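/- Let $S$ be a locally compact Hausdorff topological semigroup (the multiplication $S\times S\to S$ is jointly continuous), and let $\omega:S\to[1,\infty)$ be a Borel measurable weight, that is, $\omega(xy)\le\omega(x)\omega(y)$ for all $x,y\in S$. Put $$\Omega(x,y)=\frac{\omega(xy)}{\omega(x)\,\omega(y)}\qquad(x,y\in S),$$ and suppose that $\Omega$ is cluster on $S\times S$: for all sequences $(x_n)$ and $(y_m)$, each consisting of distinct elements of $S$, $$\lim_n\lim_m\Omega(x_n,y_m)=\lim_m\lim_n\Omega(x_n,y_m)$$ whenever both iterated limits exist. Let $M_b(S,\omega)$ be the algebra, under convolution, of the regular complex Borel measures $\mu$ on $S$ with $\|\mu\|_\omega=\int_S\omega\,d|\mu|<\infty$, and let $\ell^1(S,\omega)$ be the algebra, under convolution $(f*g)(s)=\sum_{xy=s}f(x)g(y)$, of the functions $f:S\to\mathbb C$ with $\|f\|_\omega=\sum_{s\in S}|f(s)|\,\omega(s)<\infty$; write $M_b(S)=M_b(S,1)$ and $\ell^1(S)=\ell^1(S,1)$. For a Banach algebra $A$, a functional $f\in A^*$ is weakly almost periodic if $\{f\cdot a:\|a\|\le1\}$ is relatively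 weakly compact in $A^*$, where $\langle f\cdot a,b\rangle=\langle f,ab\rangle$; $\mathrm{WAP}(A)\subseteq A^*$ is the space of these functionals, and $A$ is a WAP-algebra if the natural map $A\to\mathrm{WAP}(A)^*$ is bounded below, i.e. $\inf\{\|\iota(a)\|:\|a\|\ge1\}>0$ for this map $\iota$. Then: 1. if $M_b(S)$ is a WAP-algebra, then so is $M_b(S,\omega)$; 2. if $\ell^1(S)$ is a WAP-algebra, then so is $\ell^1(S,\omega)$. -/

import Mathlib

set_option linter.unusedSectionVars false

open MeasureTheory Filter Topology
open scoped ENNReal NNReal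

namespace WAP
/-- The dual Banach space of a complex normed space. -/
abbrev NDual (E : Type*) [NormedAddCommGroup E] [NormedSpace ℂ E] : Type _ := StrongDual ℂ E

section
variable (A : Type*) [NonUnitalNormedRing A] [NormedSpace ℂ A] [IsScalarTower ℂ A A]
  [SMulCommClass ℂ A A]

variable {A} in
/-- The module action of `A` on its dual, `⟨f · a, b⟩ = ⟨f, a b⟩`. -/
noncomputable def dualAct (f : StrongDual ℂ A) (a : A) : StrongDual ℂ A :=
  f.comp (ContinuousLinearMap.mul ℂ A a)

variable {A} in
/-- A functional `f` is weakly almost periodic if `{f · a : ‖a‖ ≤ 1}` is relatively weakly compact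
in the dual of `A`. -/
def IsWAPFunctional (f : StrongDual ℂ A) : Prop :=
  IsCompact (closure (toWeakSpace ℂ (StrongDual ℂ A) '' {g | ∃ a : A, ‖a‖ ≤ 1 ∧ dualAct f a = g}))

/-- The space `WAP(A)` of weakly almost periodic functionals. -/
noncomputable def wap : Submodule ℂ (StrongDual ℂ A) where
  carrier := {f | IsWAPFunctional f}
  zero_mem' := by
    refine (isCompact_singleton (x := toWeakSpace ℂ (StrongDual ℂ A) 0)).closure_of_subset ?_
    rintro _ ⟨_, ⟨a, -, rfl⟩, rfl⟩
    exact Set.mem_singleton_iff.2 (congrArg _ (ContinuousLinearMap.zero_comp _))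
  add_mem' {f g} hf hg := by
    refine (IsCompact.add hf hg).closure_of_subset ?_
    rintro _ ⟨_, ⟨a, ha, rfl⟩, rfl⟩
    refine ⟨_, subset_closure ⟨_, ⟨a, ha, rfl⟩, rfl⟩, _,
      subset_closure ⟨_, ⟨a, ha, rfl⟩, rfl⟩, ?_⟩
    exact (map_add _ _ _).symm.trans (congrArg _ (ContinuousLinearMap.add_comp _ _ _).symm)
  smul_mem' c f hf := by
    refine (IsCompact.smul c hf).closure_of_subset ?_
    rintro _ ⟨_, ⟨a, ha, rfl⟩, rfl⟩
    refine ⟨_, subset_closure ⟨_, ⟨a, ha, rfl⟩, rfl⟩, ?_⟩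
    exact (map_smul _ _ _).symm.trans (congrArg _ (ContinuousLinearMap.smul_comp _ _ _).symm)

variable {A} in
/-- The natural map `A → WAP(A)*`, evaluation at `a`. -/
noncomputable def wapEmbedding (a : A) : NDual (wap A) :=
  (NormedSpace.inclusionInDoubleDual ℂ A a).comp (wap A).subtypeL

/-- The algebra `A` is a WAP-algebra if the natural map `A → WAP(A)*` is bounded below, that is,
`inf {‖wapEmbedding a‖ : ‖a‖ ≥ 1} > 0`. -/
def IsWAPAlgebra : Prop :=
  ∃ c : ℝ, 0 < c ∧ ∀ a : A, 1 ≤ ‖a‖ → c ≤ ‖wapEmbedding a‖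

end

/-- A function on `X × Y` is cluster if its two iterated limits along sequences of distinct points
agree whenever both exist. -/
def IsCluster {X Y : Type*} (f : X × Y → ℂ) : Prop :=
  ∀ (x : ℕ → X) (y : ℕ → Y), Function.Injective x → Function.Injective y →
    ∀ (a b : ℕ → ℂ) (L M : ℂ),
      (∀ n, Tendsto (fun m => f (x n, y m)) atTop (𝓝 (a n))) → Tendsto a atTop (𝓝 L) →
      (∀ m, Tendsto (fun n => f (x n, y m)) atTop (𝓝 (b m))) → Tendsto b atTop (𝓝 M) → L = M

/-- A weight on a semigroup: a submultiplicative function with values in `[1, ∞)`. -/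
structure Weight (S : Type*) [Mul S] where
  toFun : S → ℝ
  one_le : ∀ x, 1 ≤ toFun x
  mul_le : ∀ x y, toFun (x * y) ≤ toFun x * toFun y

namespace Weight

variable {S : Type*} [Mul S]

instance : CoeFun (Weight S) fun _ => S → ℝ := ⟨toFun⟩

instance : One (Weight S) := ⟨⟨fun _ => 1, fun _ => le_rfl, fun _ _ => by norm_num⟩⟩

theorem pos (ω : Weight S) (x : S) : 0 < ω x := zero_lt_one.trans_le (ω.one_le x)

/-- The function `Ω(x, y) = ω(xy) / (ω(x) ω(y))`. -/
noncomputable def Omega (ω : Weight S) (p : S × S) : ℝ := ω (p.1 * p.2) / (ω p.1 * ω p.2)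

end Weight
end WAP


namespace SemigroupMeasure

variable {S : Type*} [TopologicalSpace S] [T2Space S] [MeasurableSpace S] [BorelSpace S]

theorem regular_of_le {m n : Measure S} [IsFiniteMeasure n] [n.Regular] (h : m ≤ n) :
    m.Regular := by
  have : IsFiniteMeasure m := isFiniteMeasure_of_le n h
  have key : m.InnerRegularCompactLTTop := by
    refine ⟨fun E hE r hr => ?_⟩
    have hpos : m E - r ≠ 0 := (tsub_pos_of_lt hr).ne'
    obtain ⟨K, hKE, hK, hlt⟩ := hE.1.exists_isCompact_sdiff_lt (measure_ne_top n E) hpos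
    refine ⟨K, hKE, hK, ?_⟩
    have h1 : m E ≤ m K + m (E \ K) := by
      rw [← measure_union_add_inter' hK.measurableSet]
      refine le_trans (measure_mono ?_) le_self_add
      intro x hx
      by_cases hxK : x ∈ K
      · exact Or.inl hxK
      · exact Or.inr ⟨hx, hxK⟩
    have h2 : m (E \ K) < m E - r := lt_of_le_of_lt (h _) hlt
    by_contra hcon
    have h3 : m K ≤ r := not_lt.1 hcon
    have h4 : m E < r + (m E - r) := by
      refine lt_of_le_of_lt h1 ?_
      exact ENNReal.add_lt_add_of_le_of_lt (measure_ne_top m K) h3 h2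
    rw [add_tsub_cancel_of_le hr.le] at h4
    exact lt_irrefl _ h4
  infer_instance

variable [Mul S] [ContinuousMul S]

theorem measurable_translate (x : S) : Measurable fun y : S => x * y :=
  (continuous_const_mul x).measurable

theorem isOpen_mapsTo {C U : Set S} (hC : IsCompact C) (hU : IsOpen U) :
    IsOpen {x : S | ∀ y ∈ C, x * y ∈ U} := by
  rw [isOpen_iff_forall_mem_open]
  intro x hx
  obtain ⟨u, v, hu, -, hxu, hCv, huv⟩ := generalized_tube_lemma (isCompact_singleton (x := x)) hC
    (hU.preimage continuous_mul) (by rintro ⟨a, b⟩ ⟨ha, hb⟩; obtain rfl := ha; exact hx b hb)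
  exact ⟨u, fun a ha b hb => huv (Set.mk_mem_prod ha (hCv hb)), hu, hxu rfl⟩

/-- Translates of an open set have lower semicontinuous mass. -/
theorem isOpen_lt_translate (n : Measure S) [n.Regular] {U : Set S} (hU : IsOpen U) (t : ℝ≥0∞) :
    IsOpen {x : S | t < n ((fun y => x * y) ⁻¹' U)} := by
  rw [isOpen_iff_forall_mem_open]
  intro x hx
  obtain ⟨C, hCU, hC, ht⟩ :=
    (hU.preimage (continuous_const_mul x)).exists_lt_isCompact hx
  exact ⟨{a : S | ∀ y ∈ C, a * y ∈ U},
    fun a ha => lt_of_lt_of_le ht (measure_mono fun b hb => ha b hb),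
    isOpen_mapsTo hC hU, fun b hb => hCU hb⟩

theorem measurable_measure_translate (n : Measure S) [IsFiniteMeasure n] [n.Regular] {E : Set S}
    (hE : MeasurableSet E) : Measurable fun x : S => n ((fun y => x * y) ⁻¹' E) := by
  induction E, hE using MeasurableSpace.induction_on_inter
    (BorelSpace.measurable_eq (α := S)) isPiSystem_isOpen with
  | empty => simp
  | basic U hU =>
    exact measurable_of_Ioi fun t => (isOpen_lt_translate n hU t).measurableSet
  | compl E hE ih =>
    have : (fun x : S => n ((fun y => x * y) ⁻¹' Eᶜ)) =
        fun x => n Set.univ - n ((fun y => x * y) ⁻¹' E) := by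
      funext x
      rw [Set.preimage_compl, measure_compl (measurable_translate x hE) (measure_ne_top _ _)]
    rw [this]
    exact measurable_const.sub ih
  | iUnion f hd hm ih =>
    have : (fun x : S => n ((fun y => x * y) ⁻¹' ⋃ i, f i)) =
        fun x => ∑' i, n ((fun y => x * y) ⁻¹' f i) := by
      funext x
      rw [Set.preimage_iUnion, measure_iUnion (fun i j hij => (hd hij).preimage _)
        fun i => measurable_translate x (hm i)]
    rw [this]
    exact Measurable.tsum ih

/-- The convolution of two positive measures, `E ↦ ∫ n (x⁻¹ E) dm(x)`. -/
noncomputable def posConv (m n : Measure S) : Measure S :=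
  m.bind fun x => n.map fun y => x * y

theorem measurable_map_translate (n : Measure S) [IsFiniteMeasure n] [n.Regular] :
    Measurable fun x : S => n.map fun y => x * y := by
  refine Measure.measurable_of_measurable_coe _ fun E hE => ?_
  simp_rw [Measure.map_apply (measurable_translate _) hE]
  exact measurable_measure_translate n hE

theorem posConv_apply (m n : Measure S) [IsFiniteMeasure n] [n.Regular] {E : Set S}
    (hE : MeasurableSet E) :
    posConv m n E = ∫⁻ x, n ((fun y => x * y) ⁻¹' E) ∂m := by
  rw [posConv, Measure.bind_apply hE (measurable_map_translate n).aemeasurable]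
  simp_rw [Measure.map_apply (measurable_translate _) hE]

theorem lintegral_posConv_le (m n : Measure S) (f : S → ℝ≥0∞) :
    ∫⁻ z, f z ∂(posConv m n) ≤ ∫⁻ x, ∫⁻ y, f (x * y) ∂n ∂m :=
  (Measure.lintegral_bind_le _ _ _).trans (lintegral_mono fun _ => lintegral_map_le _ _)

instance posConv_finite (m n : Measure S) [IsFiniteMeasure m] [IsFiniteMeasure n] [n.Regular] :
    IsFiniteMeasure (posConv m n) := by
  refine ⟨?_⟩
  rw [posConv_apply m n MeasurableSet.univ]
  simp only [Set.preimage_univ, lintegral_const]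
  exact ENNReal.mul_lt_top (measure_lt_top _ _) (measure_lt_top _ _)

section Regularity

variable [LocallyCompactSpace S]

theorem exists_compact_translate (n : Measure S) [n.Regular] {U K : Set S} (hU : IsOpen U)
    (hK : IsCompact K) {a : ℝ≥0∞} (h : ∀ x ∈ K, a < n ((fun y => x * y) ⁻¹' U)) :
    ∃ Q, IsCompact Q ∧ Q ⊆ U ∧ ∀ x ∈ K, a ≤ n ((fun y => x * y) ⁻¹' Q) := by
  refine hK.induction_on (p := fun K' => ∃ Q, IsCompact Q ∧ Q ⊆ U ∧
    ∀ x ∈ K', a ≤ n ((fun y => x * y) ⁻¹' Q)) ?_ ?_ ?_ ?_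
  · exact ⟨∅, isCompact_empty, Set.empty_subset _, by simp⟩
  · rintro s t hst ⟨Q, hQ, hQU, hQt⟩
    exact ⟨Q, hQ, hQU, fun x hx => hQt x (hst hx)⟩
  · rintro s t ⟨Q, hQ, hQU, hQs⟩ ⟨R, hR, hRU, hRt⟩
    refine ⟨Q ∪ R, hQ.union hR, Set.union_subset hQU hRU, ?_⟩
    rintro x (hx | hx)
    · exact (hQs x hx).trans (measure_mono fun y hy => Or.inl hy)
    · exact (hRt x hx).trans (measure_mono fun y hy => Or.inr hy)
  · intro x hx
    obtain ⟨C, hCU, hC, ht⟩ :=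
      (hU.preimage (continuous_const_mul x)).exists_lt_isCompact (h x hx)
    obtain ⟨N, hN, hNU, hNc⟩ :=
      local_compact_nhds ((isOpen_mapsTo hC hU).mem_nhds fun b hb => hCU hb)
    refine ⟨N, mem_nhdsWithin_of_mem_nhds hN, (fun p : S × S => p.1 * p.2) '' (N ×ˢ C),
      (hNc.prod hC).image continuous_mul, ?_, ?_⟩
    · rintro _ ⟨⟨b, c⟩, ⟨hb, hc⟩, rfl⟩
      exact hNU hb c hc
    · intro b hb
      exact ht.le.trans (measure_mono fun c hc => ⟨(b, c), ⟨hb, hc⟩, rfl⟩)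

/-- The convolution of two finite regular measures is regular. -/
instance posConv_regular (m n : Measure S) [IsFiniteMeasure m] [m.Regular] [IsFiniteMeasure n]
    [n.Regular] : (posConv m n).Regular := by
  have hin : (posConv m n).InnerRegularWRT IsCompact IsOpen := by
    intro U hU r hr
    rw [posConv_apply m n hU.measurableSet] at hr
    obtain ⟨e, he, hem⟩ := ENNReal.exists_nnreal_pos_mul_lt (measure_ne_top m Set.univ)
      (tsub_pos_of_lt hr).ne'
    have hr2 : r < ∫⁻ x, (n ((fun y => x * y) ⁻¹' U) - e) ∂m := by
      have h1 : ∫⁻ x, n ((fun y => x * y) ⁻¹' U) ∂m ≤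
          ∫⁻ x, (n ((fun y => x * y) ⁻¹' U) - e) ∂m + e * m Set.univ := by
        rw [← lintegral_const, ← lintegral_add_right _ measurable_const]
        exact lintegral_mono fun x => le_tsub_add
      by_contra hcon
      have h2 := h1.trans (add_le_add_left (not_lt.1 hcon) _)
      have h3 := ENNReal.add_lt_add_left (ne_top_of_lt hr) hem
      rw [add_tsub_cancel_of_le hr.le] at h3
      exact lt_irrefl _ (h2.trans_lt h3)
    rw [lintegral_def] at hr2
    simp only [lt_iSup_iff] at hr2
    obtain ⟨g, hg, hrg⟩ := hr2
    have hgU : ∀ x, g x ≠ 0 → g x < n ((fun y => x * y) ⁻¹' U) := by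
      intro x hx
      have h1 : g x ≤ n ((fun y => x * y) ⁻¹' U) - e := hg x
      refine lt_of_le_of_lt h1 (ENNReal.sub_lt_self (measure_ne_top _ _) ?_ (by simpa using he.ne'))
      intro h0
      rw [h0, zero_tsub] at h1
      exact hx (le_antisymm h1 zero_le)
    have hgfin : ∀ a ∈ g.range, a ≠ ∞ := by
      intro a ha
      obtain ⟨x, rfl⟩ := SimpleFunc.mem_range.1 ha
      exact ne_top_of_le_ne_top (measure_ne_top n _) ((hg x).trans tsub_le_self)
    rw [SimpleFunc.lintegral] at hrg
    obtain ⟨d, hd, hdm⟩ := ENNReal.exists_nnreal_pos_mul_lt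
      (ENNReal.sum_ne_top.2 hgfin) (tsub_pos_of_lt hrg).ne'
    have hK : ∀ a : ℝ≥0∞, ∃ K ⊆ g ⁻¹' {a}, IsCompact K ∧ m (g ⁻¹' {a}) < m K + d := fun a =>
      (g.measurableSet_fiber a).exists_isCompact_lt_add (measure_ne_top m _) (by simpa using hd.ne')
    choose K hKg hKc hKm using hK
    have hr3 : r < ∑ a ∈ g.range, a * m (K a) := by
      have h1 : ∑ a ∈ g.range, a * m (g ⁻¹' {a}) ≤
          ∑ a ∈ g.range, a * m (K a) + d * ∑ a ∈ g.range, a := by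
        rw [Finset.mul_sum, ← Finset.sum_add_distrib]
        refine Finset.sum_le_sum fun a _ => ?_
        rw [mul_comm (d : ℝ≥0∞) a, ← mul_add]
        exact mul_le_mul_right (hKm a).le a
      by_contra hcon
      have h2 := h1.trans (add_le_add_left (not_lt.1 hcon) _)
      have h3 := ENNReal.add_lt_add_left (ne_top_of_lt hrg) hdm
      rw [add_tsub_cancel_of_le hrg.le] at h3
      exact lt_irrefl _ (h2.trans_lt h3)
    have hQ : ∀ a : ℝ≥0∞, ∃ Q, IsCompact Q ∧ Q ⊆ U ∧
        ∀ x ∈ K a, a ≤ n ((fun y => x * y) ⁻¹' Q) := by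
      intro a
      by_cases ha : a = 0
      · exact ⟨∅, isCompact_empty, Set.empty_subset _, by simp [ha]⟩
      · refine exists_compact_translate n hU (hKc a) fun x hx => ?_
        have hxa : g x = a := hKg a hx
        rw [← hxa]
        exact hgU x (hxa ▸ ha)
    choose Q hQc hQU hQn using hQ
    refine ⟨⋃ a ∈ g.range, Q a, Set.iUnion₂_subset fun a _ => hQU a,
      g.range.isCompact_biUnion fun a _ => hQc a, ?_⟩
    rw [posConv_apply m n (g.range.isCompact_biUnion fun a _ => hQc a).measurableSet]
    refine hr3.trans_le ?_
    have h4 : ∑ a ∈ g.range, a * m (K a) =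
        ∫⁻ x, ∑ a ∈ g.range, (K a).indicator (fun _ => a) x ∂m := by
      rw [lintegral_finsetSum _ fun a _ => measurable_const.indicator (hKc a).measurableSet]
      exact Finset.sum_congr rfl fun a _ => by
        rw [lintegral_indicator_const (hKc a).measurableSet]
    rw [h4]
    refine lintegral_mono fun x => ?_
    have h5 : ∑ a ∈ g.range, (K a).indicator (fun _ => a) x =
        (K (g x)).indicator (fun _ => g x) x := by
      refine Finset.sum_eq_single (g x) (fun a _ ha => ?_) fun hx => ?_
      · exact Set.indicator_of_notMem (fun hx => ha (hKg a hx).symm) _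
      · exact absurd (SimpleFunc.mem_range_self g x) hx
    simp only [h5]
    by_cases hx : x ∈ K (g x)
    · rw [Set.indicator_of_mem hx]
      refine (hQn (g x) x hx).trans (measure_mono (Set.preimage_mono ?_))
      exact Set.subset_biUnion_of_mem (u := Q) (SimpleFunc.mem_range_self g x)
    · rw [Set.indicator_of_notMem hx]
      exact zero_le
  have : (posConv m n).WeaklyRegular :=
    Measure.InnerRegularWRT.weaklyRegular_of_finite _
      (hin.mono (fun _ h => h) fun _ h => h.isClosed)
  exact { innerRegular := hin }

end Regularity

section Complex

theorem measurable_complexMeasure_translate (v : ComplexMeasure S) [IsFiniteMeasure v.variation]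
    [v.variation.Regular] {E : Set S} (hE : MeasurableSet E) :
    Measurable fun x : S => v ((fun y => x * y) ⁻¹' E) := by
  have key : ∀ s : SignedMeasure S, s.variation ≤ v.variation →
      Measurable fun x : S => s ((fun y => x * y) ⁻¹' E) := by
    intro s hs
    rw [← SignedMeasure.totalVariation_eq_variation, SignedMeasure.totalVariation] at hs
    have : s.toJordanDecomposition.posPart.Regular :=
      regular_of_le ((Measure.le_add_right le_rfl).trans hs)
    have : s.toJordanDecomposition.negPart.Regular :=
      regular_of_le ((Measure.le_add_left le_rfl).trans hs)
    have h : (fun x : S => s ((fun y => x * y) ⁻¹' E)) = fun x =>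
        (s.toJordanDecomposition.posPart ((fun y => x * y) ⁻¹' E)).toReal -
          (s.toJordanDecomposition.negPart ((fun y => x * y) ⁻¹' E)).toReal := by
      funext x
      conv_lhs => rw [← SignedMeasure.toSignedMeasure_toJordanDecomposition s]
      rw [JordanDecomposition.toSignedMeasure, sub_apply,
        Measure.toSignedMeasure_apply_measurable (measurable_translate x hE),
        Measure.toSignedMeasure_apply_measurable (measurable_translate x hE)]
      rfl
    rw [h]
    exact (measurable_measure_translate _ hE).ennreal_toReal.sub
      (measurable_measure_translate _ hE).ennreal_toReal
  have hre := key (ComplexMeasure.re v) (VectorMeasure.variation_le_of_forall_enorm_le fun A _ => by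
    refine le_trans ?_ (VectorMeasure.enorm_measure_le_variation v A)
    rw [← ofReal_norm, ← ofReal_norm]
    exact ENNReal.ofReal_le_ofReal (Complex.abs_re_le_norm (v A)))
  have him := key (ComplexMeasure.im v) (VectorMeasure.variation_le_of_forall_enorm_le fun A _ => by
    refine le_trans ?_ (VectorMeasure.enorm_measure_le_variation v A)
    rw [← ofReal_norm, ← ofReal_norm]
    exact ENNReal.ofReal_le_ofReal (Complex.abs_im_le_norm (v A)))
  have h : (fun x : S => v ((fun y => x * y) ⁻¹' E)) = fun x =>
      ((ComplexMeasure.re v ((fun y => x * y) ⁻¹' E) : ℝ) : ℂ) +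
        ((ComplexMeasure.im v ((fun y => x * y) ⁻¹' E) : ℝ) : ℂ) * Complex.I := by
    funext x
    exact (Complex.re_add_im _).symm
  rw [h]
  exact (Complex.measurable_ofReal.comp hre).add
    ((Complex.measurable_ofReal.comp him).mul_const _)

theorem norm_complexMeasure_le (v : ComplexMeasure S) [IsFiniteMeasure v.variation] (E : Set S) :
    ‖v E‖ ≤ v.variation.real Set.univ :=
  (VectorMeasure.norm_measure_le_variation).trans (measureReal_mono (Set.subset_univ E))

/-- The integral `∫ f dv` of a complex function against a complex measure. -/
noncomputable def cintegral (v : ComplexMeasure S) (f : S → ℂ) : ℂ :=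
  v.integral f (ContinuousLinearMap.mul ℝ ℂ)

theorem enorm_cintegral_le (v : ComplexMeasure S) (f : S → ℂ) :
    ‖cintegral v f‖ₑ ≤ ∫⁻ x, ‖f x‖ₑ ∂v.variation := by
  refine VectorMeasure.enorm_integral_le_lintegral_enorm.trans ?_
  have h : ‖ContinuousLinearMap.mul ℝ ℂ‖ₑ = 1 := by
    rw [← ofReal_norm, ContinuousLinearMap.opNorm_mul, ENNReal.ofReal_one]
  rw [h, one_mul]

theorem norm_cintegral_le (v : ComplexMeasure S) [IsFiniteMeasure v.variation] {f : S → ℂ} {C : ℝ}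
    (hf : ∀ x, ‖f x‖ ≤ C) : ‖cintegral v f‖ ≤ C * v.variation.real Set.univ := by
  have h := VectorMeasure.norm_integral_le_of_norm_le_const (μ := v)
    (B := ContinuousLinearMap.mul ℝ ℂ) (Eventually.of_forall hf)
  rw [ContinuousLinearMap.opNorm_mul] at h
  simpa [cintegral] using h

theorem cintegral_indicator (v : ComplexMeasure S) [IsFiniteMeasure v.variation] {E : Set S}
    (hE : MeasurableSet E) (c : ℂ) : cintegral v (E.indicator fun _ => c) = c * v E := by
  rw [cintegral, VectorMeasure.integral_eq_setToFun,
    setToFun_indicator_const _ hE (measure_ne_top _ _)]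
  rfl

theorem integrable_of_bdd (v : ComplexMeasure S) [IsFiniteMeasure v.variation] {f : S → ℂ}
    (hf : Measurable f) {C : ℝ} (hC : ∀ x, ‖f x‖ ≤ C) : v.Integrable f :=
  Integrable.of_bound hf.aestronglyMeasurable C (Eventually.of_forall hC)

theorem cintegral_add (v : ComplexMeasure S) {f g : S → ℂ}
    (hf : v.Integrable f) (hg : v.Integrable g) :
    cintegral v (fun x => f x + g x) = cintegral v f + cintegral v g :=
  VectorMeasure.integral_add hf hg

theorem tendsto_cintegral (v : ComplexMeasure S) [IsFiniteMeasure v.variation] {F : ℕ → S → ℂ}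
    {f : S → ℂ} {C : ℝ} (hF : ∀ n, Measurable (F n)) (hC : ∀ n x, ‖F n x‖ ≤ C)
    (hlim : ∀ x, Tendsto (fun n => F n x) atTop (𝓝 (f x))) :
    Tendsto (fun n => cintegral v (F n)) atTop (𝓝 (cintegral v f)) :=
  VectorMeasure.tendsto_integral_filter_of_norm_le_const
    (Eventually.of_forall fun n => (hF n).aestronglyMeasurable)
    ⟨C, Eventually.of_forall fun n => Eventually.of_forall fun x => hC n x⟩
    (Eventually.of_forall hlim)

theorem bdd_induction {P : (S → ℂ) → Prop}
    (hind : ∀ (c : ℂ) (E : Set S), MeasurableSet E → P (E.indicator fun _ => c))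
    (hadd : ∀ (f g : S → ℂ) (C D : ℝ), Measurable f → Measurable g → (∀ x, ‖f x‖ ≤ C) →
      (∀ x, ‖g x‖ ≤ D) → P f → P g → P fun x => f x + g x)
    (hlim : ∀ (F : ℕ → S → ℂ) (f : S → ℂ) (C : ℝ), (∀ n, Measurable (F n)) →
      (∀ n x, ‖F n x‖ ≤ C) → (∀ x, Tendsto (fun n => F n x) atTop (𝓝 (f x))) →
      (∀ n, P (F n)) → P f)
    {f : S → ℂ} (hf : Measurable f) {C : ℝ} (hC : ∀ x, ‖f x‖ ≤ C) : P f := by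
  have hsimple : ∀ g : SimpleFunc S ℂ, P g := by
    intro g
    induction g using SimpleFunc.induction with
    | const c hE =>
      rw [SimpleFunc.coe_piecewise, SimpleFunc.coe_const, SimpleFunc.coe_const,
        Function.const_zero]
      classical
      rw [Set.piecewise_eq_indicator]
      exact hind c _ hE
    | @add f g _ hf hg =>
      obtain ⟨C, hC⟩ := f.exists_forall_norm_le
      obtain ⟨D, hD⟩ := g.exists_forall_norm_le
      exact hadd f g C D f.measurable g.measurable hC hD hf hg
  have hC0 : ∀ x, ‖f x‖ ≤ max C 0 := fun x => (hC x).trans (le_max_left _ _)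
  exact hlim (fun n => hf.stronglyMeasurable.approxBounded (max C 0) n) f (max C 0)
    (fun n => SimpleFunc.measurable _)
    (fun n x => hf.stronglyMeasurable.norm_approxBounded_le (le_max_right _ _) n x)
    (fun x => hf.stronglyMeasurable.tendsto_approxBounded_of_norm_le (hC0 x))
    (fun n => hsimple _)

theorem cintegral_const_mul (v : ComplexMeasure S) [IsFiniteMeasure v.variation] (c : ℂ)
    {f : S → ℂ} (hf : Measurable f) {C : ℝ} (hC : ∀ x, ‖f x‖ ≤ C) :
    cintegral v (fun x => c * f x) = c * cintegral v f := by
  refine bdd_induction (P := fun f => cintegral v (fun x => c * f x) = c * cintegral v f)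
    ?_ ?_ ?_ hf hC
  · intro a E hE
    have h : (fun x => c * E.indicator (fun _ => a) x) = E.indicator fun _ => c * a := by
      funext x
      by_cases hx : x ∈ E <;> simp [hx]
    rw [h, cintegral_indicator v hE, cintegral_indicator v hE, mul_assoc]
  · intro f g C D hf hg hC hD hPf hPg
    have h1 : ∀ (f : S → ℂ) (C : ℝ), Measurable f → (∀ x, ‖f x‖ ≤ C) →
        v.Integrable fun x => c * f x := fun f C hf hC => (integrable_of_bdd v hf hC).const_mul c
    simp only [mul_add]
    rw [cintegral_add v (h1 f C hf hC) (h1 g D hg hD), hPf, hPg,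
      cintegral_add v (integrable_of_bdd v hf hC) (integrable_of_bdd v hg hD), mul_add]
  · intro F f C hF hC hlim hP
    have h1 := tendsto_cintegral v (F := fun n x => c * F n x) (f := fun x => c * f x)
      (C := ‖c‖ * C) (fun n => (hF n).const_mul c)
      (fun n x => by rw [norm_mul]; exact mul_le_mul_of_nonneg_left (hC n x) (norm_nonneg c))
      (fun x => (hlim x).const_mul c)
    simp only [hP] at h1
    exact tendsto_nhds_unique h1 ((tendsto_cintegral v hF hC hlim).const_mul c)

theorem cintegral_smul_measure (v : ComplexMeasure S) [IsFiniteMeasure v.variation] (c : ℂ)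
    {f : S → ℂ} (hf : Measurable f) {C : ℝ} (hC : ∀ x, ‖f x‖ ≤ C) :
    cintegral (c • v) f = c * cintegral v f := by
  refine bdd_induction (P := fun f => cintegral (c • v) f = c * cintegral v f) ?_ ?_ ?_ hf hC
  · intro a E hE
    rw [cintegral_indicator _ hE, cintegral_indicator v hE, smul_apply, smul_eq_mul]
    ring
  · intro f g C D hf hg hC hD hPf hPg
    rw [cintegral_add _ (integrable_of_bdd _ hf hC) (integrable_of_bdd _ hg hD), hPf, hPg,
      cintegral_add v (integrable_of_bdd v hf hC) (integrable_of_bdd v hg hD), mul_add]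
  · intro F f C hF hC hlim hP
    have h1 := tendsto_cintegral (c • v) hF hC hlim
    simp only [hP] at h1
    exact tendsto_nhds_unique h1 ((tendsto_cintegral v hF hC hlim).const_mul c)

theorem cintegral_add_measure (u v : ComplexMeasure S) {f : S → ℂ} (hu : u.Integrable f)
    (hv : v.Integrable f) : cintegral (u + v) f = cintegral u f + cintegral v f :=
  VectorMeasure.integral_add_vectorMeasure hu hv

open scoped Classical in
/-- The convolution of complex measures: `(u ∗ v)(E) = ∫ v(x⁻¹ E) du(x)`, where
`x⁻¹ E = {y | x y ∈ E}`. -/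
noncomputable def conv (u v : ComplexMeasure S) [IsFiniteMeasure u.variation]
    [IsFiniteMeasure v.variation] [v.variation.Regular] : ComplexMeasure S where
  measureOf' E := if MeasurableSet E then cintegral u fun x => v ((fun y => x * y) ⁻¹' E) else 0
  empty' := by simp [cintegral]
  not_measurable' := by simp +contextual
  m_iUnion' f hm hd := by
    simp only [hm, ↓reduceIte, implies_true, MeasurableSet.iUnion, Set.preimage_iUnion]
    simp only [HasSum, SummationFilter.unconditional_filter]
    have A (a : Finset ℕ) : ∑ i ∈ a, cintegral u (fun x => v ((fun y => x * y) ⁻¹' f i))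
        = cintegral u fun x => ∑ i ∈ a, v ((fun y => x * y) ⁻¹' f i) := by
      simp only [cintegral]
      rw [VectorMeasure.integral_finsetSum _ fun i _ => ?_]
      exact Integrable.of_bound
        (measurable_complexMeasure_translate v (hm i)).aestronglyMeasurable _
        (Eventually.of_forall fun x => norm_complexMeasure_le v _)
    simp_rw [A]
    refine VectorMeasure.tendsto_integral_filter_of_norm_le_const
      (Eventually.of_forall fun a => ?_)
      ⟨v.variation.real Set.univ, Eventually.of_forall fun a => Eventually.of_forall fun x => ?_⟩
      (Eventually.of_forall fun x => ?_)
    · exact (Finset.measurable_sum a fun i _ =>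
        measurable_complexMeasure_translate v (hm i)).aestronglyMeasurable
    · rw [← VectorMeasure.of_biUnion_finset]
      · exact norm_complexMeasure_le v _
      · exact fun i _ j _ hij => (hd hij).preimage _
      · exact fun i _ => measurable_translate x (hm i)
    · exact VectorMeasure.hasSum_of_disjoint_iUnion (fun i => measurable_translate x (hm i))
        fun i j hij => (hd hij).preimage _

section Conv

variable (u v w : ComplexMeasure S) [IsFiniteMeasure u.variation] [IsFiniteMeasure v.variation]
  [IsFiniteMeasure w.variation] [v.variation.Regular] [w.variation.Regular]

theorem conv_apply {E : Set S} (hE : MeasurableSet E) :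
    conv u v E = cintegral u fun x => v ((fun y => x * y) ⁻¹' E) :=
  if_pos hE

theorem variation_conv_le : (conv u v).variation ≤ posConv u.variation v.variation := by
  refine VectorMeasure.variation_le_of_forall_enorm_le fun E hE => ?_
  rw [conv_apply u v hE, posConv_apply _ _ hE]
  exact (enorm_cintegral_le u _).trans
    (lintegral_mono fun x => VectorMeasure.enorm_measure_le_variation v _)

instance conv_finite : IsFiniteMeasure (conv u v).variation :=
  isFiniteMeasure_of_le _ (variation_conv_le u v)

instance conv_regular [LocallyCompactSpace S] [u.variation.Regular] :
    (conv u v).variation.Regular :=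
  regular_of_le (variation_conv_le u v)

/-- Integration against a convolution. -/
theorem cintegral_conv {f : S → ℂ} (hf : Measurable f) {C : ℝ} (hC : ∀ x, ‖f x‖ ≤ C) :
    Measurable (fun x => cintegral v fun y => f (x * y)) ∧
      cintegral (conv u v) f = cintegral u fun x => cintegral v fun y => f (x * y) := by
  refine bdd_induction (P := fun f => Measurable (fun x => cintegral v fun y => f (x * y)) ∧
      cintegral (conv u v) f = cintegral u fun x => cintegral v fun y => f (x * y))
    ?_ ?_ ?_ hf hC
  · intro c E hE
    have h : (fun x => cintegral v fun y => E.indicator (fun _ => c) (x * y)) =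
        fun x => c * v ((fun y => x * y) ⁻¹' E) := by
      funext x
      exact cintegral_indicator v (measurable_translate x hE) c
    rw [h]
    refine ⟨(measurable_complexMeasure_translate v hE).const_mul c, ?_⟩
    rw [cintegral_indicator _ hE, conv_apply u v hE,
      cintegral_const_mul u c (measurable_complexMeasure_translate v hE)
        fun x => norm_complexMeasure_le v _]
  · intro f g C D hf hg hC hD hPf hPg
    have h : (fun x => cintegral v fun y => f (x * y) + g (x * y)) = fun x =>
        (cintegral v fun y => f (x * y)) + cintegral v fun y => g (x * y) := by
      funext x
      exact cintegral_add v
        (integrable_of_bdd v (hf.comp (measurable_translate x)) fun y => hC _)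
        (integrable_of_bdd v (hg.comp (measurable_translate x)) fun y => hD _)
    rw [h]
    refine ⟨hPf.1.add hPg.1, ?_⟩
    rw [cintegral_add _ (integrable_of_bdd _ hf hC) (integrable_of_bdd _ hg hD), hPf.2, hPg.2,
      cintegral_add u (integrable_of_bdd u hPf.1 fun x => norm_cintegral_le v fun y => hC _)
        (integrable_of_bdd u hPg.1 fun x => norm_cintegral_le v fun y => hD _)]
  · intro F f C hF hC hlim hP
    have h1 : ∀ x, Tendsto (fun n => cintegral v fun y => F n (x * y)) atTop
        (𝓝 (cintegral v fun y => f (x * y))) := fun x =>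
      tendsto_cintegral v (fun n => (hF n).comp (measurable_translate x)) (fun n y => hC n _)
        fun y => hlim _
    refine ⟨measurable_of_tendsto_metrizable (fun n => (hP n).1) (tendsto_pi_nhds.2 h1), ?_⟩
    have h2 := tendsto_cintegral (conv u v) hF hC hlim
    simp only [(hP _).2] at h2
    exact tendsto_nhds_unique h2 (tendsto_cintegral u (fun n => (hP n).1)
      (fun n x => norm_cintegral_le v fun y => hC n _) h1)

end Conv

end Complex

end SemigroupMeasure

section MeasureAlgebra

open WAP SemigroupMeasure

/-- The complex Borel measures `v` on `S` such that `|v|` is regular and `∫ ω d|v| < ∞`. -/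
noncomputable def weightedMeasures {S : Type*} [TopologicalSpace S] [T2Space S] [MeasurableSpace S]
    [BorelSpace S] [Mul S] (ω : Weight S) : Submodule ℂ (ComplexMeasure S) where
  carrier := {v | v.variation.Regular ∧ ∫⁻ x, ENNReal.ofReal (ω x) ∂v.variation < ∞}
  zero_mem' := by
    refine ⟨?_, ?_⟩
    · rw [VectorMeasure.variation_zero]
      infer_instance
    · rw [VectorMeasure.variation_zero, lintegral_zero_measure]
      exact ENNReal.zero_lt_top
  add_mem' {u v} hu hv := by
    have hfin : ∀ w : ComplexMeasure S, ∫⁻ x, ENNReal.ofReal (ω x) ∂w.variation < ∞ →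
        IsFiniteMeasure w.variation := fun w hw => ⟨by
      rw [← lintegral_one]
      exact (lintegral_mono fun x => ENNReal.one_le_ofReal.2 (ω.one_le x)).trans_lt hw⟩
    have := hfin u hu.2
    have := hfin v hv.2
    have := hu.1
    have := hv.1
    have hle := VectorMeasure.variation_add_le (μ := u) (ν := v)
    refine ⟨?_, ?_⟩
    · have : (u.variation + v.variation).InnerRegular := inferInstance
      have : (u.variation + v.variation).Regular := inferInstance
      exact regular_of_le hle
    · refine (lintegral_mono' hle le_rfl).trans_lt ?_
      rw [lintegral_add_measure]
      exact ENNReal.add_lt_top.2 ⟨hu.2, hv.2⟩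
  smul_mem' c v hv := by
    have := hv.1
    refine ⟨?_, ?_⟩
    · rw [VectorMeasure.variation_smul]
      infer_instance
    · rw [VectorMeasure.variation_smul, lintegral_smul_measure]
      exact ENNReal.mul_lt_top ENNReal.coe_lt_top hv.2

/-- The weighted measure algebra `M_b(S, ω)`. -/
def WeightedMeasureAlgebra {S : Type*} [TopologicalSpace S] [T2Space S] [MeasurableSpace S]
    [BorelSpace S] [Mul S] (ω : Weight S) : Type _ := ↥(weightedMeasures ω)

namespace WeightedMeasureAlgebra

variable {S : Type*} [TopologicalSpace S] [T2Space S] [MeasurableSpace S] [BorelSpace S]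

section Norm

variable [Mul S] {ω : Weight S}

/-- The underlying complex measure. -/
def toMeasure (v : WeightedMeasureAlgebra ω) : ComplexMeasure S := v.1

noncomputable instance : AddCommGroup (WeightedMeasureAlgebra ω) :=
  inferInstanceAs (AddCommGroup ↥(weightedMeasures ω))

noncomputable instance : Module ℂ (WeightedMeasureAlgebra ω) :=
  inferInstanceAs (Module ℂ ↥(weightedMeasures ω))

theorem ext {u v : WeightedMeasureAlgebra ω} (h : u.toMeasure = v.toMeasure) : u = v :=
  Subtype.ext h

theorem toMeasure_add (u v : WeightedMeasureAlgebra ω) :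
    (u + v).toMeasure = u.toMeasure + v.toMeasure := rfl

theorem toMeasure_smul (c : ℂ) (v : WeightedMeasureAlgebra ω) :
    (c • v).toMeasure = c • v.toMeasure := rfl

instance (v : WeightedMeasureAlgebra ω) : v.toMeasure.variation.Regular := v.2.1

theorem lintegral_lt_top (v : WeightedMeasureAlgebra ω) :
    ∫⁻ x, ENNReal.ofReal (ω x) ∂v.toMeasure.variation < ∞ := v.2.2

theorem variation_univ_le (v : WeightedMeasureAlgebra ω) :
    v.toMeasure.variation Set.univ ≤ ∫⁻ x, ENNReal.ofReal (ω x) ∂v.toMeasure.variation := by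
  rw [← lintegral_one]
  exact lintegral_mono fun x => ENNReal.one_le_ofReal.2 (ω.one_le x)

instance (v : WeightedMeasureAlgebra ω) : IsFiniteMeasure v.toMeasure.variation :=
  ⟨v.variation_univ_le.trans_lt v.lintegral_lt_top⟩

/-- The norm `‖v‖ = ∫ ω d|v|`. -/
noncomputable instance : Norm (WeightedMeasureAlgebra ω) :=
  ⟨fun v => (∫⁻ x, ENNReal.ofReal (ω x) ∂v.toMeasure.variation).toReal⟩

theorem norm_def (v : WeightedMeasureAlgebra ω) :
    ‖v‖ = (∫⁻ x, ENNReal.ofReal (ω x) ∂v.toMeasure.variation).toReal := rfl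

theorem norm_smul_eq (c : ℂ) (v : WeightedMeasureAlgebra ω) : ‖c • v‖ = ‖c‖ * ‖v‖ := by
  rw [norm_def, norm_def, toMeasure_smul, VectorMeasure.variation_smul, lintegral_smul_measure]
  exact ENNReal.toReal_mul

noncomputable instance : NormedAddCommGroup (WeightedMeasureAlgebra ω) :=
  AddGroupNorm.toNormedAddCommGroup
    { toFun := fun v => ‖v‖
      map_zero' := by simpa using norm_smul_eq (ω := ω) 0 0
      add_le' := fun u v => by
        have h : ∫⁻ x, ENNReal.ofReal (ω x) ∂(u + v).toMeasure.variation ≤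
            ∫⁻ x, ENNReal.ofReal (ω x) ∂u.toMeasure.variation +
              ∫⁻ x, ENNReal.ofReal (ω x) ∂v.toMeasure.variation := by
          rw [← lintegral_add_measure]
          exact lintegral_mono' VectorMeasure.variation_add_le le_rfl
        rw [norm_def, norm_def, norm_def,
          ← ENNReal.toReal_add u.lintegral_lt_top.ne v.lintegral_lt_top.ne]
        exact ENNReal.toReal_mono
          (ENNReal.add_lt_top.2 ⟨u.lintegral_lt_top, v.lintegral_lt_top⟩).ne h
      neg' := fun v => by
        have h := norm_smul_eq (-1) v
        rwa [neg_one_smul, norm_neg, norm_one, one_mul] at h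
      eq_zero_of_map_eq_zero' := fun v hv => by
        have h1 : ∫⁻ x, ENNReal.ofReal (ω x) ∂v.toMeasure.variation = 0 :=
          ((ENNReal.toReal_eq_zero_iff _).1 hv).resolve_right v.lintegral_lt_top.ne
        have h2 : v.toMeasure.variation = 0 :=
          Measure.measure_univ_eq_zero.1 (le_antisymm (h1 ▸ v.variation_univ_le) zero_le)
        exact ext (VectorMeasure.variation_eq_zero.1 h2) }

noncomputable instance : NormedSpace ℂ (WeightedMeasureAlgebra ω) where
  norm_smul_le c v := (norm_smul_eq c v).le

end Norm

section Mul

variable [LocallyCompactSpace S] [Semigroup S] [ContinuousMul S] {ω : Weight S}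

theorem lintegral_conv_le (u v : WeightedMeasureAlgebra ω) :
    ∫⁻ x, ENNReal.ofReal (ω x) ∂(conv u.toMeasure v.toMeasure).variation ≤
      (∫⁻ x, ENNReal.ofReal (ω x) ∂u.toMeasure.variation) *
        ∫⁻ x, ENNReal.ofReal (ω x) ∂v.toMeasure.variation := by
  refine (lintegral_mono' (variation_conv_le _ _) le_rfl).trans ?_
  refine (lintegral_posConv_le _ _ _).trans ?_
  rw [← lintegral_mul_const' _ _ v.lintegral_lt_top.ne]
  refine lintegral_mono fun x => ?_
  rw [← lintegral_const_mul' _ _ ENNReal.ofReal_ne_top]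
  refine lintegral_mono fun y => ?_
  rw [← ENNReal.ofReal_mul (ω.pos x).le]
  exact ENNReal.ofReal_le_ofReal (ω.mul_le x y)

/-- The product is convolution. -/
noncomputable instance : Mul (WeightedMeasureAlgebra ω) :=
  ⟨fun u v => ⟨conv u.toMeasure v.toMeasure, conv_regular _ _,
    (lintegral_conv_le u v).trans_lt (ENNReal.mul_lt_top u.lintegral_lt_top v.lintegral_lt_top)⟩⟩

theorem toMeasure_mul (u v : WeightedMeasureAlgebra ω) :
    (u * v).toMeasure = conv u.toMeasure v.toMeasure := rfl

theorem mul_apply (u v : WeightedMeasureAlgebra ω) {E : Set S} (hE : MeasurableSet E) :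
    (u * v).toMeasure E =
      cintegral u.toMeasure fun x => v.toMeasure ((fun y => x * y) ⁻¹' E) :=
  conv_apply _ _ hE

theorem integrable_translate (u v : WeightedMeasureAlgebra ω) {E : Set S} (hE : MeasurableSet E) :
    u.toMeasure.Integrable fun x => v.toMeasure ((fun y => x * y) ⁻¹' E) :=
  integrable_of_bdd _ (measurable_complexMeasure_translate _ hE) fun _ => norm_complexMeasure_le _ _

theorem cintegral_mul (u v : WeightedMeasureAlgebra ω) {f : S → ℂ} (hf : Measurable f) {C : ℝ}
    (hC : ∀ x, ‖f x‖ ≤ C) : cintegral (u * v).toMeasure f =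
      cintegral u.toMeasure fun x => cintegral v.toMeasure fun y => f (x * y) :=
  (cintegral_conv u.toMeasure v.toMeasure hf hC).2

noncomputable instance : NonUnitalNormedRing (WeightedMeasureAlgebra ω) where
  __ := (inferInstance : NormedAddCommGroup (WeightedMeasureAlgebra ω))
  mul := (· * ·)
  left_distrib u v w := by
    refine ext (VectorMeasure.ext fun E hE => ?_)
    rw [toMeasure_add, add_apply, mul_apply _ _ hE, mul_apply _ _ hE, mul_apply _ _ hE,
      ← cintegral_add _ (integrable_translate u v hE) (integrable_translate u w hE)]
    rfl
  right_distrib u v w := by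
    refine ext (VectorMeasure.ext fun E hE => ?_)
    rw [toMeasure_add, add_apply, mul_apply _ _ hE, mul_apply _ _ hE, mul_apply _ _ hE]
    exact cintegral_add_measure _ _ (integrable_translate u w hE) (integrable_translate v w hE)
  zero_mul u := by
    refine ext (VectorMeasure.ext fun E hE => ?_)
    rw [mul_apply _ _ hE]
    exact VectorMeasure.integral_zero_vectorMeasure
  mul_zero u := by
    refine ext (VectorMeasure.ext fun E hE => ?_)
    rw [mul_apply _ _ hE]
    exact VectorMeasure.integral_zero
  mul_assoc u v w := by
    refine ext (VectorMeasure.ext fun E hE => ?_)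
    rw [mul_apply _ _ hE, mul_apply _ _ hE,
      cintegral_mul _ _ (measurable_complexMeasure_translate _ hE)
        fun x => norm_complexMeasure_le _ _]
    congr 1
    funext x
    rw [mul_apply _ _ (measurable_translate x hE)]
    congr 1
    funext y
    congr 1
    ext z
    simp only [Set.mem_preimage, mul_assoc]
  dist_eq u v := dist_eq_norm_neg_add u v
  norm_mul_le u v := by
    rw [norm_def, norm_def, norm_def, ← ENNReal.toReal_mul]
    exact ENNReal.toReal_mono
      (ENNReal.mul_lt_top u.lintegral_lt_top v.lintegral_lt_top).ne (lintegral_conv_le u v)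

instance : IsScalarTower ℂ (WeightedMeasureAlgebra ω) (WeightedMeasureAlgebra ω) where
  smul_assoc c u v := by
    refine ext (VectorMeasure.ext fun E hE => ?_)
    rw [smul_eq_mul, smul_eq_mul, toMeasure_smul, smul_apply, mul_apply _ _ hE, mul_apply _ _ hE]
    exact cintegral_smul_measure u.toMeasure c (measurable_complexMeasure_translate _ hE)
      fun x => norm_complexMeasure_le _ _

instance : SMulCommClass ℂ (WeightedMeasureAlgebra ω) (WeightedMeasureAlgebra ω) where
  smul_comm c u v := by
    refine ext (VectorMeasure.ext fun E hE => ?_)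
    rw [smul_eq_mul, smul_eq_mul, toMeasure_smul, smul_apply, mul_apply _ _ hE, mul_apply _ _ hE]
    exact (cintegral_const_mul u.toMeasure c (measurable_complexMeasure_translate _ hE)
      fun x => norm_complexMeasure_le _ _).symm

end Mul

end WeightedMeasureAlgebra

/-- The measure algebra `M_b(S)`. -/
abbrev MeasureAlgebra (S : Type*) [TopologicalSpace S] [T2Space S] [MeasurableSpace S]
    [BorelSpace S] [Mul S] : Type _ := WeightedMeasureAlgebra (1 : Weight S)

end MeasureAlgebra

section SemigroupAlgebra

open WAP

/-- The functions `f` on `S` with `∑ |f(s)| ω(s) < ∞`. -/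
noncomputable def weightedSummable {S : Type*} [Mul S] (ω : Weight S) : Submodule ℂ (S → ℂ) where
  carrier := {f | Summable fun s => ‖f s‖ * ω s}
  zero_mem' := by
    refine Summable.congr summable_zero fun s => ?_
    rw [Pi.zero_apply, norm_zero, zero_mul]
  add_mem' {f g} hf hg := by
    refine Summable.of_nonneg_of_le (fun s => mul_nonneg (norm_nonneg _) (ω.pos s).le)
      (fun s => ?_) (Summable.add hf hg)
    rw [← add_mul]
    exact mul_le_mul_of_nonneg_right (norm_add_le _ _) (ω.pos s).le
  smul_mem' c f hf := by
    refine Summable.congr (Summable.mul_left ‖c‖ hf) fun s => ?_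
    rw [Pi.smul_apply, norm_smul, mul_assoc]

/-- The weighted semigroup algebra `ℓ¹(S, ω)`. -/
def WeightedSemigroupAlgebra {S : Type*} [Mul S] (ω : Weight S) : Type _ :=
  ↥(weightedSummable ω)

namespace WeightedSemigroupAlgebra

section Norm

variable {S : Type*} [Mul S] {ω : Weight S}

/-- The underlying function. -/
def coeff (f : WeightedSemigroupAlgebra ω) : S → ℂ := f.1

noncomputable instance : AddCommGroup (WeightedSemigroupAlgebra ω) :=
  inferInstanceAs (AddCommGroup ↥(weightedSummable ω))

noncomputable instance : Module ℂ (WeightedSemigroupAlgebra ω) :=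
  inferInstanceAs (Module ℂ ↥(weightedSummable ω))

theorem ext {f g : WeightedSemigroupAlgebra ω} (h : ∀ s, f.coeff s = g.coeff s) : f = g :=
  Subtype.ext (funext h)

theorem coeff_add (f g : WeightedSemigroupAlgebra ω) (s : S) :
    (f + g).coeff s = f.coeff s + g.coeff s := rfl

theorem coeff_smul (c : ℂ) (f : WeightedSemigroupAlgebra ω) (s : S) :
    (c • f).coeff s = c * f.coeff s := rfl

theorem coeff_zero (s : S) : (0 : WeightedSemigroupAlgebra ω).coeff s = 0 := rfl

theorem summable_weight (f : WeightedSemigroupAlgebra ω) : Summable fun s => ‖f.coeff s‖ * ω s :=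
  f.2

theorem summable_norm (f : WeightedSemigroupAlgebra ω) : Summable fun s => ‖f.coeff s‖ :=
  Summable.of_nonneg_of_le (fun _ => norm_nonneg _)
    (fun s => le_mul_of_one_le_right (norm_nonneg _) (ω.one_le s)) f.summable_weight

/-- The norm `‖f‖ = ∑ |f(s)| ω(s)`. -/
noncomputable instance : Norm (WeightedSemigroupAlgebra ω) :=
  ⟨fun f => ∑' s, ‖f.coeff s‖ * ω s⟩

theorem norm_def (f : WeightedSemigroupAlgebra ω) : ‖f‖ = ∑' s, ‖f.coeff s‖ * ω s := rfl

theorem norm_smul_eq (c : ℂ) (f : WeightedSemigroupAlgebra ω) : ‖c • f‖ = ‖c‖ * ‖f‖ := by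
  rw [norm_def, norm_def, ← tsum_mul_left]
  refine tsum_congr fun s => ?_
  rw [coeff_smul, norm_mul, mul_assoc]

noncomputable instance : NormedAddCommGroup (WeightedSemigroupAlgebra ω) :=
  AddGroupNorm.toNormedAddCommGroup
    { toFun := fun f => ‖f‖
      map_zero' := by simpa using norm_smul_eq (ω := ω) 0 0
      add_le' := fun f g => by
        rw [norm_def, norm_def, norm_def, ← f.summable_weight.tsum_add g.summable_weight]
        refine (f + g).summable_weight.tsum_le_tsum (fun s => ?_)
          (f.summable_weight.add g.summable_weight)
        rw [← add_mul]
        exact mul_le_mul_of_nonneg_right (norm_add_le _ _) (ω.pos s).le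
      neg' := fun f => by
        have h := norm_smul_eq (-1) f
        rwa [neg_one_smul, norm_neg, norm_one, one_mul] at h
      eq_zero_of_map_eq_zero' := fun f hf => by
        refine ext fun s => ?_
        have h0 : HasSum (fun s => ‖f.coeff s‖ * ω s) ‖f‖ := f.summable_weight.hasSum
        rw [show ‖f‖ = 0 from hf] at h0
        have h := (hasSum_zero_iff_of_nonneg
          fun s => mul_nonneg (norm_nonneg (f.coeff s)) (ω.pos s).le).1 h0
        have hs : ‖f.coeff s‖ * ω s = 0 := congrFun h s
        exact norm_eq_zero.1 ((mul_eq_zero.1 hs).resolve_right (ω.pos s).ne') }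

noncomputable instance : NormedSpace ℂ (WeightedSemigroupAlgebra ω) where
  norm_smul_le c f := (norm_smul_eq c f).le

theorem summable_prod_weight (f g : WeightedSemigroupAlgebra ω) :
    Summable fun p : S × S => ‖f.coeff p.1 * g.coeff p.2‖ * (ω p.1 * ω p.2) := by
  refine (f.summable_weight.mul_of_nonneg g.summable_weight
    (fun s => mul_nonneg (norm_nonneg _) (ω.pos s).le)
    (fun s => mul_nonneg (norm_nonneg _) (ω.pos s).le)).congr fun p => ?_
  rw [norm_mul]
  ring

theorem summable_prod_norm (f g : WeightedSemigroupAlgebra ω) :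
    Summable fun p : S × S => ‖f.coeff p.1 * g.coeff p.2‖ :=
  Summable.of_nonneg_of_le (fun _ => norm_nonneg _)
    (fun _ => le_mul_of_one_le_right (norm_nonneg _)
      (one_le_mul_of_one_le_of_one_le (ω.one_le _) (ω.one_le _))) (f.summable_prod_weight g)

/-- The convolution `(f ∗ g)(s) = ∑_{xy = s} f(x) g(y)`. -/
noncomputable def convFun (f g : WeightedSemigroupAlgebra ω) (s : S) : ℂ :=
  ∑' p : {p : S × S // p.1 * p.2 = s}, f.coeff p.1.1 * g.coeff p.1.2

/-- The product set, partitioned according to the value of the product. -/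
def fiberEquiv : (Σ s : S, {p : S × S // p.1 * p.2 = s}) ≃ S × S :=
  Equiv.sigmaFiberEquiv fun p : S × S => p.1 * p.2

theorem summable_fiber_weight (f g : WeightedSemigroupAlgebra ω) :
    Summable fun q : Σ s : S, {p : S × S // p.1 * p.2 = s} =>
      ‖f.coeff q.2.1.1 * g.coeff q.2.1.2‖ * (ω q.2.1.1 * ω q.2.1.2) :=
  (fiberEquiv (S := S)).summable_iff.2 (f.summable_prod_weight g)

theorem norm_convFun_mul_le (f g : WeightedSemigroupAlgebra ω) (s : S) :
    ‖convFun f g s‖ * ω s ≤ ∑' p : {p : S × S // p.1 * p.2 = s},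
      ‖f.coeff p.1.1 * g.coeff p.1.2‖ * (ω p.1.1 * ω p.1.2) := by
  have h1 : Summable fun p : {p : S × S // p.1 * p.2 = s} =>
      ‖f.coeff p.1.1 * g.coeff p.1.2‖ * (ω p.1.1 * ω p.1.2) :=
    (f.summable_fiber_weight g).sigma_factor s
  have h2 : Summable fun p : {p : S × S // p.1 * p.2 = s} =>
      ‖f.coeff p.1.1 * g.coeff p.1.2‖ := (f.summable_prod_norm g).subtype _
  calc ‖convFun f g s‖ * ω s
      ≤ (∑' p : {p : S × S // p.1 * p.2 = s}, ‖f.coeff p.1.1 * g.coeff p.1.2‖) * ω s :=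
        mul_le_mul_of_nonneg_right (norm_tsum_le_tsum_norm h2) (ω.pos s).le
    _ = ∑' p : {p : S × S // p.1 * p.2 = s}, ‖f.coeff p.1.1 * g.coeff p.1.2‖ * ω s :=
        tsum_mul_right.symm
    _ ≤ _ := by
        refine (h2.mul_right _).tsum_le_tsum (fun p => ?_) h1
        refine mul_le_mul_of_nonneg_left ?_ (norm_nonneg _)
        have h3 := ω.mul_le p.1.1 p.1.2
        rwa [p.2] at h3

/-- The product is convolution. -/
noncomputable instance : Mul (WeightedSemigroupAlgebra ω) :=
  ⟨fun f g => ⟨convFun f g, Summable.of_nonneg_of_le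
    (fun s => mul_nonneg (norm_nonneg _) (ω.pos s).le) (norm_convFun_mul_le f g)
    (f.summable_fiber_weight g).sigma⟩⟩

theorem coeff_mul (f g : WeightedSemigroupAlgebra ω) (s : S) : (f * g).coeff s =
    ∑' p : {p : S × S // p.1 * p.2 = s}, f.coeff p.1.1 * g.coeff p.1.2 := rfl

theorem norm_mul_le_mul (f g : WeightedSemigroupAlgebra ω) : ‖f * g‖ ≤ ‖f‖ * ‖g‖ := by
  have h1 : ‖f‖ * ‖g‖ = ∑' s, ∑' p : {p : S × S // p.1 * p.2 = s},
      ‖f.coeff p.1.1 * g.coeff p.1.2‖ * (ω p.1.1 * ω p.1.2) := by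
    rw [norm_def, norm_def, f.summable_weight.tsum_mul_tsum g.summable_weight
      (f.summable_weight.mul_of_nonneg g.summable_weight
        (fun s => mul_nonneg (norm_nonneg _) (ω.pos s).le)
        (fun s => mul_nonneg (norm_nonneg _) (ω.pos s).le)),
      ← (f.summable_fiber_weight g).tsum_sigma, ← (fiberEquiv (S := S)).tsum_eq]
    refine tsum_congr fun q => ?_
    rw [norm_mul]
    exact mul_mul_mul_comm _ _ _ _
  rw [h1]
  exact (f * g).summable_weight.tsum_le_tsum (norm_convFun_mul_le f g)
    (f.summable_fiber_weight g).sigma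

/-- The pairing of `ℓ¹(S, ω)` with bounded functions. -/
noncomputable def pairing (f : WeightedSemigroupAlgebra ω) (φ : S → ℂ) : ℂ :=
  ∑' s, f.coeff s * φ s

theorem pairing_mul (f g : WeightedSemigroupAlgebra ω) {φ : S → ℂ} {C : ℝ}
    (hφ : ∀ s, ‖φ s‖ ≤ C) :
    pairing (f * g) φ = pairing f fun x => pairing g fun y => φ (x * y) := by
  have hs : Summable fun p : S × S => f.coeff p.1 * g.coeff p.2 * φ (p.1 * p.2) := by
    refine Summable.of_norm_bounded ((f.summable_prod_norm g).mul_right C) fun p => ?_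
    rw [norm_mul]
    exact mul_le_mul_of_nonneg_left (hφ _) (norm_nonneg _)
  have h1 : pairing (f * g) φ = ∑' p : S × S, f.coeff p.1 * g.coeff p.2 * φ (p.1 * p.2) := by
    rw [← (fiberEquiv (S := S)).tsum_eq]
    refine Eq.trans ?_ ((fiberEquiv (S := S)).summable_iff.2 hs).tsum_sigma.symm
    refine tsum_congr fun s => ?_
    rw [coeff_mul, ← tsum_mul_right]
    refine tsum_congr fun p => ?_
    have hp : p.1.1 * p.1.2 = s := p.2
    change _ = f.coeff p.1.1 * g.coeff p.1.2 * φ (p.1.1 * p.1.2)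
    rw [hp]
  rw [h1, hs.tsum_prod]
  refine tsum_congr fun x => ?_
  change _ = f.coeff x * ∑' y, g.coeff y * φ (x * y)
  rw [← tsum_mul_left]
  exact tsum_congr fun y => mul_assoc _ _ _

open scoped Classical in
theorem coeff_mul_eq_pairing (f g : WeightedSemigroupAlgebra ω) (s : S) : (f * g).coeff s =
    pairing f fun x => pairing g fun y => if x * y = s then 1 else 0 := by
  rw [← pairing_mul f g (φ := fun z => if z = s then 1 else 0) (C := 1)
    fun z => by split_ifs <;> simp]
  rw [pairing, tsum_eq_single s fun z hz => by simp [hz]]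
  simp

theorem summable_pairing (f : WeightedSemigroupAlgebra ω) {φ : S → ℂ} {C : ℝ}
    (hφ : ∀ s, ‖φ s‖ ≤ C) : Summable fun s => f.coeff s * φ s := by
  refine Summable.of_norm_bounded (f.summable_norm.mul_right C) fun s => ?_
  rw [norm_mul]
  exact mul_le_mul_of_nonneg_left (hφ _) (norm_nonneg _)

theorem summable_fiber (f g : WeightedSemigroupAlgebra ω) (s : S) :
    Summable fun p : {p : S × S // p.1 * p.2 = s} => f.coeff p.1.1 * g.coeff p.1.2 :=
  ((f.summable_prod_norm g).subtype _).of_norm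

end Norm

section Ring

variable {S : Type*} [Semigroup S] {ω : Weight S}

noncomputable instance : NonUnitalNormedRing (WeightedSemigroupAlgebra ω) where
  __ := (inferInstance : NormedAddCommGroup (WeightedSemigroupAlgebra ω))
  mul := (· * ·)
  left_distrib f g h := ext fun s => by
    rw [coeff_add, coeff_mul, coeff_mul, coeff_mul,
      ← (summable_fiber f g s).tsum_add (summable_fiber f h s)]
    exact tsum_congr fun p => mul_add _ _ _
  right_distrib f g h := ext fun s => by
    rw [coeff_add, coeff_mul, coeff_mul, coeff_mul,
      ← (summable_fiber f h s).tsum_add (summable_fiber g h s)]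
    exact tsum_congr fun p => add_mul _ _ _
  zero_mul f := ext fun s => by
    rw [coeff_mul, coeff_zero]
    simp only [coeff_zero, zero_mul, tsum_zero]
  mul_zero f := ext fun s => by
    rw [coeff_mul, coeff_zero]
    simp only [coeff_zero, mul_zero, tsum_zero]
  mul_assoc f g h := ext fun s => by
    classical
    have hb : ∀ z : S, ‖(if z = s then 1 else 0 : ℂ)‖ ≤ 1 := fun z => by split_ifs <;> simp
    have hh : ∀ u : S, ‖pairing h fun z => (if u * z = s then 1 else 0 : ℂ)‖ ≤
        ∑' z, ‖h.coeff z‖ := fun u => by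
      refine tsum_of_norm_bounded h.summable_norm.hasSum fun z => ?_
      rw [norm_mul]
      exact mul_le_of_le_one_right (norm_nonneg _) (hb _)
    rw [coeff_mul_eq_pairing, coeff_mul_eq_pairing, pairing_mul f g hh]
    congr 1
    funext x
    rw [pairing_mul g h (φ := fun w => if x * w = s then 1 else 0) (C := 1) fun w => hb _]
    simp only [mul_assoc]
  dist_eq f g := dist_eq_norm_neg_add f g
  norm_mul_le := norm_mul_le_mul

instance : IsScalarTower ℂ (WeightedSemigroupAlgebra ω) (WeightedSemigroupAlgebra ω) where
  smul_assoc c f g := ext fun s => by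
    rw [smul_eq_mul, smul_eq_mul, coeff_smul, coeff_mul, coeff_mul, ← tsum_mul_left]
    refine tsum_congr fun p => ?_
    rw [coeff_smul, mul_assoc]

instance : SMulCommClass ℂ (WeightedSemigroupAlgebra ω) (WeightedSemigroupAlgebra ω) where
  smul_comm c f g := ext fun s => by
    rw [smul_eq_mul, smul_eq_mul, coeff_smul, coeff_mul, coeff_mul, ← tsum_mul_left]
    refine tsum_congr fun p => ?_
    rw [coeff_smul, mul_left_comm]

end Ring

end WeightedSemigroupAlgebra

/-- The semigroup algebra `ℓ¹(S)`. -/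
abbrev SemigroupAlgebra (S : Type*) [Mul S] : Type _ := WeightedSemigroupAlgebra (1 : Weight S)

end SemigroupAlgebra

/-! Multiplication by the weight, Φ = `mulWeight`, is a linear isometry of the weighted algebra into
the unweighted one. It is not multiplicative, but ω(xy) = Ω(x, y) ω(x) ω(y), so Φ(a * b) is the
convolution of Φ(a) and Φ(b) twisted by the kernel Ω. If F ∘ Φ is weakly almost periodic for every
weakly almost periodic F, the lower bound passes to the weighted algebra with the same constant
(`IsWAPAlgebra.of_isometry`).

By Grothendieck's double limit criterion (`IsWAPFunctional.interchangeable`,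
`isWAPFunctional_of_interchangeable`), F is weakly almost periodic exactly when the kernel F(ab) on
the unit ball is `Interchangeable`. Such kernels are stable under substitution, continuous
operations, uniform limits (`Interchangeable.of_approx`) and, the substantial point, averaging in
each variable (`Interchangeable.tsum_tsum`), which rests on the Riesz representation theorem on a
Stone–Čech compactification. The cluster hypothesis makes Ω interchangeable.

In ℓ¹(S, ω), F(Φ(f * g)) is, up to phases, the average of Ω(x, y) F(δ_{xy}) with weights |f|ω and
|g|ω, and the stability properties finish the proof.

In M_b(S, ω) a measure need not be a sum of point masses. However, the rows of an interchangeable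
kernel are separable for uniform norms (`Interchangeable.exists_countable_uniform`,
`Interchangeable.exists_countable_ae`), so S has countable partitions (E_i), (G_j) with Ω within ε
of a constant Ω(d_i, e_j) almost everywhere on E_i × G_j. Hence F(Φ(a * b)) is uniformly close to
the sum of the Ω(d_i, e_j) F(Φ(a|E_i) * Φ(b|G_j)), which is again an average of interchangeable
kernels. -/

section Interchange

/-! ### Interchangeable kernels and iterated limits along ultrafilters. -/

variable {X Y X' Y' E F G : Type*}

/-- The limit of a function along an ultrafilter. -/
noncomputable def ulim [TopologicalSpace E] [Nonempty E] (U : Ultrafilter X) (f : X → E) : E :=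
  limUnder (U : Filter X) f

variable [NormedAddCommGroup E] [NormedAddCommGroup F] [NormedAddCommGroup G]

theorem ulim_eq {U : Ultrafilter X} {f : X → E} {a : E} (h : Tendsto f U (𝓝 a)) : ulim U f = a :=
  h.limUnder_eq

theorem ulim_const (U : Ultrafilter X) (a : E) : ulim U (fun _ => a) = a :=
  ulim_eq tendsto_const_nhds

theorem ulim_pure (x : X) (f : X → E) : ulim (pure x) f = f x :=
  ulim_eq (by simpa using tendsto_pure_nhds f x)

theorem tendsto_ulim [ProperSpace E] (U : Ultrafilter X) {f : X → E} {C : ℝ}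
    (hf : ∀ x, ‖f x‖ ≤ C) : Tendsto f U (𝓝 (ulim U f)) := by
  obtain ⟨a, -, ha⟩ := (isCompact_closedBall (0 : E) C).ultrafilter_le_nhds (U.map f)
    (le_principal_iff.2 (mem_map.2 (univ_mem' fun x => by simpa using hf x)))
  exact (ulim_eq (f := f) (U := U) ha).symm ▸ ha

theorem norm_ulim_le [ProperSpace E] (U : Ultrafilter X) {f : X → E} {C : ℝ}
    (hf : ∀ x, ‖f x‖ ≤ C) : ‖ulim U f‖ ≤ C :=
  le_of_tendsto (tendsto_ulim U hf).norm (Eventually.of_forall hf)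

theorem ulim_eq_of_tendsto_atTop {W : Ultrafilter ℕ} (hW : (W : Filter ℕ) ≤ atTop) {f : ℕ → E}
    {a : E} (h : Tendsto f atTop (𝓝 a)) : ulim W f = a :=
  ulim_eq (h.mono_left hW)

theorem tendsto_atTop_of_ulim [ProperSpace E] {f : ℕ → E} {a : E} {C : ℝ} (hf : ∀ n, ‖f n‖ ≤ C)
    (h : ∀ W : Ultrafilter ℕ, (W : Filter ℕ) ≤ atTop → ulim W f = a) :
    Tendsto f atTop (𝓝 a) :=
  (tendsto_iff_ultrafilter _ _ _).2 fun W hW => h W hW ▸ tendsto_ulim W hf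

theorem ulim_map₂ [ProperSpace E] [ProperSpace F] {φ : E × F → G} (hφ : Continuous φ)
    (U : Ultrafilter X) {a : X → E} {b : X → F} {C D : ℝ} (ha : ∀ x, ‖a x‖ ≤ C)
    (hb : ∀ x, ‖b x‖ ≤ D) : ulim U (fun x => φ (a x, b x)) = φ (ulim U a, ulim U b) :=
  ulim_eq ((hφ.tendsto _).comp ((tendsto_ulim U ha).prodMk_nhds (tendsto_ulim U hb)))

/-- A bounded kernel whose iterated limits along ultrafilters agree. -/
structure Interchangeable (f : X → Y → E) : Prop where
  bounded : ∃ C, ∀ x y, ‖f x y‖ ≤ C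
  ulim_comm : ∀ (U : Ultrafilter X) (V : Ultrafilter Y),
    ulim U (fun x => ulim V fun y => f x y) = ulim V fun y => ulim U fun x => f x y

namespace Interchangeable

theorem swap {f : X → Y → E} (hf : Interchangeable f) : Interchangeable fun y x => f x y :=
  ⟨hf.bounded.imp fun _ h y x => h x y, fun U V => (hf.ulim_comm V U).symm⟩

/-- The limit of `f ∘ p` along `U` is by definition the limit of `f` along `U.map p`. No injectivity
of `p` or `q` is needed, which is the advantage of ultrafilters over sequences of distinct points.
-/
theorem comp {f : X → Y → E} (hf : Interchangeable f) (p : X' → X) (q : Y' → Y) :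
    Interchangeable fun x y => f (p x) (q y) :=
  ⟨hf.bounded.imp fun _ h _ _ => h _ _, fun U V => hf.ulim_comm (U.map p) (V.map q)⟩

/-- In a proper space bounded families converge along every ultrafilter, so all limits exist and
commute with a continuous `φ`. -/
theorem map₂ [ProperSpace E] [ProperSpace F] {f : X → Y → E} {g : X → Y → F}
    (hf : Interchangeable f) (hg : Interchangeable g) {φ : E × F → G} (hφ : Continuous φ) :
    Interchangeable fun x y => φ (f x y, g x y) := by
  obtain ⟨C, hC⟩ := hf.bounded
  obtain ⟨D, hD⟩ := hg.bounded
  constructor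
  · obtain ⟨B, hB⟩ := (((isCompact_closedBall (0 : E) C).prod
      (isCompact_closedBall (0 : F) D)).image hφ).isBounded.exists_norm_le
    exact ⟨B, fun x y => hB _ ⟨_, ⟨by simpa using hC x y, by simpa using hD x y⟩, rfl⟩⟩
  · intro U V
    have h1 : (fun x => ulim V fun y => φ (f x y, g x y)) =
        fun x => φ (ulim V fun y => f x y, ulim V fun y => g x y) :=
      funext fun x => ulim_map₂ hφ V (hC x) (hD x)
    have h2 : (fun y => ulim U fun x => φ (f x y, g x y)) =
        fun y => φ (ulim U fun x => f x y, ulim U fun x => g x y) :=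
      funext fun y => ulim_map₂ hφ U (fun x => hC x y) fun x => hD x y
    rw [h1, h2, ulim_map₂ hφ U (fun x => norm_ulim_le V (hC x)) (fun x => norm_ulim_le V (hD x)),
      ulim_map₂ hφ V (fun y => norm_ulim_le U fun x => hC x y)
        (fun y => norm_ulim_le U fun x => hD x y), hf.ulim_comm,
      hg.ulim_comm]

theorem map [ProperSpace E] {f : X → Y → E} (hf : Interchangeable f) {φ : E → G}
    (hφ : Continuous φ) : Interchangeable fun x y => φ (f x y) :=
  hf.map₂ hf (φ := fun p => φ p.1) (hφ.comp continuous_fst)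

theorem mul {R : Type*} [NormedRing R] [ProperSpace R] {f g : X → Y → R}
    (hf : Interchangeable f) (hg : Interchangeable g) :
    Interchangeable fun x y => f x y * g x y :=
  hf.map₂ hg (φ := fun p => p.1 * p.2) continuous_mul

theorem of_left {f : X → E} {C : ℝ} (hf : ∀ x, ‖f x‖ ≤ C) :
    Interchangeable fun (x : X) (_ : Y) => f x :=
  ⟨⟨C, fun x _ => hf x⟩, fun U V => by simp only [ulim_const]⟩

theorem of_right {f : Y → E} {C : ℝ} (hf : ∀ x, ‖f x‖ ≤ C) :
    Interchangeable fun (_ : X) (y : Y) => f y :=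
  (of_left hf).swap

end Interchangeable

/-- Iterated limits along ultrafilters are iterated limits along sequences. -/
theorem exists_seq_tendsto_ulim [ProperSpace E] {f : X → Y → E} {C : ℝ}
    (hC : ∀ x y, ‖f x y‖ ≤ C) (U : Ultrafilter X) (V : Ultrafilter Y) :
    ∃ (x : ℕ → X) (y : ℕ → Y),
      (∀ n, Tendsto (fun m => f (x n) (y m)) atTop (𝓝 (ulim V fun y => f (x n) y))) ∧
      Tendsto (fun n => ulim V fun y => f (x n) y) atTop
        (𝓝 (ulim U fun x => ulim V fun y => f x y)) ∧
      (∀ m, Tendsto (fun n => f (x n) (y m)) atTop (𝓝 (ulim U fun x => f x (y m)))) ∧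
      Tendsto (fun m => ulim U fun x => f x (y m)) atTop
        (𝓝 (ulim V fun y => ulim U fun x => f x y)) ∧
      ((U : Filter X) ≤ cofinite → Function.Injective x) ∧
      ((V : Filter Y) ≤ cofinite → Function.Injective y) := by
  set a : X → E := fun x => ulim V fun y => f x y with ha
  set b : Y → E := fun y => ulim U fun x => f x y with hb
  have hda : ∀ (x : X) (ε : ℝ), 0 < ε → ∀ᶠ y in V, dist (f x y) (a x) < ε := fun x ε hε =>
    Metric.tendsto_nhds.1 (tendsto_ulim V (hC x)) ε hε
  have hdb : ∀ (y : Y) (ε : ℝ), 0 < ε → ∀ᶠ x in U, dist (f x y) (b y) < ε := fun y ε hε =>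
    Metric.tendsto_nhds.1 (tendsto_ulim U fun x => hC x y) ε hε
  have hL : ∀ ε : ℝ, 0 < ε → ∀ᶠ x in U, dist (a x) (ulim U a) < ε := fun ε hε =>
    Metric.tendsto_nhds.1 (tendsto_ulim U fun x => norm_ulim_le V (hC x)) ε hε
  have hM : ∀ ε : ℝ, 0 < ε → ∀ᶠ y in V, dist (b y) (ulim V b) < ε := fun ε hε =>
    Metric.tendsto_nhds.1 (tendsto_ulim V fun y => norm_ulim_le U fun x => hC x y) ε hε
  have hpos : ∀ n : ℕ, 0 < 1 / ((n : ℝ) + 1) := fun n => Nat.one_div_pos_of_nat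
  -- Each term is a triple (k, x, y), where k exceeds all earlier indices and 1/(k+1) is the
  -- tolerance. The new x and y are chosen close to the limits against all earlier points, which are
  -- finitely many conditions, each holding eventually along the ultrafilter. Distinctness is
  -- imposed only along a free ultrafilter.
  obtain ⟨z, hz, hzr⟩ := exists_seq_of_forall_finset_exists
    (P := fun p : ℕ × X × Y => dist (a p.2.1) (ulim U a) < 1 / ((p.1 : ℝ) + 1) ∧
      dist (b p.2.2) (ulim V b) < 1 / ((p.1 : ℝ) + 1))
    (r := fun p q : ℕ × X × Y => p.1 < q.1 ∧
      dist (f q.2.1 p.2.2) (b p.2.2) < 1 / ((q.1 : ℝ) + 1) ∧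
      dist (f p.2.1 q.2.2) (a p.2.1) < 1 / ((q.1 : ℝ) + 1) ∧
      ((U : Filter X) ≤ cofinite → p.2.1 ≠ q.2.1) ∧
      ((V : Filter Y) ≤ cofinite → p.2.2 ≠ q.2.2)) (by
    intro s _
    obtain ⟨k, hk⟩ : ∃ k : ℕ, ∀ p ∈ s, p.1 < k :=
      ⟨s.sup Prod.fst + 1, fun p hp => Nat.lt_succ_of_le (Finset.le_sup (f := Prod.fst) hp)⟩
    have hx : ∀ᶠ x in U, dist (a x) (ulim U a) < 1 / ((k : ℝ) + 1) ∧
        ∀ p ∈ s, dist (f x p.2.2) (b p.2.2) < 1 / ((k : ℝ) + 1) ∧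
          ((U : Filter X) ≤ cofinite → p.2.1 ≠ x) := by
      refine (hL _ (hpos k)).and ((eventually_all_finset s).2 fun p _ => (hdb _ _ (hpos k)).and ?_)
      refine Filter.eventually_imp_distrib_left.2 fun hU => ?_
      filter_upwards [hU (Set.finite_singleton p.2.1).compl_mem_cofinite] with x hx h
      exact hx h.symm
    have hy : ∀ᶠ y in V, dist (b y) (ulim V b) < 1 / ((k : ℝ) + 1) ∧
        ∀ p ∈ s, dist (f p.2.1 y) (a p.2.1) < 1 / ((k : ℝ) + 1) ∧
          ((V : Filter Y) ≤ cofinite → p.2.2 ≠ y) := by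
      refine (hM _ (hpos k)).and ((eventually_all_finset s).2 fun p _ => (hda _ _ (hpos k)).and ?_)
      refine Filter.eventually_imp_distrib_left.2 fun hV => ?_
      filter_upwards [hV (Set.finite_singleton p.2.2).compl_mem_cofinite] with x hx h
      exact hx h.symm
    obtain ⟨x, hx⟩ := hx.exists
    obtain ⟨y, hy⟩ := hy.exists
    exact ⟨(k, x, y), ⟨hx.1, hy.1⟩, fun p hp => ⟨hk p hp, (hx.2 p hp).1, (hy.2 p hp).1,
      (hx.2 p hp).2, (hy.2 p hp).2⟩⟩)
  have hmono : StrictMono fun n => (z n).1 := fun m n h => (hzr m n h).1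
  have hle : ∀ n : ℕ, 1 / (((z n).1 : ℝ) + 1) ≤ 1 / ((n : ℝ) + 1) := fun n =>
    Nat.one_div_le_one_div hmono.le_apply
  refine ⟨fun n => (z n).2.1, fun n => (z n).2.2, fun n => ?_, ?_, fun m => ?_, ?_,
    fun hU => .of_lt_imp_ne fun m n h => (hzr m n h).2.2.2.1 hU,
    fun hV => .of_lt_imp_ne fun m n h => (hzr m n h).2.2.2.2 hV⟩
  · refine tendsto_iff_dist_tendsto_zero.2 (squeeze_zero' (Eventually.of_forall fun _ =>
      dist_nonneg) ?_ tendsto_one_div_add_atTop_nhds_zero_nat)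
    exact (eventually_gt_atTop n).mono fun m hm => ((hzr n m hm).2.2.1.trans_le (hle m)).le
  · exact tendsto_iff_dist_tendsto_zero.2 (squeeze_zero (fun _ => dist_nonneg)
      (fun n => ((hz n).1.trans_le (hle n)).le) tendsto_one_div_add_atTop_nhds_zero_nat)
  · refine tendsto_iff_dist_tendsto_zero.2 (squeeze_zero' (Eventually.of_forall fun _ =>
      dist_nonneg) ?_ tendsto_one_div_add_atTop_nhds_zero_nat)
    exact (eventually_gt_atTop m).mono fun n hn => ((hzr m n hn).2.1.trans_le (hle n)).le
  · exact tendsto_iff_dist_tendsto_zero.2 (squeeze_zero (fun _ => dist_nonneg)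
      (fun n => ((hz n).2.trans_le (hle n)).le) tendsto_one_div_add_atTop_nhds_zero_nat)

/-- Interchangeability can be tested on sequences. -/
theorem Interchangeable.of_seq [ProperSpace E] {f : X → Y → E} {C : ℝ} (hC : ∀ x y, ‖f x y‖ ≤ C)
    (h : ∀ (x : ℕ → X) (y : ℕ → Y) (a b : ℕ → E) (L M : E),
      (∀ n, Tendsto (fun m => f (x n) (y m)) atTop (𝓝 (a n))) → Tendsto a atTop (𝓝 L) →
      (∀ m, Tendsto (fun n => f (x n) (y m)) atTop (𝓝 (b m))) → Tendsto b atTop (𝓝 M) → L = M) :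
    Interchangeable f := by
  refine ⟨⟨C, hC⟩, fun U V => ?_⟩
  obtain ⟨x, y, h1, h2, h3, h4, -, -⟩ := exists_seq_tendsto_ulim hC U V
  exact h x y _ _ _ _ h1 h2 h3 h4

/-- Free ultrafilters lead to sequences of distinct points, to which the cluster condition applies.
Along a principal ultrafilter the limit is an evaluation, and there is nothing to interchange. -/
theorem WAP.IsCluster.interchangeable {f : X × Y → ℂ} (hf : WAP.IsCluster f) {C : ℝ}
    (hC : ∀ p, ‖f p‖ ≤ C) : Interchangeable fun x y => f (x, y) := by
  refine ⟨⟨C, fun x y => hC (x, y)⟩, fun U V => ?_⟩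
  rcases U.le_cofinite_or_eq_pure with hU | ⟨x, rfl⟩
  · rcases V.le_cofinite_or_eq_pure with hV | ⟨y, rfl⟩
    · obtain ⟨x, y, h1, h2, h3, h4, hx, hy⟩ :=
        exists_seq_tendsto_ulim (f := fun x y => f (x, y)) (fun x y => hC (x, y)) U V
      exact hf x y (hx hU) (hy hV) _ _ _ _ h1 h2 h3 h4
    · simp only [ulim_pure]
  · simp only [ulim_pure]

end Interchange

/-! ### Averages of interchangeable kernels. -/

section Averages

variable {X Y I J T : Type*}

theorem continuous_ulim {g : T → ℝ} {C : ℝ} (hC : ∀ t, ‖g t‖ ≤ C) :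
    Continuous fun z : Ultrafilter T => ulim z g := by
  -- The universal property of the Stone–Čech compactification requires a compact target, hence the
  -- corestriction.
  let g' : T → Set.Icc (-C) C := fun t => ⟨g t, abs_le.1 (hC t)⟩
  have h : ∀ z : Ultrafilter T, ulim z g =
      ((Ultrafilter.extend g' z : Set.Icc (-C) C) : ℝ) := fun z => by
    have h1 : Tendsto g' z (𝓝 (Ultrafilter.extend g' z)) := ultrafilter_extend_eq_iff.1 rfl
    exact ulim_eq (f := g) ((continuous_subtype_val.tendsto _).comp h1)
  simp only [h]
  exact continuous_subtype_val.comp (continuous_ultrafilter_extend g')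

theorem summable_mul_of_bounded {q h : J → ℝ} (hq0 : ∀ j, 0 ≤ q j) (hq : Summable q) {C : ℝ}
    (hC : ∀ j, ‖h j‖ ≤ C) : Summable fun j => q j * h j := by
  refine Summable.of_norm_bounded (hq.mul_right C) fun j => ?_
  rw [norm_mul, Real.norm_of_nonneg (hq0 j)]
  exact mul_le_mul_of_nonneg_left (hC j) (hq0 j)

theorem norm_tsum_mul_le {q : J → ℝ} {h : J → ℝ} (hq0 : ∀ j, 0 ≤ q j) (hq : Summable q)
    (hq1 : ∑' j, q j ≤ 1) {C : ℝ} (hC0 : 0 ≤ C) (hC : ∀ j, ‖h j‖ ≤ C) :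
    ‖∑' j, q j * h j‖ ≤ C := by
  refine (tsum_of_norm_bounded (hq.mul_right C).hasSum fun j => ?_).trans ?_
  · rw [norm_mul, Real.norm_of_nonneg (hq0 j)]
    exact mul_le_mul_of_nonneg_left (hC j) (hq0 j)
  · rw [tsum_mul_right]
    exact mul_le_of_le_one_left hC0 hq1

/-- A limit of averages is continuous along pointwise convergent interchangeable sequences. -/
theorem tendsto_ulim_tsum {q : Y → J → ℝ} (hq0 : ∀ m j, 0 ≤ q m j) (hq : ∀ m, Summable (q m))
    (hq1 : ∀ m, ∑' j, q m j ≤ 1) {g : ℕ → Y × J → ℝ} (hg : Interchangeable g) {g' : Y × J → ℝ}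
    (hlim : ∀ t, Tendsto (fun n => g n t) atTop (𝓝 (g' t))) (W : Ultrafilter Y) :
    Tendsto (fun n => ulim W fun m => ∑' j, q m j * g n (m, j)) atTop
      (𝓝 (ulim W fun m => ∑' j, q m j * g' (m, j))) := by
  obtain ⟨C, hC⟩ := hg.bounded
  have hC' : ∀ t, ‖g' t‖ ≤ C := fun t =>
    le_of_tendsto (hlim t).norm (Eventually.of_forall fun n => hC n t)
  borelize (Ultrafilter (Y × J))
  have hb : ∀ h : CompactlySupportedContinuousMap (Ultrafilter (Y × J)) ℝ,
      ∃ D, 0 ≤ D ∧ ∀ z, ‖h z‖ ≤ D := fun h => by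
    obtain ⟨D, hD⟩ := (isCompact_range h.continuous).isBounded.exists_norm_le
    exact ⟨max D 0, le_max_right _ _, fun z => (hD _ ⟨z, rfl⟩).trans (le_max_left _ _)⟩
  have htend : ∀ h : CompactlySupportedContinuousMap (Ultrafilter (Y × J)) ℝ,
      Tendsto (fun m => ∑' j, q m j * h (pure (m, j))) W
        (𝓝 (ulim W fun m => ∑' j, q m j * h (pure (m, j)))) := fun h => by
    obtain ⟨D, hD0, hD⟩ := hb h
    exact tendsto_ulim W fun m => norm_tsum_mul_le (hq0 m) (hq m) (hq1 m) hD0 fun j => hD _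
  have hsum : ∀ (h : CompactlySupportedContinuousMap (Ultrafilter (Y × J)) ℝ) (m : Y),
      Summable fun j => q m j * h (pure (m, j)) := fun h m => by
    obtain ⟨D, hD0, hD⟩ := hb h
    exact summable_mul_of_bounded (hq0 m) (hq m) fun j => hD _
  -- A positive functional on the continuous functions of the compact space of ultrafilters. Its
  -- Riesz measure represents the limit of averages of a bounded `h` as the integral of the
  -- extension `z ↦ ulim z h`.
  let Λ : CompactlySupportedContinuousMap (Ultrafilter (Y × J)) ℝ →ₚ[ℝ] ℝ :=
    { toFun h := ulim W fun m => ∑' j, q m j * h (pure (m, j))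
      map_add' h k := by
        refine ulim_eq (((htend h).add (htend k)).congr fun m => ?_)
        rw [← (hsum h m).tsum_add (hsum k m)]
        exact tsum_congr fun j => (mul_add _ _ _).symm
      map_smul' c h := by
        refine ulim_eq (((htend h).const_mul c).congr fun m => ?_)
        rw [← tsum_mul_left]
        exact tsum_congr fun j => mul_left_comm _ _ _
      monotone' h k hhk := by
        refine le_of_tendsto_of_tendsto (htend h) (htend k) (Eventually.of_forall fun m => ?_)
        exact (hsum h m).tsum_le_tsum (fun j => mul_le_mul_of_nonneg_left (hhk _) (hq0 m j))
          (hsum k m) }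
  have hext : ∀ h : Y × J → ℝ, (∀ t, ‖h t‖ ≤ C) →
      ulim W (fun m => ∑' j, q m j * h (m, j)) =
        ∫ z, ulim z h ∂(RealRMK.rieszMeasure Λ) := fun h hh => by
    let k : CompactlySupportedContinuousMap (Ultrafilter (Y × J)) ℝ :=
      { toFun := fun z => ulim z h
        continuous_toFun := continuous_ulim hh
        hasCompactSupport' := HasCompactSupport.of_compactSpace _ }
    refine Eq.trans ?_ (RealRMK.integral_rieszMeasure Λ k).symm
    refine congrArg (ulim W) (funext fun m => tsum_congr fun j => ?_)
    exact congrArg _ (ulim_pure (m, j) h).symm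
  rw [hext g' hC']
  simp only [fun n => hext (g n) (hC n)]
  refine tendsto_integral_of_dominated_convergence (fun _ => C)
    (fun n => (continuous_ulim (hC n)).measurable.aestronglyMeasurable) (integrable_const C)
    (fun n => Eventually.of_forall fun z => norm_ulim_le z (hC n))
    (Eventually.of_forall fun z => ?_)
  -- Dominated convergence needs convergence at every ultrafilter `z`, not only at the points of `Y
  -- × J`. This is what the interchange of limits for `g` provides.
  refine tendsto_atTop_of_ulim (fun n => norm_ulim_le z (hC n)) fun W' hW' => ?_
  rw [hg.ulim_comm W' z]
  exact congrArg (ulim z) (funext fun t => ulim_eq_of_tendsto_atTop hW' (hlim t))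

/-- Along sequences only countably many pairs carry a nonzero weight, so a diagonal argument makes
the rows converge pointwise there. Then `tendsto_ulim_tsum` moves the limit in n through the limit
of averages in m. -/
theorem Interchangeable.tsum_right_real {f : X → Y × J → ℝ} (hf : Interchangeable f)
    {Q : Y → J → ℝ} (hQ0 : ∀ y j, 0 ≤ Q y j) (hQ : ∀ y, Summable (Q y))
    (hQ1 : ∀ y, ∑' j, Q y j ≤ 1) :
    Interchangeable fun x y => ∑' j, Q y j * f x (y, j) := by
  obtain ⟨C, hC⟩ := hf.bounded
  have hC0 : ∀ x t, ‖f x t‖ ≤ max C 0 := fun x t => (hC x t).trans (le_max_left _ _)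
  refine .of_seq (fun x y => norm_tsum_mul_le (hQ0 y) (hQ y) (hQ1 y) (le_max_right C 0)
    fun j => hC0 _ _) fun x y a b L M ha hL hb hM => ?_
  set s : Set (ℕ × J) := {p | Q (y p.1) p.2 ≠ 0}
  have hs : s.Countable := by
    have : s ⊆ ⋃ m, Prod.mk m '' Function.support (Q (y m)) := fun p hp =>
      Set.mem_iUnion.2 ⟨p.1, p.2, hp, rfl⟩
    exact (Set.countable_iUnion fun m => ((hQ (y m)).countable_support).image _).mono this
  have := hs.to_subtype
  -- Cutting off to the countable set `s` changes no average and makes the subsequence converge at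
  -- every point.
  let g : ℕ → ℕ × J → ℝ := fun n p => f (x n) (y p.1, p.2) * s.indicator 1 p
  have hg : Interchangeable g := by
    refine (hf.comp x fun p : ℕ × J => (y p.1, p.2)).mul
      (Interchangeable.of_right (f := s.indicator 1) (C := 1) fun p => ?_)
    by_cases hp : p ∈ s <;> simp [hp]
  have hgC : ∀ n p, ‖g n p‖ ≤ max C 0 := fun n p => by
    by_cases hp : p ∈ s
    · simpa [g, hp] using hC0 (x n) (y p.1, p.2)
    · simp [g, hp]
  have hgQ : ∀ n m j, Q (y m) j * f (x n) (y m, j) = Q (y m) j * g n (m, j) := fun n m j => by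
    by_cases hp : (m, j) ∈ s
    · simp [g, hp]
    · have : Q (y m) j = 0 := not_not.1 hp
      simp [this]
  simp only [hgQ] at ha hb
  obtain ⟨k, -, φ, hφ, hk⟩ := (isCompact_univ_pi fun _ : s =>
    isCompact_closedBall (0 : ℝ) (max C 0)).tendsto_subseq (x := fun n (p : s) => g n p)
      fun n p _ => by simpa using hgC n p
  classical
  let g' : ℕ × J → ℝ := fun p => if hp : p ∈ s then k ⟨p, hp⟩ else 0
  have hlim : ∀ p, Tendsto (fun n => g (φ n) p) atTop (𝓝 (g' p)) := fun p => by
    by_cases hp : p ∈ s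
    · simpa [g', hp] using tendsto_pi_nhds.1 hk ⟨p, hp⟩
    · simp [g', hp, g]
  have hW := Nat.hyperfilter_le_atTop
  have h1 := tendsto_ulim_tsum (fun m => hQ0 (y m)) (fun m => hQ (y m)) (fun m => hQ1 (y m))
    (hg.comp φ id) (g' := g') hlim (hyperfilter ℕ)
  have h2 : ∀ m, b m = ∑' j, Q (y m) j * g' (m, j) := fun m => by
    refine tendsto_nhds_unique ((hb m).comp hφ.tendsto_atTop)
      (tendsto_tsum_of_dominated_convergence ((hQ (y m)).mul_right (max C 0))
        (fun j => (hlim (m, j)).const_mul _) (Eventually.of_forall fun n j => ?_))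
    rw [norm_mul, Real.norm_of_nonneg (hQ0 _ _)]
    exact mul_le_mul_of_nonneg_left (hgC _ _) (hQ0 _ _)
  simp only [id, fun n => ulim_eq_of_tendsto_atTop hW (ha (φ n)), ← h2,
    ulim_eq_of_tendsto_atTop hW hM] at h1
  exact tendsto_nhds_unique (hL.comp hφ.tendsto_atTop) h1

theorem summable_ofReal_mul {q : J → ℝ} {h : J → ℂ} (hq0 : ∀ j, 0 ≤ q j) (hq : Summable q) {C : ℝ}
    (hC : ∀ j, ‖h j‖ ≤ C) : Summable fun j => (q j : ℂ) * h j := by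
  refine Summable.of_norm_bounded (hq.mul_right C) fun j => ?_
  rw [norm_mul, Complex.norm_of_nonneg (hq0 j)]
  exact mul_le_mul_of_nonneg_left (hC j) (hq0 j)

/-- Averaging an interchangeable kernel over one variable. -/
theorem Interchangeable.tsum_right {f : X → Y × J → ℂ} (hf : Interchangeable f)
    {Q : Y → J → ℝ} (hQ0 : ∀ y j, 0 ≤ Q y j) (hQ : ∀ y, Summable (Q y))
    (hQ1 : ∀ y, ∑' j, Q y j ≤ 1) :
    Interchangeable fun x y => ∑' j, (Q y j : ℂ) * f x (y, j) := by
  obtain ⟨C, hC⟩ := hf.bounded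
  have h1 := (hf.map Complex.continuous_re).tsum_right_real hQ0 hQ hQ1
  have h2 := (hf.map Complex.continuous_im).tsum_right_real hQ0 hQ hQ1
  have h3 := h1.map₂ h2 (φ := fun p : ℝ × ℝ => (p.1 : ℂ) + p.2 * Complex.I) (by fun_prop)
  convert h3 using 3 with x y
  have hs := summable_ofReal_mul (hQ0 y) (hQ y) fun j => hC x (y, j)
  rw [← Complex.re_add_im (∑' j, (Q y j : ℂ) * f x (y, j)), Complex.re_tsum hs,
    Complex.im_tsum hs]
  simp

theorem Interchangeable.tsum_tsum {f : X × I → Y × J → ℂ} (hf : Interchangeable f)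
    {P : X → I → ℝ} (hP0 : ∀ x i, 0 ≤ P x i) (hP : ∀ x, Summable (P x))
    (hP1 : ∀ x, ∑' i, P x i ≤ 1) {Q : Y → J → ℝ} (hQ0 : ∀ y j, 0 ≤ Q y j)
    (hQ : ∀ y, Summable (Q y)) (hQ1 : ∀ y, ∑' j, Q y j ≤ 1) :
    Interchangeable fun x y =>
      ∑' i, (P x i : ℂ) * ∑' j, (Q y j : ℂ) * f (x, i) (y, j) :=
  ((hf.tsum_right hQ0 hQ hQ1).swap.tsum_right hP0 hP hP1).swap

end Averages

/-! ### Goldstine's theorem. -/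

section Goldstine

variable {Z E : Type*} [NormedAddCommGroup E] [NormedSpace ℂ E]

/-- **Goldstine's theorem** for a convex norming family of functionals. -/
theorem exists_ultrafilter_tendsto_of_norming (e : Z → StrongDual ℂ E)
    (hconv : Convex ℝ (Set.range e))
    (hnorm : ∀ (h : E) (C : ℝ), (∀ z, (e z h).re ≤ C) → ‖h‖ ≤ C)
    (Ψ : StrongDual ℂ E) (hΨ : ‖Ψ‖ ≤ 1) :
    ∃ V : Ultrafilter Z, ∀ h, Tendsto (fun z => e z h) V (𝓝 (Ψ h)) := by
  let T : Z → WeakBilin (topDualPairing ℂ E) := e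
  have hs : Convex ℝ (Set.range T) := hconv
  have : ContinuousSMul ℝ (WeakBilin (topDualPairing ℂ E)) := IsScalarTower.continuousSMul ℂ
  let Ψ' : WeakBilin (topDualPairing ℂ E) := Ψ
  -- Otherwise Hahn–Banach separates `Ψ'` from the closed convex hull by a continuous functional for
  -- the weak-* topology, that is, by evaluation at some `h`. The norming property gives ‖h‖ ≤ u <
  -- Re Ψ h, against ‖Ψ‖ ≤ 1.
  have hmem : Ψ' ∈ closure (Set.range T) := by
    by_contra hcon
    obtain ⟨f, u, hfu, huΨ⟩ :=
      RCLike.geometric_hahn_banach_closed_point (𝕜 := ℂ) hs.closure isClosed_closure hcon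
    obtain ⟨h, rfl⟩ := LinearMap.dualEmbedding_surjective (topDualPairing ℂ E) f
    have h1 : ‖h‖ ≤ u := hnorm h u fun z => (hfu _ (subset_closure ⟨z, rfl⟩)).le
    have h2 : u < (Ψ h).re := huΨ
    have h3 : ‖Ψ h‖ ≤ 1 * ‖h‖ := Ψ.le_of_opNorm_le hΨ h
    linarith [Complex.re_le_norm (Ψ h)]
  have hne : (comap T (𝓝 Ψ')).NeBot := by
    rw [comap_neBot_iff]
    intro t ht
    obtain ⟨_, hxt, z, rfl⟩ := mem_closure_iff_nhds.1 hmem t ht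
    exact ⟨z, hxt⟩
  refine ⟨Ultrafilter.of (comap T (𝓝 Ψ')), fun h => ?_⟩
  exact ((WeakBilin.eval_continuous (topDualPairing ℂ E) h).tendsto Ψ').comp
    (tendsto_iff_comap.2 (Ultrafilter.of_le _))

end Goldstine

/-! ### Grothendieck's double limit criterion and transfer along an isometry. -/

namespace WAP

variable {A : Type*} [NonUnitalNormedRing A] [NormedSpace ℂ A] [IsScalarTower ℂ A A]
  [SMulCommClass ℂ A A]

theorem norm_apply_mul_le (F : StrongDual ℂ A) (a b : Metric.closedBall (0 : A) 1) :
    ‖F (a * b : A)‖ ≤ ‖F‖ := by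
  have ha : ‖(a : A)‖ ≤ 1 := mem_closedBall_zero_iff.1 a.2
  have hb : ‖(b : A)‖ ≤ 1 := mem_closedBall_zero_iff.1 b.2
  exact F.unit_le_opNorm _ ((norm_mul_le _ _).trans (mul_le_one₀ ha (norm_nonneg _) hb))

theorem norm_apply_closedBall_le (φ : StrongDual ℂ A) (b : Metric.closedBall (0 : A) 1) :
    ‖φ b‖ ≤ ‖φ‖ := φ.unit_le_opNorm _ (mem_closedBall_zero_iff.1 b.2)

/-- The functional on the dual given by the limit of evaluations along an ultrafilter. -/
noncomputable def evalLimit (V : Ultrafilter (Metric.closedBall (0 : A) 1)) :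
    StrongDual ℂ (StrongDual ℂ A) :=
  LinearMap.mkContinuous
    { toFun := fun φ => ulim V fun b => φ b
      map_add' := fun φ ψ => ulim_eq ((tendsto_ulim V (norm_apply_closedBall_le φ)).add
        (tendsto_ulim V (norm_apply_closedBall_le ψ)))
      map_smul' := fun c φ => ulim_eq ((tendsto_ulim V (norm_apply_closedBall_le φ)).const_smul c) }
    1 fun φ => by
      rw [one_mul]
      exact norm_ulim_le V (norm_apply_closedBall_le φ)

/-- Rotating and rescaling `x` makes φ(x) real and positive. This is the norming hypothesis of
Goldstine's theorem for the unit ball of `A`. -/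
theorem norm_le_of_re_le (φ : StrongDual ℂ A) (C : ℝ)
    (h : ∀ b : Metric.closedBall (0 : A) 1, (φ b).re ≤ C) : ‖φ‖ ≤ C := by
  have hC : 0 ≤ C := by simpa using h ⟨0, by simp⟩
  refine φ.opNorm_le_bound hC fun x => ?_
  rcases eq_or_ne (φ x) 0 with hx | hx
  · rw [hx, norm_zero]
    positivity
  have hx0 : x ≠ 0 := fun h0 => hx (by rw [h0, map_zero])
  have hxp : 0 < ‖x‖ := norm_pos_iff.2 hx0
  have hφ : ‖φ x‖ ≠ 0 := norm_ne_zero_iff.2 hx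
  let c : ℂ := (starRingEnd ℂ) (φ x) / (‖φ x‖ * ‖x‖ : ℝ)
  have hc : ‖c • x‖ ≤ 1 := by
    rw [norm_smul, norm_div, RCLike.norm_conj, Complex.norm_real, norm_mul, norm_norm, norm_norm]
    field_simp
    rfl
  have h1 := h ⟨c • x, by simpa using hc⟩
  have h2 : φ (c • x) = ((‖φ x‖ / ‖x‖ : ℝ) : ℂ) := by
    rw [map_smul, smul_eq_mul, div_mul_eq_mul_div, Complex.conj_mul']
    push_cast
    have : (‖φ x‖ : ℂ) ≠ 0 := by exact_mod_cast hφ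
    have : (‖x‖ : ℂ) ≠ 0 := by exact_mod_cast hxp.ne'
    field_simp
  rw [h2] at h1
  rwa [← div_le_iff₀ hxp]

/-- By compactness the functionals F · a converge weakly along `U` to some `g`. Weak convergence is
tested both on evaluations at `b` and on `evalLimit V`, and comparing the two results gives the
interchange. -/
theorem IsWAPFunctional.interchangeable {F : StrongDual ℂ A} (hF : IsWAPFunctional F) :
    Interchangeable fun a b : Metric.closedBall (0 : A) 1 => F (a * b : A) := by
  refine ⟨⟨‖F‖, norm_apply_mul_le F⟩, fun U V => ?_⟩
  obtain ⟨g, -, hg⟩ := hF.ultrafilter_le_nhds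
    (U.map fun a : Metric.closedBall (0 : A) 1 => toWeakSpace ℂ _ (dualAct F (a : A)))
    (le_principal_iff.2 (mem_map.2 (univ_mem' fun a =>
      subset_closure ⟨_, ⟨a, mem_closedBall_zero_iff.1 a.2, rfl⟩, rfl⟩)))
  have key : ∀ Ψ : StrongDual ℂ (StrongDual ℂ A),
      ulim U (fun a => Ψ (dualAct F (a : A))) = Ψ ((toWeakSpace ℂ _).symm g) := fun Ψ =>
    ulim_eq (((WeakBilin.eval_continuous (topDualPairing ℂ (StrongDual ℂ A)).flip Ψ).tendsto g).comp
      hg)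
  have h1 := key (evalLimit V)
  have h2 : ∀ b : Metric.closedBall (0 : A) 1, ulim U (fun a => F (a * b : A)) =
      (toWeakSpace ℂ (StrongDual ℂ A)).symm g b := fun b =>
    key (NormedSpace.inclusionInDoubleDual ℂ A b)
  simp only [h2]
  exact h1

/-- A bounded set is relatively weakly compact once the weak-* closure of its image in the bidual
stays inside the space. A point `z` of that closure, here in the third dual of `A`, is a limit of F
· a along some `U`. The only candidate for it is g(b) = lim_U F(ab). Goldstine's theorem writes any
Ψ in the unit ball of A** as a limit of evaluations, and the interchange yields z(Ψ) = Ψ(g). -/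
theorem isWAPFunctional_of_interchangeable {F : StrongDual ℂ A}
    (hF : Interchangeable fun a b : Metric.closedBall (0 : A) 1 => F (a * b : A)) :
    IsWAPFunctional F := by
  have hact : ∀ (a : Metric.closedBall (0 : A) 1), ‖dualAct F (a : A)‖ ≤ ‖F‖ := fun a => by
    refine (dualAct F (a : A)).opNorm_le_bound (norm_nonneg _) fun b => ?_
    have ha : ‖(a : A)‖ ≤ 1 := mem_closedBall_zero_iff.1 a.2
    refine (F.le_opNorm _).trans (mul_le_mul_of_nonneg_left ?_ (norm_nonneg _))
    exact (norm_mul_le _ _).trans (mul_le_of_le_one_left (norm_nonneg _) ha)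
  refine NormedSpace.isCompact_closure_of_isBounded ℂ _ _ ?_ ?_
  · refine isBounded_iff_forall_norm_le.2 ⟨‖F‖, ?_⟩
    rintro φ ⟨ψ, ⟨a, ha, rfl⟩, h⟩
    obtain rfl := (toWeakSpace ℂ (StrongDual ℂ A)).injective h
    exact hact ⟨a, by simpa using ha⟩
  · intro z hz
    have hne : (comap (fun a : Metric.closedBall (0 : A) 1 =>
        NormedSpace.inclusionInDoubleDualWeak ℂ _ (toWeakSpace ℂ _ (dualAct F (a : A))))
          (𝓝 z)).NeBot := by
      rw [comap_neBot_iff]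
      intro t ht
      obtain ⟨_, hxt, _, ⟨_, ⟨a, ha, rfl⟩, rfl⟩, rfl⟩ := mem_closure_iff_nhds.1 hz t ht
      exact ⟨⟨a, by simpa using ha⟩, hxt⟩
    let U := Ultrafilter.of (comap (fun a : Metric.closedBall (0 : A) 1 =>
      NormedSpace.inclusionInDoubleDualWeak ℂ _ (toWeakSpace ℂ _ (dualAct F (a : A)))) (𝓝 z))
    have hU : ∀ Ψ : StrongDual ℂ (StrongDual ℂ A),
        Tendsto (fun a : Metric.closedBall (0 : A) 1 => Ψ (dualAct F (a : A))) U (𝓝 (z Ψ)) :=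
      fun Ψ => ((WeakDual.eval_continuous Ψ).tendsto z).comp
        (tendsto_iff_comap.2 (Ultrafilter.of_le _))
    have hb : ∀ b : A, Tendsto (fun a : Metric.closedBall (0 : A) 1 => F (a * b : A)) U
        (𝓝 (ulim U fun a => F (a * b : A))) := fun b =>
      tendsto_ulim U (C := ‖F‖ * ‖b‖) fun a => (dualAct F (a : A)).le_of_opNorm_le (hact a) b
    let g : StrongDual ℂ A := LinearMap.mkContinuous
      { toFun := fun b => ulim U fun a => F (a * b : A)
        map_add' := fun b c => ulim_eq (((hb b).add (hb c)).congr fun a => by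
          rw [mul_add, map_add])
        map_smul' := fun r b => ulim_eq (((hb b).const_smul r).congr fun a => by
          rw [mul_smul_comm, map_smul]) } ‖F‖
      fun b => norm_ulim_le U fun a => (dualAct F (a : A)).le_of_opNorm_le (hact a) b
    have key : ∀ Ψ : StrongDual ℂ (StrongDual ℂ A), ‖Ψ‖ ≤ 1 → z Ψ = Ψ g := by
      intro Ψ hΨ
      obtain ⟨V, hV⟩ := exists_ultrafilter_tendsto_of_norming
        (fun b : Metric.closedBall (0 : A) 1 => NormedSpace.inclusionInDoubleDual ℂ A b)
        (by
          rw [Set.range_comp' (NormedSpace.inclusionInDoubleDual ℂ A) Subtype.val,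
            Subtype.range_coe]
          exact (convex_closedBall (0 : A) 1).linear_image
            ((NormedSpace.inclusionInDoubleDual ℂ A).toLinearMap.restrictScalars ℝ))
        norm_le_of_re_le Ψ hΨ
      have h1 : ∀ φ : StrongDual ℂ A, Ψ φ = ulim V fun b => φ b := fun φ => (ulim_eq (hV φ)).symm
      rw [← ulim_eq (hU Ψ)]
      simp only [h1]
      exact hF.ulim_comm U V
    refine ⟨toWeakSpace ℂ _ g, ?_⟩
    refine DFunLike.ext _ _ fun Ψ => ?_
    change Ψ g = z Ψ
    rcases eq_or_ne Ψ 0 with rfl | hΨ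
    · exact (map_zero z).symm
    · have h0 : (‖Ψ‖ : ℂ) ≠ 0 := by exact_mod_cast norm_ne_zero_iff.2 hΨ
      have h1 := key ((‖Ψ‖ : ℂ)⁻¹ • Ψ) (by
        refine (ContinuousLinearMap.opNorm_smul_le _ _).trans_eq ?_
        rw [norm_inv, Complex.norm_real, norm_norm, inv_mul_cancel₀ (norm_ne_zero_iff.2 hΨ)])
      rw [map_smul, smul_apply, smul_eq_mul, smul_eq_mul] at h1
      exact (mul_left_cancel₀ (inv_ne_zero h0) h1).symm

/-- Weakly almost periodic functionals pull back along `Φ` as soon as their kernels do. -/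
theorem IsWAPAlgebra.of_isometry {B : Type*} [NonUnitalNormedRing B] [NormedSpace ℂ B]
    [IsScalarTower ℂ B B] [SMulCommClass ℂ B B] (hA : IsWAPAlgebra A) (Φ : B →ₗᵢ[ℂ] A)
    (hΦ : ∀ F : StrongDual ℂ A, IsWAPFunctional F →
      Interchangeable fun a b : Metric.closedBall (0 : B) 1 => F (Φ (a * b : B))) :
    IsWAPAlgebra B := by
  obtain ⟨c, hc, h⟩ := hA
  refine ⟨c, hc, fun b hb => (h (Φ b) (by rwa [Φ.norm_map])).trans ?_⟩
  -- Evaluating `F` at `Φ b` is evaluating `F ∘ Φ` at `b`. This functional is weakly almost periodic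
  -- on `B` with norm at most ‖F‖, so the constant `c` survives. Multiplicativity of `Φ` plays no
  -- role.
  refine ContinuousLinearMap.opNorm_le_bound _ (norm_nonneg (wapEmbedding b)) fun F => ?_
  let G : StrongDual ℂ B := F.1.comp Φ.toContinuousLinearMap
  have hG : IsWAPFunctional G := isWAPFunctional_of_interchangeable (hΦ F.1 F.2)
  refine ((wapEmbedding b).le_opNorm ⟨G, hG⟩).trans
    (mul_le_mul_of_nonneg_left ?_ (norm_nonneg _))
  refine G.opNorm_le_bound (norm_nonneg F.1) fun x => ?_
  exact (F.1.le_opNorm _).trans_eq (by rw [← Φ.norm_map x]; rfl)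

end WAP

/-! ### The kernel Ω. -/

theorem WAP.Weight.Omega_nonneg {S : Type*} [Mul S] (ω : WAP.Weight S) (p : S × S) :
    0 ≤ ω.Omega p :=
  div_nonneg (ω.pos _).le (mul_nonneg (ω.pos _).le (ω.pos _).le)

theorem WAP.Weight.Omega_le_one {S : Type*} [Mul S] (ω : WAP.Weight S) (p : S × S) :
    ω.Omega p ≤ 1 :=
  div_le_one_of_le₀ (ω.mul_le _ _) (mul_nonneg (ω.pos _).le (ω.pos _).le)

theorem WAP.Weight.mul_Omega {S : Type*} [Mul S] (ω : WAP.Weight S) (x y : S) :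
    ω x * ω y * ω.Omega (x, y) = ω (x * y) :=
  mul_div_cancel₀ _ (mul_pos (ω.pos x) (ω.pos y)).ne'

theorem WAP.Weight.interchangeable_Omega {S : Type*} [Mul S] {ω : WAP.Weight S}
    (hΩ : WAP.IsCluster fun p : S × S => ((ω.Omega p : ℝ) : ℂ)) :
    Interchangeable fun x y => ((ω.Omega (x, y) : ℝ) : ℂ) :=
  hΩ.interchangeable (C := 1) fun p => by
    rw [Complex.norm_of_nonneg (ω.Omega_nonneg p)]
    exact ω.Omega_le_one p

/-! ### The case of ℓ¹(S, ω). -/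

namespace WeightedSemigroupAlgebra

open WAP

variable {S : Type*}

section Mul

variable [Mul S] {ω : Weight S}

/-- Evaluation of coefficients. -/
noncomputable def coeffLinear (s : S) : WeightedSemigroupAlgebra ω →ₗ[ℂ] ℂ where
  toFun f := f.coeff s
  map_add' f g := coeff_add f g s
  map_smul' c f := coeff_smul c f s

open scoped Classical in
/-- The point mass at `s`. -/
noncomputable def single (s : S) : WeightedSemigroupAlgebra ω :=
  ⟨Pi.single s 1, summable_of_ne_finset_zero (s := {s}) fun t ht => by
    rw [Pi.single_eq_of_ne (by simpa using ht), norm_zero, zero_mul]⟩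

theorem coeff_single_self (s : S) : (single s : WeightedSemigroupAlgebra ω).coeff s = 1 := by
  classical
  exact Pi.single_eq_same s 1

theorem coeff_single_of_ne {s t : S} (h : t ≠ s) :
    (single s : WeightedSemigroupAlgebra ω).coeff t = 0 := by
  classical
  exact Pi.single_eq_of_ne h 1

theorem norm_single (s : S) : ‖(single s : WeightedSemigroupAlgebra ω)‖ = ω s := by
  rw [norm_def, tsum_eq_single s fun t ht => by rw [coeff_single_of_ne ht, norm_zero, zero_mul],
    coeff_single_self, norm_one, one_mul]

theorem pairing_single (s : S) (φ : S → ℂ) :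
    pairing (single s : WeightedSemigroupAlgebra ω) φ = φ s := by
  rw [pairing, tsum_eq_single s fun t ht => by rw [coeff_single_of_ne ht, zero_mul],
    coeff_single_self, one_mul]

theorem single_mul_single (s t : S) :
    (single s * single t : WeightedSemigroupAlgebra ω) = single (s * t) := by
  classical
  refine ext fun z => ?_
  rw [coeff_mul_eq_pairing, pairing_single, pairing_single]
  rcases eq_or_ne z (s * t) with rfl | h
  · rw [if_pos rfl, coeff_single_self]
  · rw [if_neg h.symm, coeff_single_of_ne h]

/-- The distance from `h` to a partial sum is a tail of the series defining ‖h‖. Consequently a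
bounded functional is determined by its values on point masses. -/
theorem hasSum_single (h : WeightedSemigroupAlgebra ω) :
    HasSum (fun s => h.coeff s • (single s : WeightedSemigroupAlgebra ω)) h := by
  refine tendsto_iff_norm_sub_tendsto_zero.2 ?_
  refine (tendsto_tsum_compl_atTop_zero fun s => ‖h.coeff s‖ * ω s).congr fun T => ?_
  rw [norm_sub_rev, norm_def]
  refine (tsum_subtype {s | s ∉ T} fun s => ‖h.coeff s‖ * ω s).trans (tsum_congr fun s => ?_)
  have h1 : (h - ∑ t ∈ T, h.coeff t • (single t : WeightedSemigroupAlgebra ω)).coeff s =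
      h.coeff s - ∑ t ∈ T, h.coeff t * (single t : WeightedSemigroupAlgebra ω).coeff s := by
    refine (map_sub (coeffLinear s) _ _).trans ?_
    rw [map_sum]
    simp only [map_smul]
    rfl
  rw [h1]
  by_cases hs : s ∈ T
  · rw [Finset.sum_eq_single_of_mem s hs fun t _ ht => by
      rw [coeff_single_of_ne ht.symm, mul_zero], coeff_single_self, mul_one, sub_self, norm_zero,
      zero_mul]
    exact Set.indicator_of_notMem (s := {s | s ∉ T}) (fun h => h hs) _
  · rw [Finset.sum_eq_zero fun t ht => by
      rw [coeff_single_of_ne (ne_of_mem_of_not_mem ht hs).symm, mul_zero], sub_zero]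
    exact Set.indicator_of_mem (s := {s | s ∉ T}) hs _

theorem apply_eq_pairing (F : StrongDual ℂ (WeightedSemigroupAlgebra ω))
    (h : WeightedSemigroupAlgebra ω) : F h = pairing h fun s => F (single s) := by
  have h1 := (hasSum_single h).mapL F
  simp only [map_smul, smul_eq_mul] at h1
  exact h1.tsum_eq.symm

/-- Multiplication by the weight, an isometry onto the unweighted algebra. -/
noncomputable def mulWeight (ω : Weight S) :
    WeightedSemigroupAlgebra ω →ₗᵢ[ℂ] SemigroupAlgebra S where
  toFun f := ⟨fun s => f.coeff s * ω s, f.summable_weight.congr fun s => by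
    rw [norm_mul, Complex.norm_of_nonneg (ω.pos s).le]
    exact (mul_one _).symm⟩
  map_add' f g := ext fun s => add_mul _ _ _
  map_smul' c f := ext fun s => mul_assoc _ _ _
  norm_map' f := by
    rw [norm_def, norm_def]
    refine tsum_congr fun s => ?_
    change ‖f.coeff s * ω s‖ * 1 = _
    rw [norm_mul, Complex.norm_of_nonneg (ω.pos s).le, mul_one]

theorem coeff_mulWeight (f : WeightedSemigroupAlgebra ω) (s : S) :
    (mulWeight ω f).coeff s = f.coeff s * ω s := rfl

/-- The function ωφ may be unbounded, so `pairing_mul` does not apply. Absolute convergence of the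
double series comes from submultiplicativity of ω. -/
theorem pairing_mulWeight_mul (f g : WeightedSemigroupAlgebra ω) {φ : S → ℂ} {C : ℝ}
    (hφ : ∀ s, ‖φ s‖ ≤ C) : pairing (mulWeight ω (f * g)) φ =
      ∑' x, ∑' y, f.coeff x * g.coeff y * (ω (x * y) * φ (x * y)) := by
  have hs : Summable fun p : S × S =>
      f.coeff p.1 * g.coeff p.2 * (ω (p.1 * p.2) * φ (p.1 * p.2)) := by
    refine Summable.of_norm_bounded ((f.summable_prod_weight g).mul_right C) fun p => ?_
    rw [norm_mul, norm_mul (ω (p.1 * p.2) : ℂ), Complex.norm_of_nonneg (ω.pos _).le, mul_assoc]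
    refine mul_le_mul_of_nonneg_left ?_ (norm_nonneg _)
    exact mul_le_mul (ω.mul_le _ _) (hφ _) (norm_nonneg _)
      (mul_nonneg (ω.pos _).le (ω.pos _).le)
  rw [← hs.tsum_prod, ← (fiberEquiv (S := S)).tsum_eq]
  refine Eq.trans ?_ ((fiberEquiv (S := S)).summable_iff.2 hs).tsum_sigma.symm
  refine tsum_congr fun s => ?_
  rw [coeff_mulWeight, coeff_mul, mul_assoc, ← tsum_mul_right]
  refine tsum_congr fun p => ?_
  have hp : p.1.1 * p.1.2 = s := p.2
  change _ = f.coeff p.1.1 * g.coeff p.1.2 * (ω (p.1.1 * p.1.2) * φ (p.1.1 * p.1.2))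
  rw [hp]

end Mul

section Semigroup

variable [Semigroup S] {ω : Weight S}

/-- The double sum for F(Φ(f * g)) is an average of Ω(x, y) F(δ_{xy}) with nonnegative weights
|f(x)|ω(x) and |g(y)|ω(y) of total mass at most 1, once the phases of f and g are moved into the
kernel. -/
theorem interchangeable_mulWeight
    (hΩ : IsCluster fun p : S × S => ((ω.Omega p : ℝ) : ℂ))
    {F : StrongDual ℂ (SemigroupAlgebra S)} (hF : IsWAPFunctional F) :
    Interchangeable fun f g : Metric.closedBall (0 : WeightedSemigroupAlgebra ω) 1 =>
      F (mulWeight ω (f * g : WeightedSemigroupAlgebra ω)) := by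
  have hδ : ∀ s : S, ‖(single s : SemigroupAlgebra S)‖ = 1 := fun s => norm_single s
  have h1 : Interchangeable fun x y : S => F (single (x * y)) := by
    have := hF.interchangeable.comp
      (fun x : S => ⟨single x, mem_closedBall_zero_iff.2 (hδ x).le⟩)
      (fun x : S => ⟨single x, mem_closedBall_zero_iff.2 (hδ x).le⟩)
    simpa only [single_mul_single] using this
  -- The phase of a coefficient, equal to 0 where the coefficient vanishes because division by zero
  -- gives 0.
  let u : (Metric.closedBall (0 : WeightedSemigroupAlgebra ω) 1) × S → ℂ := fun p =>
    p.1.1.coeff p.2 / ‖p.1.1.coeff p.2‖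
  have hu : ∀ p, ‖u p‖ ≤ 1 := fun p => by
    rw [norm_div, Complex.norm_real, norm_norm]
    exact div_self_le_one _
  have hu' : ∀ f s, ((‖f.1.coeff s‖ : ℝ) : ℂ) * u (f, s) = f.1.coeff s := fun f s => by
    rcases eq_or_ne (f.1.coeff s) 0 with h | h
    · simp [h, u]
    · exact mul_div_cancel₀ _ (by exact_mod_cast norm_ne_zero_iff.2 h)
  -- With pairs (element of the ball, point of S) as variables, each phase depends on one variable
  -- only and is trivially interchangeable.
  have h2 : Interchangeable fun p q : (Metric.closedBall (0 : WeightedSemigroupAlgebra ω) 1) × S =>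
      u p * u q * (((ω.Omega (p.2, q.2) : ℝ) : ℂ) * F (single (p.2 * q.2))) :=
    ((Interchangeable.of_left hu).mul (Interchangeable.of_right hu)).mul
      (((Weight.interchangeable_Omega hΩ).comp Prod.snd Prod.snd).mul (h1.comp Prod.snd Prod.snd))
  have hP0 : ∀ (f : Metric.closedBall (0 : WeightedSemigroupAlgebra ω) 1) (s : S),
      0 ≤ ‖f.1.coeff s‖ * ω s := fun f s => mul_nonneg (norm_nonneg _) (ω.pos s).le
  have hP1 : ∀ f : Metric.closedBall (0 : WeightedSemigroupAlgebra ω) 1,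
      ∑' s, ‖f.1.coeff s‖ * ω s ≤ 1 := fun f => mem_closedBall_zero_iff.1 f.2
  have h3 := h2.tsum_tsum hP0 (fun f => f.1.summable_weight) hP1 hP0
    (fun f => f.1.summable_weight) hP1
  convert h3 using 3 with f g
  rw [apply_eq_pairing, pairing_mulWeight_mul _ _ (C := ‖F‖) fun s => F.unit_le_opNorm _ (hδ s).le]
  refine tsum_congr fun x => ?_
  rw [← tsum_mul_left]
  refine tsum_congr fun y => ?_
  have h4 : (ω x * ω y * (ω.Omega (x, y) : ℝ) : ℂ) = ω (x * y) := by
    exact_mod_cast ω.mul_Omega x y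
  push_cast
  linear_combination
    (-(‖g.1.coeff y‖ * u (g, y) * (ω x * ω y * ω.Omega (x, y)) * F (single (x * y)))) * hu' f x -
      f.1.coeff x * (ω x * ω y * ω.Omega (x, y)) * F (single (x * y)) * hu' g y -
      f.1.coeff x * g.1.coeff y * F (single (x * y)) * h4

theorem isWAPAlgebra (hΩ : IsCluster fun p : S × S => ((ω.Omega p : ℝ) : ℂ))
    (h : IsWAPAlgebra (SemigroupAlgebra S)) : IsWAPAlgebra (WeightedSemigroupAlgebra ω) :=
  h.of_isometry (mulWeight ω) fun _ hF => interchangeable_mulWeight hΩ hF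

end Semigroup

end WeightedSemigroupAlgebra

/-! ### Separability of the rows of an interchangeable kernel. -/

section Separability

variable {X Y : Type*}

section Functionals

variable [TopologicalSpace Y]

/-- The functionals that are countable absolutely convex combinations of evaluations. -/
def evalCombinations (Y : Type*) [TopologicalSpace Y] :
    Set (StrongDual ℂ (BoundedContinuousFunction Y ℂ)) :=
  {φ | ∃ Q : Y × Metric.closedBall (0 : ℂ) 1 → ℝ, (∀ j, 0 ≤ Q j) ∧ Summable Q ∧ ∑' j, Q j ≤ 1 ∧
    ∀ h, φ h = ∑' j, (Q j : ℂ) * (j.2 * h j.1)}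

theorem norm_phase_mul_le (h : BoundedContinuousFunction Y ℂ)
    (j : Y × Metric.closedBall (0 : ℂ) 1) : ‖(j.2 : ℂ) * h j.1‖ ≤ ‖h‖ := by
  rw [norm_mul]
  exact (mul_le_of_le_one_left (norm_nonneg _) (mem_closedBall_zero_iff.1 j.2.2)).trans
    (h.norm_coe_le_norm _)

/-- Together with `norm_le_of_evalCombinations` this supplies the hypotheses of Goldstine's theorem.
The combinations are series with nonnegative weights so that the averaging theorem also applies to
them. -/
theorem convex_evalCombinations : Convex ℝ (evalCombinations Y) := by
  rintro φ ⟨P, hP0, hP, hP1, hφ⟩ ψ ⟨Q, hQ0, hQ, hQ1, hψ⟩ a b ha hb hab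
  refine ⟨fun j => a * P j + b * Q j,
    fun j => add_nonneg (mul_nonneg ha (hP0 j)) (mul_nonneg hb (hQ0 j)),
    (hP.mul_left a).add (hQ.mul_left b), ?_, fun h => ?_⟩
  · rw [(hP.mul_left a).tsum_add (hQ.mul_left b), tsum_mul_left, tsum_mul_left]
    exact (add_le_add (mul_le_of_le_one_right ha hP1) (mul_le_of_le_one_right hb hQ1)).trans hab.le
  · have h1 := summable_ofReal_mul hP0 hP (norm_phase_mul_le h)
    have h2 := summable_ofReal_mul hQ0 hQ (norm_phase_mul_le h)
    have h3 : (a • φ + b • ψ) h = a * φ h + b * ψ h := rfl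
    rw [h3, hφ, hψ, ← tsum_mul_left, ← tsum_mul_left, ← (h1.mul_left _).tsum_add (h2.mul_left _)]
    refine tsum_congr fun j => ?_
    push_cast
    ring

theorem norm_le_of_evalCombinations (h : BoundedContinuousFunction Y ℂ) (C : ℝ)
    (hC : ∀ φ : evalCombinations Y, (φ.1 h).re ≤ C) : ‖h‖ ≤ C := by
  classical
  have hC0 : 0 ≤ C := by
    have := hC ⟨0, 0, fun _ => le_rfl, summable_zero, by simp, fun h => by simp⟩
    simpa using this
  refine (BoundedContinuousFunction.norm_le hC0).2 fun y => ?_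
  rcases eq_or_ne (h y) 0 with hy | hy
  · rwa [hy, norm_zero]
  let c : ℂ := (starRingEnd ℂ) (h y) / ‖h y‖
  have hc : ‖c‖ ≤ 1 := by
    rw [norm_div, RCLike.norm_conj, Complex.norm_real, norm_norm]
    exact div_self_le_one _
  let j : Y × Metric.closedBall (0 : ℂ) 1 := (y, ⟨c, mem_closedBall_zero_iff.2 hc⟩)
  have h1 := hC ⟨c • BoundedContinuousFunction.evalCLM ℂ y, Pi.single j 1,
    fun i => by by_cases hi : i = j <;> simp [hi],
    summable_of_ne_finset_zero (s := {j}) fun i hi =>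
      Pi.single_eq_of_ne (by simpa using hi) _,
    by rw [tsum_pi_single], fun h => by
      rw [tsum_eq_single j fun i hi => by rw [Pi.single_eq_of_ne hi, Complex.ofReal_zero, zero_mul],
        Pi.single_eq_same, Complex.ofReal_one, one_mul]
      rfl⟩
  have h2 : (c • BoundedContinuousFunction.evalCLM ℂ y) h = c * h y := rfl
  have h3 : c * h y = (‖h y‖ : ℂ) := by
    have : (‖h y‖ : ℂ) ≠ 0 := by exact_mod_cast norm_ne_zero_iff.2 hy
    rw [div_mul_eq_mul_div, Complex.conj_mul', div_eq_iff this, sq]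
  change ((c • BoundedContinuousFunction.evalCLM ℂ y) h).re ≤ C at h1
  rw [h2, h3, Complex.ofReal_re] at h1
  exact h1

theorem Interchangeable.evalCombinations {r : X → BoundedContinuousFunction Y ℂ}
    (hr : Interchangeable fun x y => r x y) :
    Interchangeable fun x (φ : evalCombinations Y) => φ.1 (r x) := by
  choose Q hQ0 hQ hQ1 hφ using fun φ : _root_.evalCombinations Y => φ.2
  have h1 : Interchangeable fun (x : X)
      (p : _root_.evalCombinations Y × (Y × Metric.closedBall (0 : ℂ) 1)) =>
        (p.2.2 : ℂ) * r x p.2.1 :=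
    (Interchangeable.of_right (C := 1) (f := fun p : _root_.evalCombinations Y ×
      (Y × Metric.closedBall (0 : ℂ) 1) => (p.2.2 : ℂ)) fun p =>
        mem_closedBall_zero_iff.1 p.2.2.2).mul
      (hr.comp id fun p : _root_.evalCombinations Y × (Y × Metric.closedBall (0 : ℂ) 1) => p.2.1)
  simpa only [hφ] using h1.tsum_right hQ0 hQ hQ1

/-- A pointwise limit of an interchangeable family lies in its norm-closed span. -/
theorem Interchangeable.mem_closure_span {r : X → BoundedContinuousFunction Y ℂ}
    (hr : Interchangeable fun x y => r x y) {D : Set X} {U : Ultrafilter X} (hD : D ∈ U) {x₀ : X}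
    (hU : ∀ y, Tendsto (fun x => r x y) U (𝓝 (r x₀ y))) :
    r x₀ ∈ closure (Submodule.span ℂ (r '' D) : Set (BoundedContinuousFunction Y ℂ)) := by
  by_contra hcon
  obtain ⟨Ψ, u, hΨu, huΨ⟩ := RCLike.geometric_hahn_banach_closed_point (𝕜 := ℂ)
    (((Submodule.span ℂ (r '' D)).restrictScalars ℝ).convex.closure) isClosed_closure hcon
  have hn : 0 < ‖Ψ‖ := by
    refine lt_of_le_of_ne (norm_nonneg Ψ) fun h => ?_
    have h0 := hΨu 0 (subset_closure (Submodule.zero_mem _))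
    have h1 : Ψ (r x₀) = 0 := by
      have h2 := Ψ.le_opNorm (r x₀)
      rw [← h, zero_mul] at h2
      exact norm_le_zero_iff.1 h2
    rw [h1] at huΨ
    rw [map_zero] at h0
    exact lt_asymm h0 huΨ
  have hn' : (‖Ψ‖ : ℂ) ≠ 0 := by exact_mod_cast hn.ne'
  obtain ⟨C, hC⟩ := hr.bounded
  have hC0 : 0 ≤ max C 0 := le_max_right _ _
  have hrC : ∀ x, ‖r x‖ ≤ max C 0 := fun x =>
    (BoundedContinuousFunction.norm_le hC0).2 fun y => (hC x y).trans (le_max_left _ _)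
  -- The normalised separating functional is a limit of combinations of evaluations. Each
  -- combination respects the convergence of r(x) to r(x₀) along `U` by dominated convergence, and
  -- the interchange of `U` with `V` passes this on to `Ψ`. As `D ∈ U`, this contradicts the
  -- separation.
  obtain ⟨V, hV⟩ := exists_ultrafilter_tendsto_of_norming
    (fun φ : _root_.evalCombinations Y => φ.1)
    (by rw [Subtype.range_coe]; exact convex_evalCombinations) norm_le_of_evalCombinations
    ((‖Ψ‖ : ℂ)⁻¹ • Ψ) (by
      rw [norm_smul, norm_inv, Complex.norm_real, norm_norm, inv_mul_cancel₀ hn.ne'])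
  have h1 : ∀ φ : _root_.evalCombinations Y, ulim U (fun x => φ.1 (r x)) = φ.1 (r x₀) := by
    rintro ⟨φ, Q, hQ0, hQ, -, hφ⟩
    refine ulim_eq ?_
    simp only [hφ]
    refine tendsto_tsum_of_dominated_convergence (hQ.mul_right (max C 0))
      (fun j => ((hU j.1).const_mul _).const_mul _) (Eventually.of_forall fun x j => ?_)
    rw [norm_mul, Complex.norm_of_nonneg (hQ0 j)]
    exact mul_le_mul_of_nonneg_left ((norm_phase_mul_le _ _).trans (hrC x)) (hQ0 j)
  have h2 := hr.evalCombinations.ulim_comm U V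
  have h3 : ∀ x, ulim V (fun φ : _root_.evalCombinations Y => φ.1 (r x)) = (‖Ψ‖ : ℂ)⁻¹ * Ψ (r x) :=
    fun x => ulim_eq (hV (r x))
  simp only [h1, h3] at h2
  have h4 : Tendsto (fun x => (‖Ψ‖ : ℂ)⁻¹ * Ψ (r x)) U (𝓝 ((‖Ψ‖ : ℂ)⁻¹ * Ψ (r x₀))) := by
    rw [← h2]
    refine tendsto_ulim U (C := ‖(‖Ψ‖ : ℂ)⁻¹‖ * (‖Ψ‖ * max C 0)) fun x => ?_
    rw [norm_mul]
    exact mul_le_mul_of_nonneg_left (Ψ.le_opNorm_of_le (hrC x)) (norm_nonneg _)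
  have h5 : Tendsto (fun x => Ψ (r x)) U (𝓝 (Ψ (r x₀))) := by
    have := h4.const_mul (‖Ψ‖ : ℂ)
    simpa only [mul_inv_cancel_left₀ hn'] using this
  have h6 : (Ψ (r x₀)).re ≤ u := by
    refine le_of_tendsto ((Complex.continuous_re.tendsto _).comp h5) ?_
    filter_upwards [hD] with x hx
    exact (hΨu _ (subset_closure (Submodule.subset_span ⟨x, hx, rfl⟩))).le
  exact absurd huΨ h6.not_gt

end Functionals

theorem exists_countable_forall_mem_closure {E : Type*} [TopologicalSpace E] (r : X → E)
    [TopologicalSpace.SeparableSpace (Set.range r)] :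
    ∃ D : Set X, D.Countable ∧ ∀ x, r x ∈ closure (r '' D) := by
  obtain ⟨t, htc, htd⟩ := TopologicalSpace.exists_countable_dense (Set.range r)
  choose g hg using fun z : Set.range r => z.2
  refine ⟨g '' t, htc.image g, fun x => ?_⟩
  have h1 : (⟨r x, x, rfl⟩ : Set.range r) ∈ closure t := htd _
  rw [closure_subtype] at h1
  refine closure_mono ?_ h1
  rintro _ ⟨z, hz, rfl⟩
  exact ⟨g z, ⟨z, hz, rfl⟩, hg z⟩

/-- The closed span of a countable set is separable, and so are its subsets. Hence the rows can be
approximated by rows instead of linear combinations of rows. -/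
theorem exists_countable_dense_of_mem_closure_span {E : Type*} [NormedAddCommGroup E]
    [NormedSpace ℂ E] {r : X → E} {D : Set X} (hD : D.Countable)
    (h : ∀ x, r x ∈ closure (Submodule.span ℂ (r '' D) : Set E)) :
    ∃ D' : Set X, D'.Countable ∧ ∀ x, ∀ ε > 0, ∃ d ∈ D', ‖r x - r d‖ < ε := by
  have h1 : TopologicalSpace.IsSeparable (Set.range r) :=
    ((hD.image r).isSeparable.span (R := ℂ)).closure.mono (Set.range_subset_iff.2 h)
  have := h1.separableSpace
  obtain ⟨D', hD', hrD'⟩ := exists_countable_forall_mem_closure r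
  refine ⟨D', hD', fun x ε hε => ?_⟩
  obtain ⟨_, ⟨d, hd, rfl⟩, hxd⟩ := Metric.mem_closure_iff.1 (hrD' x) ε hε
  exact ⟨d, hd, by rwa [← dist_eq_norm]⟩

theorem exists_ultrafilter_of_mem_closure_image {E : Type*} [TopologicalSpace E] {r : X → E}
    {D : Set X} {a : E} (h : a ∈ closure (r '' D)) :
    ∃ U : Ultrafilter X, D ∈ U ∧ Tendsto r U (𝓝 a) := by
  obtain ⟨u, hu, hua⟩ := mem_closure_iff_ultrafilter.1 h
  refine ⟨Ultrafilter.ofComapInfPrincipal hu, Ultrafilter.ofComapInfPrincipal_mem hu, ?_⟩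
  have h1 := Ultrafilter.ofComapInfPrincipal_eq_of_map hu
  change ((Ultrafilter.map r (Ultrafilter.ofComapInfPrincipal hu) : Ultrafilter E) : Filter E) ≤ _
  rw [h1]
  exact hua

/-- The rows of an interchangeable kernel over a countable set are separable for the uniform
norm. -/
theorem Interchangeable.exists_countable_uniform [Countable Y] {f : X → Y → ℂ}
    (hf : Interchangeable f) :
    ∃ D : Set X, D.Countable ∧ ∀ x, ∀ ε > 0, ∃ d ∈ D, ∀ y, ‖f x y - f d y‖ ≤ ε := by
  let _ : TopologicalSpace Y := ⊥
  have _ : DiscreteTopology Y := ⟨rfl⟩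
  obtain ⟨C, hC⟩ := hf.bounded
  let r : X → BoundedContinuousFunction Y ℂ := fun x =>
    BoundedContinuousFunction.ofNormedAddCommGroupDiscrete (f x) C (hC x)
  -- As `Y` is countable, the product topology is second countable, which gives a countable set
  -- dense for pointwise convergence. `mem_closure_span` upgrades this to the uniform norm.
  obtain ⟨D, hD, hfD⟩ := exists_countable_forall_mem_closure f
  obtain ⟨D', hD', h⟩ := exists_countable_dense_of_mem_closure_span (r := r) hD fun x => by
    obtain ⟨U, hDU, hU⟩ := exists_ultrafilter_of_mem_closure_image (hfD x)
    exact Interchangeable.mem_closure_span (r := r) hf hDU (tendsto_pi_nhds.1 hU)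
  refine ⟨D', hD', fun x ε hε => ?_⟩
  obtain ⟨d, hd, hxd⟩ := h x ε hε
  exact ⟨d, hd, fun y => ((r x - r d).norm_coe_le_norm y).trans hxd.le⟩

/-- Sequences of rows of an interchangeable kernel have pointwise convergent subsequences. -/
theorem Interchangeable.exists_subseq_tendsto {f : X → Y → ℂ} (hf : Interchangeable f)
    (x : ℕ → X) : ∃ φ : ℕ → ℕ, StrictMono φ ∧
      ∀ y, ∃ l, Tendsto (fun n => f (x (φ n)) y) atTop (𝓝 l) := by
  obtain ⟨C, hC⟩ := hf.bounded
  -- With the roles exchanged, countably many rows leave the columns uniformly separable. A diagonal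
  -- subsequence converging on a countable dense set of columns therefore converges on all of them.
  obtain ⟨D, hD, h⟩ := (hf.comp x id).swap.exists_countable_uniform
  have := hD.to_subtype
  obtain ⟨k, -, φ, hφ, hk⟩ := (isCompact_univ_pi fun _ : D =>
    isCompact_closedBall (0 : ℂ) C).tendsto_subseq (x := fun n (d : D) => f (x n) d)
      fun n d _ => by simpa using hC (x n) d
  refine ⟨φ, hφ, fun y => cauchySeq_tendsto_of_complete (Metric.cauchySeq_iff'.2 fun ε hε => ?_)⟩
  obtain ⟨d, hd, hyd⟩ := h y (ε / 4) (by positivity)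
  obtain ⟨N, hN⟩ := Metric.cauchySeq_iff'.1 (tendsto_pi_nhds.1 hk ⟨d, hd⟩).cauchySeq (ε / 4)
    (by positivity)
  refine ⟨N, fun n hn => ?_⟩
  have h1 : dist (f (x (φ n)) y) (f (x (φ n)) d) ≤ ε / 4 := by
    rw [dist_eq_norm]; exact hyd (φ n)
  have h2 : dist (f (x (φ N)) d) (f (x (φ N)) y) ≤ ε / 4 := by
    rw [dist_comm, dist_eq_norm]; exact hyd (φ N)
  have h3 : dist (f (x (φ n)) d) (f (x (φ N)) d) < ε / 4 := hN n hn
  have h4 := dist_triangle4 (f (x (φ n)) y) (f (x (φ n)) d) (f (x (φ N)) d) (f (x (φ N)) y)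
  linarith

/-- If total boundedness fails, a greedy choice gives an ε-separated sequence, which has no Cauchy
subsequence. -/
theorem totallyBounded_range_of_subseq {E : Type*} [PseudoMetricSpace E] {r : X → E}
    (h : ∀ x : ℕ → X, ∃ φ : ℕ → ℕ, StrictMono φ ∧ CauchySeq fun n => r (x (φ n))) :
    TotallyBounded (Set.range r) := by
  rw [Metric.totallyBounded_iff]
  by_contra! hcon
  obtain ⟨ε, hε, hcon⟩ := hcon
  obtain ⟨x, -, hx⟩ := exists_seq_of_forall_finset_exists (P := fun _ : X => True)
    (r := fun a b => ε ≤ dist (r b) (r a)) (by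
      intro s _
      by_contra! hs
      refine hcon (r '' s) (s.finite_toSet.image r) ?_
      rintro _ ⟨y, rfl⟩
      obtain ⟨a, ha, hya⟩ := hs y trivial
      exact Set.mem_biUnion ⟨a, ha, rfl⟩ hya)
  obtain ⟨φ, hφ, hc⟩ := h x
  obtain ⟨N, hN⟩ := Metric.cauchySeq_iff'.1 hc ε hε
  exact absurd (hN (N + 1) N.le_succ) (hx _ _ (hφ N.lt_succ_self)).not_gt

section AlmostEverywhere

variable [MeasurableSpace Y] (ν : Measure Y)

/-- Integrable-power functions as a submodule, mapped to `Lp`. -/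
noncomputable def toLpLinear (p : ℝ≥0∞) :
    ({ carrier := {h : Y → ℂ | MemLp h p ν}
       add_mem' := fun h k => h.add k
       zero_mem' := MemLp.zero
       smul_mem' := fun c _ h => h.const_smul c } : Submodule ℂ (Y → ℂ)) →ₗ[ℂ] Lp ℂ p ν where
  toFun h := h.2.toLp
  map_add' h k := MemLp.toLp_add h.2 k.2
  map_smul' c h := MemLp.toLp_const_smul c h.2

/-- The rows of an interchangeable kernel are separable for the essential supremum norm of a finite
measure. -/
theorem Interchangeable.exists_countable_ae [IsFiniteMeasure ν] {f : X → Y → ℂ}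
    (hf : Interchangeable f) (hm : ∀ x, Measurable (f x)) :
    ∃ D : Set X, D.Countable ∧ ∀ x, ∀ ε > 0, ∃ d ∈ D, ∀ᵐ y ∂ν, ‖f x y - f d y‖ ≤ ε := by
  obtain ⟨C, hC⟩ := hf.bounded
  have hLp : ∀ (p : ℝ≥0∞) x, MemLp (f x) p ν := fun p x =>
    MemLp.of_bound (hm x).aestronglyMeasurable C (Eventually.of_forall (hC x))
  -- Pointwise convergent subsequences and dominated convergence make the rows totally bounded in
  -- L¹, hence L¹-separable.
  have h1 : TotallyBounded (Set.range fun x => (hLp 1 x).toLp) := by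
    refine totallyBounded_range_of_subseq fun x => ?_
    obtain ⟨φ, hφ, hlim⟩ := hf.exists_subseq_tendsto x
    choose g hg using hlim
    have hgm : Measurable g :=
      measurable_of_tendsto_metrizable (fun n => hm (x (φ n))) (tendsto_pi_nhds.2 hg)
    have hgLp : MemLp g 1 ν := MemLp.of_bound hgm.aestronglyMeasurable C
      (Eventually.of_forall fun y => le_of_tendsto (hg y).norm
        (Eventually.of_forall fun n => hC _ y))
    refine ⟨φ, hφ, Tendsto.cauchySeq (x := hgLp.toLp) ?_⟩
    rw [Lp.tendsto_Lp_iff_tendsto_eLpNorm'']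
    simp only [eLpNorm_one_eq_lintegral_enorm]
    have h2 := tendsto_lintegral_norm_of_dominated_convergence (μ := ν) (F := fun n => f (x (φ n)))
      (f := g) (bound := fun _ => C) (fun n => (hm _).aestronglyMeasurable)
      (hasFiniteIntegral_const C) (fun n => Eventually.of_forall (hC _))
      (Eventually.of_forall hg)
    simpa only [ofReal_norm, Pi.sub_apply] using h2
  have := h1.isSeparable.separableSpace
  obtain ⟨D, hD, hDd⟩ := exists_countable_forall_mem_closure fun x => (hLp 1 x).toLp
  -- From L¹ to L^∞: an L¹-approximating sequence has a subsequence converging almost everywhere. On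
  -- the set of full measure where it converges, `mem_closure_span` gives approximation in supremum
  -- norm by linear combinations.
  obtain ⟨D', hD', h⟩ := exists_countable_dense_of_mem_closure_span
    (r := fun x => (hLp ∞ x).toLp) hD fun x₀ => by
      obtain ⟨z, hzD, hz⟩ := mem_closure_iff_seq_limit.1 (hDd x₀)
      choose d hdD hd using hzD
      obtain ⟨φ, hφ, hlim⟩ := (tendstoInMeasure_of_tendsto_Lp hz).exists_seq_tendsto_ae
      have hae : ∀ᵐ y ∂ν, Tendsto (fun n => f (d (φ n)) y) atTop (𝓝 (f x₀ y)) := by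
        filter_upwards [hlim, (hLp 1 x₀).coeFn_toLp,
          ae_all_iff.2 fun n => (hLp 1 (d n)).coeFn_toLp] with y h1 h2 h3
        rw [h2] at h1
        refine h1.congr fun n => ?_
        rw [← hd, h3]
      let Y' := {y : Y // Tendsto (fun n => f (d (φ n)) y) atTop (𝓝 (f x₀ y))}
      let _ : TopologicalSpace Y' := ⊥
      have _ : DiscreteTopology Y' := ⟨rfl⟩
      let r : X → BoundedContinuousFunction Y' ℂ := fun x =>
        BoundedContinuousFunction.ofNormedAddCommGroupDiscrete (fun y => f x y) C fun y => hC x y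
      have h2 := Interchangeable.mem_closure_span (r := r) (hf.comp id Subtype.val) (D := D)
        (U := (hyperfilter ℕ).map fun n => d (φ n)) (x₀ := x₀)
        (Filter.mem_map.2 (univ_mem' fun n => hdD _))
        (fun y => tendsto_map'_iff.2 (y.2.mono_left Nat.hyperfilter_le_atTop))
      refine Metric.mem_closure_iff.2 fun ε hε => ?_
      obtain ⟨s, hs, hsε⟩ := Metric.mem_closure_iff.1 h2 ε hε
      obtain ⟨l, hl, rfl⟩ := (Finsupp.mem_span_image_iff_linearCombination ℂ).1 hs
      -- The same coefficients serve in L^∞. The genuine functions are kept so that the combination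
      -- can be evaluated pointwise.
      let w : X → ({ carrier := {h : Y → ℂ | MemLp h ∞ ν}
                     add_mem' := fun h k => h.add k
                     zero_mem' := MemLp.zero
                     smul_mem' := fun c _ h => h.const_smul c } : Submodule ℂ (Y → ℂ)) :=
        fun x => ⟨f x, hLp ∞ x⟩
      refine ⟨Finsupp.linearCombination ℂ (fun x => (hLp ∞ x).toLp) l,
        (Finsupp.mem_span_image_iff_linearCombination ℂ).2 ⟨l, hl, rfl⟩, ?_⟩
      have h3 : (hLp ∞ x₀).toLp - Finsupp.linearCombination ℂ (fun x => (hLp ∞ x).toLp) l =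
          toLpLinear ν ∞ (w x₀ - Finsupp.linearCombination ℂ w l) := by
        rw [map_sub, Finsupp.apply_linearCombination]
        rfl
      have h4 : ∀ᵐ y ∂ν, ‖(w x₀ - Finsupp.linearCombination ℂ w l).1 y‖ ≤
          dist (r x₀) (Finsupp.linearCombination ℂ r l) := by
        filter_upwards [hae] with y hy
        have h5 := (r x₀ - Finsupp.linearCombination ℂ r l).norm_coe_le_norm ⟨y, hy⟩
        rw [← dist_eq_norm] at h5
        have h6 : (w x₀ - Finsupp.linearCombination ℂ w l).1 y =
            (r x₀ - Finsupp.linearCombination ℂ r l) ⟨y, hy⟩ := by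
          rw [BoundedContinuousFunction.sub_apply]
          change f x₀ y - ((LinearMap.proj y).comp (Submodule.subtype _))
            (Finsupp.linearCombination ℂ w l) = f x₀ y -
              (BoundedContinuousFunction.evalCLM ℂ (⟨y, hy⟩ : Y')).toLinearMap
                (Finsupp.linearCombination ℂ r l)
          rw [Finsupp.apply_linearCombination, Finsupp.apply_linearCombination]
          rfl
        rwa [h6]
      rw [dist_eq_norm, h3]
      refine lt_of_le_of_lt ?_ hsε
      refine (Lp.norm_toLp _ (w x₀ - Finsupp.linearCombination ℂ w l).2).trans_le
        (ENNReal.toReal_le_of_le_ofReal dist_nonneg ?_)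
      rw [eLpNorm_exponent_top]
      exact eLpNormEssSup_le_of_ae_bound h4
  refine ⟨D', hD', fun x ε hε => ?_⟩
  obtain ⟨d, hd, hxd⟩ := h x ε hε
  refine ⟨d, hd, ?_⟩
  rw [← MemLp.toLp_sub, Lp.norm_toLp, eLpNorm_exponent_top] at hxd
  filter_upwards [ae_le_eLpNormEssSup (f := f x - f d) (μ := ν)] with y hy
  have h2 := ENNReal.toReal_mono (eLpNorm_exponent_top (f := f x - f d) (μ := ν) ▸
    ((hLp ∞ x).sub (hLp ∞ d)).2.ne) hy
  rw [toReal_enorm] at h2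
  exact h2.trans hxd.le

end AlmostEverywhere

end Separability

/-! ### Complex measures given by a density. -/

namespace SemigroupMeasure

section Density

variable {S : Type*} [TopologicalSpace S] [T2Space S] [MeasurableSpace S] [BorelSpace S]
  [Mul S] [ContinuousMul S]

/-- By absolute continuity of the integral, a compact set that nearly exhausts `E` for `m` also does
so for the measure with density `f`. -/
theorem regular_withDensity {m : Measure S} [IsFiniteMeasure m] [m.Regular] {f : S → ℝ≥0∞}
    (hf : ∫⁻ x, f x ∂m ≠ ∞) : (m.withDensity f).Regular := by
  have : IsFiniteMeasure (m.withDensity f) := isFiniteMeasure_withDensity hf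
  have key : (m.withDensity f).InnerRegularCompactLTTop := by
    refine ⟨fun E hE r hr => ?_⟩
    obtain ⟨δ, hδ, h⟩ := exists_pos_setLIntegral_lt_of_measure_lt hf (tsub_pos_of_lt hr).ne'
    obtain ⟨K, hKE, hK, hlt⟩ := hE.1.exists_isCompact_sdiff_lt (measure_ne_top m E) hδ.ne'
    refine ⟨K, hKE, hK, ?_⟩
    by_contra hcon
    have h1 : m.withDensity f E = m.withDensity f K + m.withDensity f (E \ K) := by
      rw [← measure_union disjoint_sdiff_self_right (hE.1.diff hK.measurableSet),
        Set.union_sdiff_cancel hKE]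
    have h2 : m.withDensity f (E \ K) < m.withDensity f E - r := by
      rw [withDensity_apply _ (hE.1.diff hK.measurableSet)]
      exact h _ hlt
    have h3 : m.withDensity f E < r + (m.withDensity f E - r) :=
      h1.trans_lt (ENNReal.add_lt_add_of_le_of_lt (measure_ne_top _ K) (not_lt.1 hcon) h2)
    rw [add_tsub_cancel_of_le hr.le] at h3
    exact lt_irrefl _ h3
  infer_instance

theorem tendsto_cintegral_of_dominated (v : ComplexMeasure S) {F : ℕ → S → ℂ} {f : S → ℂ}
    (bound : S → ℝ) (hF : ∀ n, Measurable (F n)) (hb : Integrable bound v.variation)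
    (hFb : ∀ n x, ‖F n x‖ ≤ bound x) (hlim : ∀ x, Tendsto (fun n => F n x) atTop (𝓝 (f x))) :
    Tendsto (fun n => cintegral v (F n)) atTop (𝓝 (cintegral v f)) :=
  VectorMeasure.tendsto_integral_of_dominated_convergence bound
    (fun n => (hF n).aestronglyMeasurable) hb (fun n => Eventually.of_forall (hFb n))
    (Eventually.of_forall hlim)

/-- The truncation of a function to the set where its norm is at most `n`. -/
noncomputable def truncate (f : S → ℂ) (n : ℕ) : S → ℂ := {x | ‖f x‖ ≤ n}.indicator f

theorem measurable_truncate {f : S → ℂ} (hf : Measurable f) (n : ℕ) : Measurable (truncate f n) :=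
  hf.indicator (measurableSet_le hf.norm measurable_const)

theorem norm_truncate_le (f : S → ℂ) (n : ℕ) (x : S) : ‖truncate f n x‖ ≤ n := by
  by_cases h : ‖f x‖ ≤ n
  · rwa [truncate, Set.indicator_of_mem (by exact h)]
  · rw [truncate, Set.indicator_of_notMem (by exact h), norm_zero]
    exact n.cast_nonneg

theorem norm_truncate_le_norm (f : S → ℂ) (n : ℕ) (x : S) : ‖truncate f n x‖ ≤ ‖f x‖ :=
  norm_indicator_le_norm_self f x

theorem tendsto_truncate (f : S → ℂ) (x : S) :
    Tendsto (fun n => truncate f n x) atTop (𝓝 (f x)) := by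
  refine tendsto_const_nhds.congr' ?_
  filter_upwards [eventually_ge_atTop ⌈‖f x‖⌉₊] with n hn
  exact (Set.indicator_of_mem (s := {x | ‖f x‖ ≤ n}) (Nat.ceil_le.1 hn) f).symm

/-- The weight may be unbounded, so the formulas for bounded functions are extended by truncation
and dominated convergence. -/
theorem cintegral_smul_measure_of_integrable (v : ComplexMeasure S) [IsFiniteMeasure v.variation]
    (c : ℂ) {f : S → ℂ} (hf : Measurable f) (hi : v.Integrable f) :
    cintegral (c • v) f = c * cintegral v f := by
  have h1 := tendsto_cintegral_of_dominated (c • v) (F := truncate f) (f := f) (fun x => ‖f x‖)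
    (measurable_truncate hf) (by
      rw [VectorMeasure.variation_smul]
      exact hi.norm.smul_measure_nnreal) (norm_truncate_le_norm f) (tendsto_truncate f)
  have h2 := tendsto_cintegral_of_dominated v (F := truncate f) (f := f) (fun x => ‖f x‖)
    (measurable_truncate hf) hi.norm (norm_truncate_le_norm f) (tendsto_truncate f)
  refine tendsto_nhds_unique h1 ((h2.const_mul c).congr fun n => ?_)
  exact (cintegral_smul_measure v c (measurable_truncate hf n) (norm_truncate_le f n)).symm

/-- The complex measure with density `g` with respect to `v`. -/
noncomputable def density (v : ComplexMeasure S) (g : S → ℂ) : ComplexMeasure S :=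
  v.withDensity g (ContinuousLinearMap.mul ℝ ℂ)

theorem density_apply {v : ComplexMeasure S} {g : S → ℂ} (hg : v.Integrable g) {E : Set S}
    (hE : MeasurableSet E) : density v g E = cintegral v (E.indicator g) := by
  rw [density, VectorMeasure.withDensity_apply hg, cintegral, VectorMeasure.integral_indicator hE]

theorem variation_density {v : ComplexMeasure S} {g : S → ℂ} (hg : v.Integrable g) :
    (density v g).variation = v.variation.withDensity fun x => ‖g x‖ₑ := by
  have h : ∀ x y : ℂ, ‖ContinuousLinearMap.mul ℝ ℂ x y‖₊ = ‖x‖₊ * ‖y‖₊ := fun x y => nnnorm_mul x y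
  rw [density, VectorMeasure.variation_withDensity hg h, VectorMeasure.variation_transpose_eq _ _ h]

theorem isFiniteMeasure_variation_density {v : ComplexMeasure S} {g : S → ℂ}
    (hg : v.Integrable g) : IsFiniteMeasure (density v g).variation := by
  rw [variation_density hg]
  exact isFiniteMeasure_withDensity hg.2.ne

theorem regular_variation_density {v : ComplexMeasure S} [IsFiniteMeasure v.variation]
    [v.variation.Regular] {g : S → ℂ} (hg : v.Integrable g) :
    (density v g).variation.Regular := by
  rw [variation_density hg]
  exact regular_withDensity hg.2.ne

theorem density_add {u v : ComplexMeasure S} {g : S → ℂ} (hu : u.Integrable g)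
    (hv : v.Integrable g) : density (u + v) g = density u g + density v g := by
  refine VectorMeasure.ext fun E hE => ?_
  rw [add_apply, density_apply (hu.add_vectorMeasure hv) hE, density_apply hu hE,
    density_apply hv hE]
  exact cintegral_add_measure u v (Integrable.indicator hu hE) (Integrable.indicator hv hE)

theorem density_smul {v : ComplexMeasure S} [IsFiniteMeasure v.variation] {g : S → ℂ}
    (hg : Measurable g) (hv : v.Integrable g) (c : ℂ) : density (c • v) g = c • density v g := by
  have h : (c • v).Integrable g := by
    rw [VectorMeasure.Integrable, VectorMeasure.variation_smul]
    exact Integrable.smul_measure_nnreal hv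
  refine VectorMeasure.ext fun E hE => ?_
  rw [smul_apply, density_apply h hE, density_apply hv hE, smul_eq_mul]
  exact cintegral_smul_measure_of_integrable v c (hg.indicator hE) (Integrable.indicator hv hE)

theorem cintegral_const_mul_of_integrable (v : ComplexMeasure S) [IsFiniteMeasure v.variation]
    (c : ℂ) {f : S → ℂ} (hf : Measurable f) (hi : v.Integrable f) :
    cintegral v (fun x => c * f x) = c * cintegral v f := by
  have h2 := tendsto_cintegral_of_dominated v (F := truncate f) (f := f) (fun x => ‖f x‖)
    (measurable_truncate hf) hi.norm (norm_truncate_le_norm f) (tendsto_truncate f)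
  have h1 := tendsto_cintegral_of_dominated v (F := fun n x => c * truncate f n x)
    (f := fun x => c * f x) (fun x => ‖c‖ * ‖f x‖) (fun n => (measurable_truncate hf n).const_mul c)
    (hi.norm.const_mul _) (fun n x => by
      rw [norm_mul]
      exact mul_le_mul_of_nonneg_left (norm_truncate_le_norm f n x) (norm_nonneg c))
    fun x => (tendsto_truncate f x).const_mul c
  refine tendsto_nhds_unique h1 ((h2.const_mul c).congr fun n => ?_)
  exact (cintegral_const_mul v c (measurable_truncate hf n) (norm_truncate_le f n)).symm

theorem integrable_mul_of_bdd {v : ComplexMeasure S} {g f : S → ℂ} (hv : v.Integrable g)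
    (hf : Measurable f) {C : ℝ} (hC : ∀ x, ‖f x‖ ≤ C) : v.Integrable fun x => g x * f x :=
  Integrable.mul_bdd hv hf.aestronglyMeasurable (Eventually.of_forall hC)

theorem cintegral_density {v : ComplexMeasure S} [IsFiniteMeasure v.variation] {g : S → ℂ}
    (hg : Measurable g) (hv : v.Integrable g) {f : S → ℂ} (hf : Measurable f) {C : ℝ}
    (hC : ∀ x, ‖f x‖ ≤ C) : cintegral (density v g) f = cintegral v fun x => g x * f x := by
  have := isFiniteMeasure_variation_density hv
  refine bdd_induction (P := fun f => cintegral (density v g) f = cintegral v fun x => g x * f x)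
    ?_ ?_ ?_ hf hC
  · intro c E hE
    rw [cintegral_indicator _ hE, density_apply hv hE, ← cintegral_const_mul_of_integrable v c
      (hg.indicator hE) (Integrable.indicator hv hE)]
    congr 1
    funext x
    by_cases hx : x ∈ E <;> simp [hx, mul_comm]
  · intro f₁ f₂ C₁ C₂ h₁ h₂ hC₁ hC₂ hP₁ hP₂
    rw [cintegral_add _ (integrable_of_bdd _ h₁ hC₁) (integrable_of_bdd _ h₂ hC₂), hP₁, hP₂,
      ← cintegral_add v (integrable_mul_of_bdd hv h₁ hC₁) (integrable_mul_of_bdd hv h₂ hC₂)]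
    simp only [mul_add]
  · intro F f C hF hC hlim hP
    refine tendsto_nhds_unique (tendsto_cintegral _ hF hC hlim) ?_
    simp only [hP]
    refine tendsto_cintegral_of_dominated v (fun x => ‖g x‖ * C) (fun n => hg.mul (hF n))
      (hv.norm.mul_const C) (fun n x => ?_) fun x => (hlim x).const_mul _
    rw [norm_mul]
    exact mul_le_mul_of_nonneg_left (hC n x) (norm_nonneg _)

end Density

end SemigroupMeasure

/-! ### The isometry M_b(S, ω) → M_b(S) and restriction to partitions. -/

namespace WeightedMeasureAlgebra

open WAP SemigroupMeasure

variable {S : Type*} [TopologicalSpace S] [T2Space S] [MeasurableSpace S] [BorelSpace S]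
  [LocallyCompactSpace S] [Semigroup S] [ContinuousMul S] {ω : Weight S}

theorem enorm_weight (ω : Weight S) (x : S) : ‖(ω x : ℂ)‖ₑ = ENNReal.ofReal (ω x) := by
  rw [← ofReal_norm, Complex.norm_of_nonneg (ω.pos x).le]

theorem integrable_weight (hω : Measurable fun x => ω x) (a : WeightedMeasureAlgebra ω) :
    a.toMeasure.Integrable fun x => (ω x : ℂ) := by
  refine ⟨(Complex.measurable_ofReal.comp hω).aestronglyMeasurable, ?_⟩
  rw [HasFiniteIntegral]
  simp only [enorm_weight]
  exact a.lintegral_lt_top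

theorem variation_density_weight (hω : Measurable fun x => ω x) (a : WeightedMeasureAlgebra ω) :
    (density a.toMeasure fun x => (ω x : ℂ)).variation =
      a.toMeasure.variation.withDensity fun x => ENNReal.ofReal (ω x) := by
  simp only [variation_density (integrable_weight hω a), enorm_weight]

theorem norm_eq_variation_univ (u : MeasureAlgebra S) :
    ‖u‖ = (u.toMeasure.variation Set.univ).toReal := by
  rw [norm_def]
  congr 1
  rw [← lintegral_one]
  exact lintegral_congr fun x => ENNReal.ofReal_one

/-- Multiplication by the weight, as an isometry from `M_b(S, ω)` to `M_b(S)`. -/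
noncomputable def mulWeight (hω : Measurable fun x => ω x) :
    WeightedMeasureAlgebra ω →ₗᵢ[ℂ] MeasureAlgebra S where
  toFun a := ⟨density a.toMeasure fun x => (ω x : ℂ),
    regular_variation_density (integrable_weight hω a), by
      have := isFiniteMeasure_variation_density (integrable_weight hω a)
      refine (lintegral_congr fun x => ENNReal.ofReal_one).trans_lt ?_
      rw [lintegral_one]
      exact measure_lt_top _ _⟩
  map_add' a b := ext (density_add (integrable_weight hω a) (integrable_weight hω b))
  map_smul' c a := ext (density_smul (Complex.measurable_ofReal.comp hω) (integrable_weight hω a) c)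
  norm_map' a := by
    rw [norm_eq_variation_univ, norm_def]
    congr 1
    change (density a.toMeasure fun x => (ω x : ℂ)).variation Set.univ = _
    rw [variation_density_weight hω, withDensity_apply _ MeasurableSet.univ, Measure.restrict_univ]

theorem toMeasure_mulWeight (hω : Measurable fun x => ω x) (a : WeightedMeasureAlgebra ω) :
    (mulWeight hω a).toMeasure = density a.toMeasure fun x => (ω x : ℂ) := rfl

section Restrict

/-- The restriction of a measure to a set. -/
noncomputable def restrict (a : WeightedMeasureAlgebra ω) (E : Set S) : WeightedMeasureAlgebra ω :=
  have hle : (a.toMeasure.restrict E).variation ≤ a.toMeasure.variation :=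
    VectorMeasure.variation_restrict_le.trans Measure.restrict_le_self
  ⟨a.toMeasure.restrict E, regular_of_le hle,
    (lintegral_mono' hle le_rfl).trans_lt a.lintegral_lt_top⟩

theorem toMeasure_restrict (a : WeightedMeasureAlgebra ω) (E : Set S) :
    (a.restrict E).toMeasure = a.toMeasure.restrict E := rfl

theorem variation_toMeasure_restrict (a : WeightedMeasureAlgebra ω) {E : Set S}
    (hE : MeasurableSet E) :
    (a.restrict E).toMeasure.variation = a.toMeasure.variation.restrict E :=
  VectorMeasure.variation_restrict hE

theorem norm_restrict (a : WeightedMeasureAlgebra ω) {E : Set S} (hE : MeasurableSet E) :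
    ‖a.restrict E‖ = (∫⁻ x in E, ENNReal.ofReal (ω x) ∂a.toMeasure.variation).toReal := by
  rw [norm_def, variation_toMeasure_restrict a hE]

theorem lintegral_restrict_ne_top (a : WeightedMeasureAlgebra ω) (E : Set S) :
    ∫⁻ x in E, ENNReal.ofReal (ω x) ∂a.toMeasure.variation ≠ ∞ :=
  ((setLIntegral_le_lintegral _ _).trans_lt a.lintegral_lt_top).ne

/-- The norm is an integral against |a|, hence countably additive. The norms of the pieces later
serve as averaging weights. -/
theorem hasSum_norm_restrict (a : WeightedMeasureAlgebra ω) {E : ℕ → Set S}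
    (hE : ∀ i, MeasurableSet (E i)) (hd : Pairwise (Function.onFun Disjoint E))
    (hU : ⋃ i, E i = Set.univ) : HasSum (fun i => ‖a.restrict (E i)‖) ‖a‖ := by
  have h1 : ∑' i, ∫⁻ x in E i, ENNReal.ofReal (ω x) ∂a.toMeasure.variation =
      ∫⁻ x, ENNReal.ofReal (ω x) ∂a.toMeasure.variation := by
    rw [← lintegral_iUnion hE hd, hU, Measure.restrict_univ]
  have h2 := ENNReal.hasSum_toReal (h1.trans_ne a.lintegral_lt_top.ne)
  rw [← ENNReal.tsum_toReal_eq fun i => a.lintegral_restrict_ne_top (E i), h1] at h2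
  simpa only [norm_restrict a (hE _), norm_def] using h2

theorem sub_sum_restrict (a : WeightedMeasureAlgebra ω) {E : ℕ → Set S}
    (hE : ∀ i, MeasurableSet (E i)) (hd : Pairwise (Function.onFun Disjoint E)) (s : Finset ℕ) :
    a - ∑ i ∈ s, a.restrict (E i) = a.restrict (⋃ i ∈ s, E i)ᶜ := by
  have hs : MeasurableSet (⋃ i ∈ s, E i) := s.measurableSet_biUnion fun i _ => hE i
  have h1 : a.restrict (⋃ i ∈ s, E i) = ∑ i ∈ s, a.restrict (E i) := by
    induction s using Finset.induction_on with
    | empty => exact ext (by simp only [toMeasure_restrict, Finset.notMem_empty, Set.iUnion_false,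
        Set.iUnion_empty, VectorMeasure.restrict_empty]; rfl)
    | insert i s hi ih =>
      have hs' : MeasurableSet (⋃ i ∈ s, E i) := s.measurableSet_biUnion fun i _ => hE i
      rw [Finset.sum_insert hi, ← ih hs', Finset.set_biUnion_insert]
      refine ext (VectorMeasure.restrict_union ?_ (hE i) hs')
      exact Set.disjoint_iUnion₂_right.2 fun j hj => hd fun h => hi (h ▸ hj)
  have h2 : a = a.restrict (⋃ i ∈ s, E i) + a.restrict (⋃ i ∈ s, E i)ᶜ :=
    ext (VectorMeasure.restrict_add_restrict_compl hs).symm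
  rw [← h1, sub_eq_iff_eq_add']
  exact h2

/-- A measure is the norm convergent sum of its restrictions to a countable partition. -/
theorem hasSum_restrict (a : WeightedMeasureAlgebra ω) {E : ℕ → Set S}
    (hE : ∀ i, MeasurableSet (E i)) (hd : Pairwise (Function.onFun Disjoint E))
    (hU : ⋃ i, E i = Set.univ) : HasSum (fun i => a.restrict (E i)) a := by
  -- The error is the restriction to the uncovered part, whose norm is exactly the missing mass.
  have h1 : ∀ s : Finset ℕ, ‖∑ i ∈ s, a.restrict (E i) - a‖ =
      ‖a‖ - ∑ i ∈ s, ‖a.restrict (E i)‖ := by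
    intro s
    have hs : MeasurableSet (⋃ i ∈ s, E i) := s.measurableSet_biUnion fun i _ => hE i
    have h2 := lintegral_add_compl (μ := a.toMeasure.variation)
      (fun x => ENNReal.ofReal (ω x)) hs
    rw [lintegral_biUnion_finset (fun i _ j _ hij => hd hij) fun i _ => hE i] at h2
    rw [norm_sub_rev, sub_sum_restrict a hE hd, norm_restrict a hs.compl, norm_def, ← h2,
      ENNReal.toReal_add (ENNReal.sum_ne_top.2 fun i _ => a.lintegral_restrict_ne_top _)
        (a.lintegral_restrict_ne_top _),
      ENNReal.toReal_sum fun i _ => a.lintegral_restrict_ne_top _]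
    simp only [norm_restrict a (hE _), add_sub_cancel_left]
  rw [HasSum, tendsto_iff_norm_sub_tendsto_zero]
  simp only [h1]
  have h3 := (tendsto_const_nhds (x := ‖a‖)).sub (hasSum_norm_restrict a hE hd hU)
  rwa [sub_self] at h3

end Restrict

end WeightedMeasureAlgebra

/-! ### Comparison of Φ(a * b) with c Φ(a) * Φ(b). -/

namespace WeightedMeasureAlgebra

open WAP SemigroupMeasure

variable {S : Type*} [TopologicalSpace S] [T2Space S] [MeasurableSpace S] [BorelSpace S]
  [LocallyCompactSpace S] [Semigroup S] [ContinuousMul S] {ω : Weight S}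

theorem integrable_of_norm_le_weight (hω : Measurable fun x => ω x) (a : WeightedMeasureAlgebra ω)
    {f : S → ℂ} (hf : Measurable f) {C : ℝ} (hC : ∀ x, ‖f x‖ ≤ C * ω x) :
    a.toMeasure.Integrable f := by
  refine Integrable.mono' ((integrable_weight hω a).norm.const_mul C) hf.aestronglyMeasurable
    (Eventually.of_forall fun x => ?_)
  rw [Complex.norm_of_nonneg (ω.pos x).le]
  exact hC x

theorem norm_cintegral_le_weight (a : WeightedMeasureAlgebra ω) {f : S → ℂ} {C : ℝ} (hC0 : 0 ≤ C)
    (hC : ∀ x, ‖f x‖ ≤ C * ω x) : ‖cintegral a.toMeasure f‖ ≤ C * ‖a‖ := by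
  have h1 : ‖cintegral a.toMeasure f‖ₑ ≤
      ENNReal.ofReal C * ∫⁻ x, ENNReal.ofReal (ω x) ∂a.toMeasure.variation := by
    refine (enorm_cintegral_le _ _).trans ?_
    rw [← lintegral_const_mul' _ _ ENNReal.ofReal_ne_top]
    refine lintegral_mono fun x => ?_
    rw [← ENNReal.ofReal_mul hC0, ← ofReal_norm]
    exact ENNReal.ofReal_le_ofReal (hC x)
  have h2 := ENNReal.toReal_mono
    (ENNReal.mul_lt_top ENNReal.ofReal_lt_top a.lintegral_lt_top).ne h1
  rwa [toReal_enorm, ENNReal.toReal_mul, ENNReal.toReal_ofReal hC0] at h2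

/-- Integration of functions dominated by the weight against a convolution. -/
theorem cintegral_mul_of_norm_le_weight (hω : Measurable fun x => ω x)
    (a b : WeightedMeasureAlgebra ω) {f : S → ℂ} (hf : Measurable f) (hC : ∀ x, ‖f x‖ ≤ ω x) :
    Measurable (fun x => cintegral b.toMeasure fun y => f (x * y)) ∧
      cintegral (a * b).toMeasure f =
        cintegral a.toMeasure fun x => cintegral b.toMeasure fun y => f (x * y) := by
  have hF : ∀ n x, ‖truncate f n x‖ ≤ ω x := fun n x => (norm_truncate_le_norm f n x).trans (hC x)
  have hF' : ∀ n x y, ‖truncate f n (x * y)‖ ≤ ω x * ω y := fun n x y =>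
    (hF n _).trans (ω.mul_le x y)
  have hlim : ∀ x, Tendsto (fun n => cintegral b.toMeasure fun y => truncate f n (x * y)) atTop
      (𝓝 (cintegral b.toMeasure fun y => f (x * y))) := fun x =>
    tendsto_cintegral_of_dominated _ (fun y => ω x * ‖(ω y : ℂ)‖)
      (fun n => (measurable_truncate hf n).comp (measurable_translate x))
      ((integrable_weight hω b).norm.const_mul _) (fun n y => by
        rw [Complex.norm_of_nonneg (ω.pos y).le]
        exact hF' n x y) fun y => tendsto_truncate f _
  have hm : ∀ n, Measurable fun x => cintegral b.toMeasure fun y => truncate f n (x * y) := fun n =>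
    (cintegral_conv a.toMeasure b.toMeasure (measurable_truncate hf n) (norm_truncate_le f n)).1
  refine ⟨measurable_of_tendsto_metrizable hm (tendsto_pi_nhds.2 hlim), ?_⟩
  have h1 := tendsto_cintegral_of_dominated (a * b).toMeasure (F := truncate f) (f := f)
    (fun x => ‖(ω x : ℂ)‖) (measurable_truncate hf) (integrable_weight hω (a * b)).norm
    (fun n x => by
      rw [Complex.norm_of_nonneg (ω.pos x).le]
      exact hF n x) (tendsto_truncate f)
  have h2 := tendsto_cintegral_of_dominated a.toMeasure _
    hm ((integrable_weight hω a).norm.mul_const ‖b‖) (fun n x => by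
      rw [Complex.norm_of_nonneg (ω.pos x).le]
      exact norm_cintegral_le_weight b (ω.pos x).le (hF' n x)) hlim
  refine tendsto_nhds_unique h1 (h2.congr fun n => ?_)
  exact (cintegral_mul a b (measurable_truncate hf n) (norm_truncate_le f n)).symm

theorem cintegral_sub_const_mul (hω : Measurable fun x => ω x) (a : WeightedMeasureAlgebra ω)
    {f g : S → ℂ} (hf : Measurable f) (hg : Measurable g) {C D : ℝ}
    (hC : ∀ x, ‖f x‖ ≤ C * ω x) (hD : ∀ x, ‖g x‖ ≤ D * ω x) (c : ℂ) :
    cintegral a.toMeasure f - c * cintegral a.toMeasure g =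
      cintegral a.toMeasure fun x => f x - c * g x := by
  have h1 := integrable_of_norm_le_weight hω a hf hC
  have h2 := integrable_of_norm_le_weight hω a hg hD
  rw [← cintegral_const_mul_of_integrable _ c hg h2]
  exact (VectorMeasure.integral_sub h1 (Integrable.const_mul h2 c)).symm

/-- Both convolutions become iterated integrals against `a` and `b`: the first puts ω(xy) in the
integrand, the second ω(x)ω(y). -/
theorem mulWeight_mul_sub_apply (hω : Measurable fun x => ω x) (a b : WeightedMeasureAlgebra ω)
    (c : ℂ) {E : Set S} (hE : MeasurableSet E) :
    (mulWeight hω (a * b) - c • (mulWeight hω a * mulWeight hω b)).toMeasure E =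
      cintegral a.toMeasure fun x => cintegral b.toMeasure fun y =>
        ((fun y => x * y) ⁻¹' E).indicator (fun y => (ω (x * y) - c * (ω x * ω y) : ℂ)) y := by
  have hωc : Measurable fun x => (ω x : ℂ) := Complex.measurable_ofReal.comp hω
  have hn : ∀ x, ‖(ω x : ℂ)‖ = ω x := fun x => Complex.norm_of_nonneg (ω.pos x).le
  have hi : ∀ (E : Set S) x, ‖E.indicator (fun x => (ω x : ℂ)) x‖ ≤ ω x := fun E x =>
    (norm_indicator_le_norm_self _ x).trans (hn x).le
  have hb : ∀ x : S, MeasurableSet ((fun y => x * y) ⁻¹' E) := fun x => measurable_translate x hE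
  obtain ⟨hm1, h1⟩ := cintegral_mul_of_norm_le_weight hω a b (hωc.indicator hE) (hi E)
  have hm2 := measurable_complexMeasure_translate (mulWeight hω b).toMeasure hE
  have h2 : (mulWeight hω a * mulWeight hω b).toMeasure E = cintegral a.toMeasure fun x =>
      (ω x : ℂ) * cintegral b.toMeasure
        (((fun y => x * y) ⁻¹' E).indicator fun y => (ω y : ℂ)) := by
    rw [mul_apply _ _ hE, toMeasure_mulWeight,
      cintegral_density hωc (integrable_weight hω a) hm2 fun x => norm_complexMeasure_le _ _]
    congr 1
    funext x
    rw [toMeasure_mulWeight, density_apply (integrable_weight hω b) (hb x)]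
  have h3 : (fun x => cintegral b.toMeasure
      (((fun y => x * y) ⁻¹' E).indicator fun y => (ω y : ℂ))) =
        fun x => (mulWeight hω b).toMeasure ((fun y => x * y) ⁻¹' E) := by
    funext x
    rw [toMeasure_mulWeight, density_apply (integrable_weight hω b) (hb x)]
  have h4 : (mulWeight hω (a * b) - c • (mulWeight hω a * mulWeight hω b)).toMeasure E =
      (mulWeight hω (a * b)).toMeasure E - c * (mulWeight hω a * mulWeight hω b).toMeasure E := rfl
  rw [h4, h2, toMeasure_mulWeight, density_apply (integrable_weight hω (a * b)) hE, h1,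
    cintegral_sub_const_mul hω a (C := ‖b‖) (D := ‖b‖) hm1]
  · congr 1
    funext x
    rw [← cintegral_const_mul_of_integrable _ _ (hωc.indicator (hb x))
      (Integrable.indicator (integrable_weight hω b) (hb x)),
      cintegral_sub_const_mul hω b (f := fun y => E.indicator (fun z => (ω z : ℂ)) (x * y))
        (C := ω x) (D := ω x) ((hωc.indicator hE).comp (measurable_translate x))
        ((hωc.indicator (hb x)).const_mul _)]
    · congr 1
      funext y
      by_cases hy : x * y ∈ E <;> simp [hy]
    · exact fun y => (hi E _).trans (ω.mul_le x y)
    · intro y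
      rw [norm_mul, hn]
      exact mul_le_mul_of_nonneg_left (hi _ y) (ω.pos x).le
  · exact hωc.mul (h3 ▸ hm2)
  · intro x
    rw [mul_comm]
    exact norm_cintegral_le_weight b (ω.pos x).le fun y => (hi E _).trans (ω.mul_le x y)
  · intro x
    rw [norm_mul, hn, mul_comm]
    refine mul_le_mul_of_nonneg_right ?_ (ω.pos x).le
    rw [← one_mul ‖b‖]
    exact norm_cintegral_le_weight b zero_le_one fun y => (hi _ y).trans (one_mul _).ge

/-- Since ω(xy) − c ω(x)ω(y) = (Ω(x, y) − c) ω(x)ω(y), the variation of the difference is at most ε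
times the convolution of |Φ(a)| and |Φ(b)|, whose total mass is ‖a‖ ‖b‖. -/
theorem norm_mulWeight_mul_sub_le (hω : Measurable fun x => ω x) (a b : WeightedMeasureAlgebra ω)
    {c : ℂ} {ε : ℝ} (hε : 0 ≤ ε) (h : ∀ᵐ x ∂a.toMeasure.variation, ∀ᵐ y ∂b.toMeasure.variation,
      ‖(ω.Omega (x, y) : ℂ) - c‖ ≤ ε) :
    ‖mulWeight hω (a * b) - c • (mulWeight hω a * mulWeight hω b)‖ ≤ ε * (‖a‖ * ‖b‖) := by
  have hωe : Measurable fun x => ENNReal.ofReal (ω x) := ENNReal.measurable_ofReal.comp hω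
  have hle : (mulWeight hω (a * b) - c • (mulWeight hω a * mulWeight hω b)).toMeasure.variation ≤
      ENNReal.ofReal ε • posConv (mulWeight hω a).toMeasure.variation
        (mulWeight hω b).toMeasure.variation := by
    refine VectorMeasure.variation_le_of_forall_enorm_le fun E hE => ?_
    have hb : ∀ x : S, MeasurableSet ((fun y => x * y) ⁻¹' E) := fun x => measurable_translate x hE
    have hm := measurable_measure_translate (mulWeight hω b).toMeasure.variation hE
    rw [mulWeight_mul_sub_apply hω a b c hE, Measure.smul_apply, posConv_apply _ _ hE]
    refine (enorm_cintegral_le _ _).trans ?_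
    have h1 : ∫⁻ x, (mulWeight hω b).toMeasure.variation ((fun y => x * y) ⁻¹' E)
        ∂(mulWeight hω a).toMeasure.variation = ∫⁻ x, ENNReal.ofReal (ω x) *
          ∫⁻ y in (fun y => x * y) ⁻¹' E, ENNReal.ofReal (ω y) ∂b.toMeasure.variation
            ∂a.toMeasure.variation := by
      rw [toMeasure_mulWeight, variation_density_weight hω] at hm ⊢
      rw [toMeasure_mulWeight, variation_density_weight hω]
      rw [lintegral_withDensity_eq_lintegral_mul _ hωe hm]
      refine lintegral_congr fun x => ?_
      rw [Pi.mul_apply, withDensity_apply _ (hb x)]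
    rw [h1, smul_eq_mul, ← lintegral_const_mul' _ _ ENNReal.ofReal_ne_top]
    refine lintegral_mono_ae ?_
    filter_upwards [h] with x hx
    refine (enorm_cintegral_le _ _).trans ?_
    rw [← lintegral_const_mul' _ _ ENNReal.ofReal_ne_top,
      ← lintegral_const_mul' _ _ ENNReal.ofReal_ne_top, ← lintegral_indicator (hb x)]
    refine lintegral_mono_ae ?_
    filter_upwards [hx] with y hy
    by_cases hyE : y ∈ (fun y => x * y) ⁻¹' E
    · rw [Set.indicator_of_mem hyE, Set.indicator_of_mem hyE,
        ← ENNReal.ofReal_mul (ω.pos x).le, ← ENNReal.ofReal_mul hε, ← ofReal_norm]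
      refine ENNReal.ofReal_le_ofReal ?_
      have h2 : (ω (x * y) - c * (ω x * ω y) : ℂ) =
          ((ω.Omega (x, y) : ℂ) - c) * ((ω x * ω y : ℝ) : ℂ) := by
        rw [← Weight.mul_Omega]
        push_cast
        ring
      rw [h2, norm_mul, Complex.norm_of_nonneg (mul_pos (ω.pos x) (ω.pos y)).le]
      exact mul_le_mul_of_nonneg_right hy (mul_pos (ω.pos x) (ω.pos y)).le
    · rw [Set.indicator_of_notMem hyE, enorm_zero]
      exact zero_le
  have h1 := ENNReal.toReal_mono (by
    rw [Measure.smul_apply, smul_eq_mul]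
    exact ENNReal.mul_ne_top ENNReal.ofReal_ne_top (measure_ne_top _ _)) (hle Set.univ)
  rw [Measure.smul_apply, posConv_apply _ _ MeasurableSet.univ] at h1
  simp only [Set.preimage_univ, lintegral_const, smul_eq_mul, ENNReal.toReal_mul,
    ENNReal.toReal_ofReal hε, ← norm_eq_variation_univ, LinearIsometry.norm_map] at h1
  rwa [mul_comm ‖a‖]

end WeightedMeasureAlgebra

/-! ### Measurable partitions on which Ω is nearly constant. -/

theorem exists_measurable_partition {S X : Type*} [MeasurableSpace S] [Nonempty S] {D : Set X}
    (hD : D.Countable) {W : X → Set S} (hW : ∀ d, MeasurableSet (W d)) (h : ∀ s, ∃ d ∈ D, s ∈ W d) :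
    ∃ (d : ℕ → X) (E : ℕ → Set S), (∀ i, MeasurableSet (E i)) ∧
      Pairwise (Function.onFun Disjoint E) ∧ ⋃ i, E i = Set.univ ∧ ∀ i, E i ⊆ W (d i) := by
  obtain ⟨d₀, hd₀, -⟩ := h (Classical.arbitrary S)
  obtain ⟨d, rfl⟩ := hD.exists_eq_range ⟨d₀, hd₀⟩
  refine ⟨d, disjointed fun i => W (d i), fun i => MeasurableSet.disjointed (fun j => hW (d j)) i,
    disjoint_disjointed _, ?_, fun i => disjointed_subset _ i⟩
  rw [iUnion_disjointed]
  refine Set.eq_univ_of_forall fun s => ?_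
  obtain ⟨_, ⟨i, rfl⟩, hi⟩ := h s
  exact Set.mem_iUnion.2 ⟨i, hi⟩

namespace SemigroupMeasure

variable {S : Type*} [TopologicalSpace S] [T2Space S] [MeasurableSpace S] [BorelSpace S]
  [Mul S] [ContinuousMul S]

theorem measurable_prodMk_translate (x : S) : Measurable fun y : S => (y, x * y) :=
  measurable_id.prodMk (measurable_translate x)

/-- The kernel sending `x` to the law of `(y, x y)`. -/
noncomputable def translateKernel (n : Measure S) [IsFiniteMeasure n] [n.Regular] :
    ProbabilityTheory.Kernel S (S × S) where
  toFun x := n.map fun y => (y, x * y)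
  measurable' := by
    -- On a rectangle P × Q the mass is that of x⁻¹Q for `n` restricted to `P`, which is again
    -- regular, so `measurable_measure_translate` applies.
    refine Measurable.measure_of_isPiSystem generateFrom_prod.symm isPiSystem_prod ?_ ?_
    · rintro _ ⟨P, hP, Q, hQ, rfl⟩
      have : (n.restrict P).Regular := regular_of_le (n := n) Measure.restrict_le_self
      refine (congrArg Measurable (funext fun x => ?_)).mp
        (measurable_measure_translate (n.restrict P) hQ)
      rw [Measure.map_apply (measurable_prodMk_translate x) (hP.prod hQ),
        Measure.restrict_apply (measurable_translate x hQ), Set.inter_comm]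
      rfl
    · simp_rw [Measure.map_apply (measurable_prodMk_translate _) MeasurableSet.univ,
        Set.preimage_univ]
      exact measurable_const

instance (n : Measure S) [IsFiniteMeasure n] [n.Regular] :
    ProbabilityTheory.IsFiniteKernel (translateKernel n) :=
  ⟨n Set.univ, measure_lt_top _ _, fun x => by
    change n.map (fun y => (y, x * y)) Set.univ ≤ _
    rw [Measure.map_apply (measurable_prodMk_translate x) MeasurableSet.univ, Set.preimage_univ]⟩

/-- Without second countability, multiplication need not be measurable for the product σ-algebra.
The product xy is therefore carried as a separate coordinate, and `translateKernel` supplies the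
measurability. -/
theorem measurableSet_ae_translate (n : Measure S) [IsFiniteMeasure n] [n.Regular]
    {t : Set (S × S × S)} (ht : MeasurableSet t) :
    MeasurableSet {x : S | ∀ᵐ y ∂n, (x, y, x * y) ∈ t} := by
  have h := ProbabilityTheory.Kernel.measurable_kernel_prodMk_left (κ := translateKernel n)
    ht.compl (measurableSet_singleton 0)
  refine (congrArg MeasurableSet ?_).mp h
  ext x
  change n.map (fun y => (y, x * y)) (Prod.mk x ⁻¹' tᶜ) = 0 ↔ ∀ᵐ y ∂n, (x, y, x * y) ∈ t
  rw [Measure.map_apply (measurable_prodMk_translate x)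
    (measurable_prodMk_left ht.compl), ae_iff]
  rfl

end SemigroupMeasure

namespace WAP.Weight

variable {S : Type*} [TopologicalSpace S] [T2Space S] [MeasurableSpace S] [BorelSpace S]
  [Mul S] [ContinuousMul S] {ω : Weight S}

theorem measurable_Omega (hω : Measurable fun x => ω x) (x : S) :
    Measurable fun y => (ω.Omega (x, y) : ℂ) :=
  Complex.measurable_ofReal.comp
    ((hω.comp (SemigroupMeasure.measurable_translate x)).div (hω.const_mul (ω x)))

/-- One finite measure dominating all `n m` makes a single countable family of rows sufficient. Here
y ranges over all of `S`, so the approximation holds only almost everywhere. -/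
theorem exists_partition_left [Nonempty S] (hω : Measurable fun x => ω x)
    (hΩ : Interchangeable fun x y => (ω.Omega (x, y) : ℂ)) (n : ℕ → Measure S)
    [∀ m, IsFiniteMeasure (n m)] [∀ m, (n m).Regular] {ε : ℝ} (hε : 0 < ε) :
    ∃ (d : ℕ → S) (E : ℕ → Set S), (∀ i, MeasurableSet (E i)) ∧
      Pairwise (Function.onFun Disjoint E) ∧ ⋃ i, E i = Set.univ ∧
      ∀ i, ∀ x ∈ E i, ∀ m, ∀ᵐ y ∂n m, ‖(ω.Omega (x, y) : ℂ) - ω.Omega (d i, y)‖ ≤ ε := by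
  obtain ⟨D, hD, h⟩ := hΩ.exists_countable_ae (Measure.sum n).toFinite (measurable_Omega hω)
  refine exists_measurable_partition (W := fun d => {x | ∀ m, ∀ᵐ y ∂n m,
    ‖(ω.Omega (x, y) : ℂ) - ω.Omega (d, y)‖ ≤ ε}) hD (fun d => ?_) fun x => ?_
  · rw [Set.ofPred_forall]
    refine MeasurableSet.iInter fun m => ?_
    have ht : MeasurableSet {p : S × S × S |
        ‖((ω p.2.2 / (ω p.1 * ω p.2.1) : ℝ) : ℂ) - ω.Omega (d, p.2.1)‖ ≤ ε} :=
      measurableSet_le ((Complex.measurable_ofReal.comp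
        ((hω.comp (measurable_snd.comp measurable_snd)).div ((hω.comp measurable_fst).mul
          (hω.comp (measurable_fst.comp measurable_snd))))).sub
        ((measurable_Omega hω d).comp (measurable_fst.comp measurable_snd))).norm measurable_const
    exact SemigroupMeasure.measurableSet_ae_translate (n m) ht
  · obtain ⟨d, hd, hxd⟩ := h x ε hε
    exact ⟨d, hd, fun m => ((Measure.absolutelyContinuous_of_le (Measure.le_sum n m)).trans
      (absolutelyContinuous_toFinite _)).ae_le hxd⟩

/-- Only the countably many points `d i` remain in the first variable, so uniform separability
applies and no null sets appear. -/
theorem exists_partition_right [Nonempty S] (hω : Measurable fun x => ω x)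
    (hΩ : Interchangeable fun x y => (ω.Omega (x, y) : ℂ)) (d : ℕ → S) {ε : ℝ} (hε : 0 < ε) :
    ∃ (e : ℕ → S) (G : ℕ → Set S), (∀ j, MeasurableSet (G j)) ∧
      Pairwise (Function.onFun Disjoint G) ∧ ⋃ j, G j = Set.univ ∧
      ∀ j, ∀ y ∈ G j, ∀ i, ‖(ω.Omega (d i, y) : ℂ) - ω.Omega (d i, e j)‖ ≤ ε := by
  obtain ⟨D, hD, h⟩ := (hΩ.comp d id).swap.exists_countable_uniform
  refine exists_measurable_partition (W := fun e => {y | ∀ i,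
    ‖(ω.Omega (d i, y) : ℂ) - ω.Omega (d i, e)‖ ≤ ε}) hD (fun e => ?_) fun y => h y ε hε
  rw [Set.ofPred_forall]
  exact MeasurableSet.iInter fun i =>
    measurableSet_le ((measurable_Omega hω (d i)).sub measurable_const).norm measurable_const

end WAP.Weight

theorem dist_ulim_le {X E : Type*} [NormedAddCommGroup E] [ProperSpace E] (U : Ultrafilter X)
    {f g : X → E} {C D ε : ℝ} (hf : ∀ x, ‖f x‖ ≤ C) (hg : ∀ x, ‖g x‖ ≤ D)
    (h : ∀ x, dist (f x) (g x) ≤ ε) : dist (ulim U f) (ulim U g) ≤ ε :=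
  le_of_tendsto ((tendsto_ulim U hf).dist (tendsto_ulim U hg)) (Eventually.of_forall h)

/-- Uniform limits of interchangeable kernels are interchangeable. -/
theorem Interchangeable.of_approx {X Y E : Type*} [NormedAddCommGroup E] [ProperSpace E]
    {f : X → Y → E} {C : ℝ} (hC : ∀ x y, ‖f x y‖ ≤ C)
    (h : ∀ ε > 0, ∃ g : X → Y → E, Interchangeable g ∧ ∀ x y, ‖f x y - g x y‖ ≤ ε) :
    Interchangeable f := by
  refine ⟨⟨C, hC⟩, fun U V => ?_⟩
  refine eq_of_forall_dist_le fun ε hε => ?_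
  obtain ⟨g, hg, hfg⟩ := h (ε / 2) (half_pos hε)
  obtain ⟨D, hD⟩ := hg.bounded
  have hd : ∀ x y, dist (f x y) (g x y) ≤ ε / 2 := fun x y => by
    rw [dist_eq_norm]
    exact hfg x y
  have h1 := dist_ulim_le U (fun x => norm_ulim_le V (hC x)) (fun x => norm_ulim_le V (hD x))
    fun x => dist_ulim_le V (hC x) (hD x) (hd x)
  have h2 := dist_ulim_le V (fun y => norm_ulim_le U fun x => hC x y)
    (fun y => norm_ulim_le U fun x => hD x y)
    fun y => dist_ulim_le U (fun x => hC x y) (fun x => hD x y) fun x => hd x y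
  rw [hg.ulim_comm U V] at h1
  rw [dist_comm] at h2
  linarith [dist_triangle (ulim U fun x => ulim V fun y => f x y)
    (ulim V fun y => ulim U fun x => g x y) (ulim V fun y => ulim U fun x => f x y)]

theorem norm_sub_tsum_le {I E : Type*} [NormedAddCommGroup E] [CompleteSpace E] {u v : I → E}
    {q : I → ℝ} {s : E} {t : ℝ} (hu : HasSum u s) (hq : HasSum q t)
    (h : ∀ i, ‖u i - v i‖ ≤ q i) : ‖s - ∑' i, v i‖ ≤ t := by
  have h1 : Summable fun i => u i - v i := Summable.of_norm_bounded hq.summable h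
  have h2 : Summable v := (hu.summable.sub h1).congr fun i => sub_sub_cancel _ _
  rw [← hu.tsum_eq, ← hu.summable.tsum_sub h2]
  exact tsum_of_norm_bounded hq h

/-- `T v w` is expanded in one variable at a time. Since the norms of the pieces sum to the norm of
the whole, the termwise errors add up without loss. -/
theorem norm_bilin_sub_tsum_le {I J V W : Type*} [NormedAddCommGroup V] [NormedSpace ℂ V]
    [NormedAddCommGroup W] [NormedSpace ℂ W] (T : V →L[ℂ] W →L[ℂ] ℂ) {a : I → V} {b : J → W}
    {v : V} {w : W} (ha : HasSum a v) (hb : HasSum b w) (ha' : HasSum (fun i => ‖a i‖) ‖v‖)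
    (hb' : HasSum (fun j => ‖b j‖) ‖w‖) {p : I → ℂ} {k : I → J → ℂ} {C : ℝ}
    (h : ∀ i j, ‖T (a i) (b j) - p i * k i j‖ ≤ C * (‖a i‖ * ‖b j‖)) :
    ‖T v w - ∑' i, p i * ∑' j, k i j‖ ≤ C * (‖v‖ * ‖w‖) := by
  refine norm_sub_tsum_le ((T.flip w).hasSum ha) ((ha'.mul_right ‖w‖).mul_left C) fun i => ?_
  rw [← tsum_mul_left]
  exact norm_sub_tsum_le ((T (a i)).hasSum hb) ((hb'.mul_left _).mul_left C) (h i)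

/-! ### The case of M_b(S, ω). -/

namespace WeightedMeasureAlgebra

open WAP SemigroupMeasure

variable {S : Type*} [TopologicalSpace S] [T2Space S] [MeasurableSpace S] [BorelSpace S]
  [LocallyCompactSpace S] [Semigroup S] [ContinuousMul S] {ω : Weight S}

/-- The normalisation of the image of a weighted measure. -/
noncomputable def normalize (hω : Measurable fun x => ω x) (a : WeightedMeasureAlgebra ω) :
    Metric.closedBall (0 : MeasureAlgebra S) 1 :=
  ⟨(‖a‖ : ℂ)⁻¹ • mulWeight hω a, by
    rw [mem_closedBall_zero_iff, norm_smul, norm_inv, Complex.norm_real, norm_norm,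
      LinearIsometry.norm_map]
    exact inv_mul_le_one⟩

theorem norm_smul_normalize (hω : Measurable fun x => ω x) (a : WeightedMeasureAlgebra ω) :
    (‖a‖ : ℂ) • (normalize hω a : MeasureAlgebra S) = mulWeight hω a := by
  rcases eq_or_ne a 0 with rfl | ha
  · rw [norm_zero, Complex.ofReal_zero, zero_smul, map_zero]
  · exact smul_inv_smul₀ (by exact_mod_cast norm_ne_zero_iff.2 ha) _

theorem apply_mulWeight_mul (hω : Measurable fun x => ω x) (F : StrongDual ℂ (MeasureAlgebra S))
    (a b : WeightedMeasureAlgebra ω) : F (mulWeight hω a * mulWeight hω b) =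
      ‖a‖ * (‖b‖ * F (normalize hω a * normalize hω b : MeasureAlgebra S)) := by
  rw [← norm_smul_normalize hω a, ← norm_smul_normalize hω b, smul_mul_assoc, mul_smul_comm,
    map_smul, map_smul, smul_eq_mul, smul_eq_mul]

theorem norm_apply_sub_le (hω : Measurable fun x => ω x)
    (F : StrongDual ℂ (MeasureAlgebra S)) (a b : WeightedMeasureAlgebra ω) {c : ℂ}
    {ε : ℝ} (hε : 0 ≤ ε) (h : ∀ᵐ x ∂a.toMeasure.variation, ∀ᵐ y ∂b.toMeasure.variation,
      ‖(ω.Omega (x, y) : ℂ) - c‖ ≤ ε) :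
    ‖F (mulWeight hω (a * b)) - ‖a‖ *
      (‖b‖ * (c * F (normalize hω a * normalize hω b : MeasureAlgebra S)))‖ ≤
        ‖F‖ * ε * (‖a‖ * ‖b‖) := by
  have h1 : (‖a‖ : ℂ) * (‖b‖ * (c * F (normalize hω a * normalize hω b : MeasureAlgebra S))) =
      F (c • (mulWeight hω a * mulWeight hω b)) := by
    rw [map_smul, apply_mulWeight_mul, smul_eq_mul]
    ring
  rw [h1, mul_assoc, ← map_sub]
  exact F.le_opNorm_of_le (norm_mulWeight_mul_sub_le hω _ _ hε h)

/-- Approximation of `F (mulWeight (a * b))` along partitions on which `Ω` is nearly constant. -/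
theorem norm_apply_sub_tsum_le (hω : Measurable fun x => ω x)
    (F : StrongDual ℂ (MeasureAlgebra S)) (a b : WeightedMeasureAlgebra ω) {E G : ℕ → Set S}
    (hE : ∀ i, MeasurableSet (E i)) (hEd : Pairwise (Function.onFun Disjoint E))
    (hEU : ⋃ i, E i = Set.univ) (hG : ∀ i, MeasurableSet (G i))
    (hGd : Pairwise (Function.onFun Disjoint G)) (hGU : ⋃ i, G i = Set.univ) (c : ℕ → ℕ → ℂ)
    {ε : ℝ} (hε : 0 ≤ ε) (h : ∀ i j, ∀ x ∈ E i, ∀ᵐ y ∂b.toMeasure.variation, y ∈ G j →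
      ‖(ω.Omega (x, y) : ℂ) - c i j‖ ≤ ε) :
    ‖F (mulWeight hω (a * b)) - ∑' i, (‖a.restrict (E i)‖ : ℂ) *
      ∑' j, (‖b.restrict (G j)‖ : ℂ) * (c i j * F (normalize hω (a.restrict (E i)) *
        normalize hω (b.restrict (G j)) : MeasureAlgebra S))‖ ≤ ‖F‖ * ε * (‖a‖ * ‖b‖) := by
  let H : StrongDual ℂ (WeightedMeasureAlgebra ω) := F.comp (mulWeight hω).toContinuousLinearMap
  refine norm_bilin_sub_tsum_le ((ContinuousLinearMap.compL ℂ _ _ _ H).comp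
    (ContinuousLinearMap.mul ℂ (WeightedMeasureAlgebra ω)))
    (a.hasSum_restrict hE hEd hEU) (b.hasSum_restrict hG hGd hGU)
    (a.hasSum_norm_restrict hE hEd hEU) (b.hasSum_norm_restrict hG hGd hGU) fun i j => ?_
  refine norm_apply_sub_le hω F _ _ hε ?_
  rw [variation_toMeasure_restrict a (hE i), variation_toMeasure_restrict b (hG j)]
  exact ae_restrict_of_forall_mem (hE i) fun x hx => (ae_restrict_iff' (hG j)).2 (h i j x hx)

theorem norm_apply_mulWeight_mul_le (hω : Measurable fun x => ω x)
    (F : StrongDual ℂ (MeasureAlgebra S)) {a b : WeightedMeasureAlgebra ω} (ha : ‖a‖ ≤ 1)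
    (hb : ‖b‖ ≤ 1) : ‖F (mulWeight hω (a * b))‖ ≤ ‖F‖ := by
  refine F.unit_le_opNorm _ ?_
  rw [LinearIsometry.norm_map]
  exact (norm_mul_le _ _).trans (mul_le_one₀ ha (norm_nonneg _) hb)

/-- Passing to sequences leaves countably many measures `y m`, so one pair of partitions serves them
all. The approximants are averages of Ω(d_i, e_j) times F on normalised pieces, both
interchangeable. -/
theorem interchangeable_mulWeight (hω : Measurable fun x => ω x)
    (hΩ : IsCluster fun p : S × S => ((ω.Omega p : ℝ) : ℂ))
    {F : StrongDual ℂ (MeasureAlgebra S)} (hF : IsWAPFunctional F) :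
    Interchangeable fun a b : Metric.closedBall (0 : WeightedMeasureAlgebra ω) 1 =>
      F (mulWeight hω (a * b : WeightedMeasureAlgebra ω)) := by
  have hball : ∀ a : Metric.closedBall (0 : WeightedMeasureAlgebra ω) 1, ‖a.1‖ ≤ 1 := fun a =>
    mem_closedBall_zero_iff.1 a.2
  have hbd : ∀ a b : Metric.closedBall (0 : WeightedMeasureAlgebra ω) 1,
      ‖F (mulWeight hω (a * b : WeightedMeasureAlgebra ω))‖ ≤ ‖F‖ := fun a b =>
    norm_apply_mulWeight_mul_le hω F (hball a) (hball b)
  rcases isEmpty_or_nonempty S with hS | hS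
  · have h0 : ∀ a : WeightedMeasureAlgebra ω, a = 0 := fun a => by
      refine ext (VectorMeasure.ext fun E _ => ?_)
      rw [Set.eq_empty_of_isEmpty E, VectorMeasure.empty, VectorMeasure.empty]
    have h1 : ∀ a b : WeightedMeasureAlgebra ω, F (mulWeight hω (a * b)) = 0 := fun a b => by
      rw [h0 (a * b), map_zero, map_zero]
    simp only [h1]
    exact Interchangeable.of_left (C := 0) fun _ => norm_zero.le
  refine Interchangeable.of_seq hbd fun x y u v L M hu hL hv hM => ?_
  have hseq : Interchangeable fun n m : ℕ =>
      F (mulWeight hω (x n * y m : WeightedMeasureAlgebra ω)) := by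
    refine Interchangeable.of_approx (fun n m => hbd (x n) (y m)) fun ε hε => ?_
    have hK := Weight.interchangeable_Omega hΩ
    -- Each of the two partitions contributes this error, and the sum is multiplied by ‖F‖. The
    -- added 1 covers F = 0.
    have hδ : 0 < ε / (2 * (‖F‖ + 1)) := by positivity
    obtain ⟨d, E, hE, hEd, hEU, hdE⟩ := Weight.exists_partition_left hω hK
      (fun m => (y m).1.toMeasure.variation) hδ
    obtain ⟨e, G, hG, hGd, hGU, heG⟩ := Weight.exists_partition_right hω hK d hδ
    have hsum : ∀ (a : Metric.closedBall (0 : WeightedMeasureAlgebra ω) 1) {E : ℕ → Set S},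
        (∀ i, MeasurableSet (E i)) → Pairwise (Function.onFun Disjoint E) →
        ⋃ i, E i = Set.univ → Summable (fun i => ‖a.1.restrict (E i)‖) ∧
          ∑' i, ‖a.1.restrict (E i)‖ ≤ 1 := fun a E hE hEd hEU => by
      have h1 := a.1.hasSum_norm_restrict hE hEd hEU
      exact ⟨h1.summable, h1.tsum_eq.trans_le (hball a)⟩
    refine ⟨_, Interchangeable.tsum_tsum (f := fun p q : ℕ × ℕ => (ω.Omega (d p.2, e q.2) : ℂ) *
      F (normalize hω ((x p.1).1.restrict (E p.2)) * normalize hω ((y q.1).1.restrict (G q.2)) :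
        MeasureAlgebra S))
      ((hK.comp (fun p => d p.2) fun q => e q.2).mul (hF.interchangeable.comp
        (fun p : ℕ × ℕ => normalize hω ((x p.1).1.restrict (E p.2)))
        fun q : ℕ × ℕ => normalize hω ((y q.1).1.restrict (G q.2))))
      (P := fun n i => ‖(x n).1.restrict (E i)‖) (Q := fun m j => ‖(y m).1.restrict (G j)‖)
      (fun _ _ => norm_nonneg _) (fun n => (hsum (x n) hE hEd hEU).1)
      (fun n => (hsum (x n) hE hEd hEU).2) (fun _ _ => norm_nonneg _)
      (fun m => (hsum (y m) hG hGd hGU).1) (fun m => (hsum (y m) hG hGd hGU).2), fun n m => ?_⟩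
    refine (norm_apply_sub_tsum_le hω F (x n).1 (y m).1 hE hEd hEU hG hGd hGU
      (fun i j => (ω.Omega (d i, e j) : ℂ)) (ε := 2 * (ε / (2 * (‖F‖ + 1)))) (by positivity)
      fun i j s hs => ?_).trans ?_
    · filter_upwards [hdE i s hs m] with t ht htG
      refine (norm_sub_le_norm_sub_add_norm_sub _ (ω.Omega (d i, t) : ℂ) _).trans ?_
      rw [two_mul]
      exact add_le_add ht (heG j t htG i)
    · have h1 : 2 * (ε / (2 * (‖F‖ + 1))) = ε / (‖F‖ + 1) := by field_simp
      rw [h1]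
      refine (mul_le_of_le_one_right (by positivity)
        (mul_le_one₀ (hball _) (norm_nonneg _) (hball _))).trans ?_
      rw [← mul_div_assoc, div_le_iff₀ (by positivity)]
      nlinarith [norm_nonneg F]
  -- The sequential limits exist, so they agree with the limits along a free ultrafilter.
  have h1 := hseq.ulim_comm (hyperfilter ℕ) (hyperfilter ℕ)
  have hle := Nat.hyperfilter_le_atTop
  simp only [fun n => ulim_eq_of_tendsto_atTop hle (hu n),
    fun m => ulim_eq_of_tendsto_atTop hle (hv m)] at h1
  rwa [ulim_eq_of_tendsto_atTop hle hL, ulim_eq_of_tendsto_atTop hle hM] at h1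

theorem isWAPAlgebra (hω : Measurable fun x => ω x)
    (hΩ : IsCluster fun p : S × S => ((ω.Omega p : ℝ) : ℂ))
    (h : IsWAPAlgebra (MeasureAlgebra S)) : IsWAPAlgebra (WeightedMeasureAlgebra ω) :=
  h.of_isometry (mulWeight hω) fun _ hF => interchangeable_mulWeight hω hΩ hF

end WeightedMeasureAlgebra

theorem mainTheorem4 {S : Type*} [TopologicalSpace S] [T2Space S] [LocallyCompactSpace S]
    [MeasurableSpace S] [BorelSpace S] [Semigroup S] [ContinuousMul S]
    (ω : WAP.Weight S) (hω : Measurable fun x => ω x)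
    (hΩ : WAP.IsCluster fun p : S × S => ((ω.Omega p : ℝ) : ℂ)) :
    (WAP.IsWAPAlgebra (MeasureAlgebra S) → WAP.IsWAPAlgebra (WeightedMeasureAlgebra ω)) ∧
      (WAP.IsWAPAlgebra (SemigroupAlgebra S) → WAP.IsWAPAlgebra (WeightedSemigroupAlgebra ω)) := by
  exact ⟨WeightedMeasureAlgebra.isWAPAlgebra hω hΩ, WeightedSemigroupAlgebra.isWAPAlgebra hΩ⟩
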